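/- **Proposition (H-totally isotropic surfaces are Willmore).** Let $M$ be a Riemann surface and let $y:M\to S^{2m}\subset\mathbb R^{2m+1}$ be a smooth conformal immersion. *Notation.* Let $\langle x,w\rangle=-x_1w_1+\sum_{j\ge 2}x_jw_j$ on $\mathbb R^{2m+2}_1$, extended complex bilinearly. For a local complex coordinate $z$ with $\langle y_z,y_{\bar z}\rangle=\frac12e^{2\omega}$, let $Y=e^{-\omega}(1,y)$ be the canonical lift, let $V=\mathrm{Span}_{\mathbb R}\{Y,\mathrm{Re}\,Y_z,\mathrm{Im}\,Y_z,Y_{z\bar z}\}$, let $D$ be the normal connection on $V^\perp_{\mathbb C}$ (differentiation followed by orthogonal projection), and define the Schwarzian $s$ and the conformal Hopf differential $\kappa\in\Gamma(V^\perp_{\mathbb C})$ by $Y_{zz}=-\frac s2Y+\kappa$. *H-total isotropy.* Suppose that $y$ is totally isotropic, i.e. $\langle \partial_z^{j}Y,\partial_z^{l}Y\rangle=0$ for all $j,l\ge1$ and every $z$. Suppose moreover that near every point of $M$ there are a coordinate $z$ and smooth sections $E_1,\dots,E_m$ with values in $\mathbb C^{2m+2}$ such that - $\langle E_j,E_l\rangle=0$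 and $\langle E_j,\bar E_l\rangle=2\delta_{jl}$ for $1\le j,l\le m$; - $\partial_z^{j}Y\in\mathrm{Span}_{\mathbb C}\{Y,E_1,\dots,E_j\}$ for $1\le j\le m$; - $\{E_j,\bar E_j\}_{2\le j\le m}$ is a basis of $V^\perp_{\mathbb C}$ at each point; - $D_{\bar z}E_j\in\mathrm{Span}_{\mathbb C}\{E_2,\dots,E_m\}$ for $2\le j\le m$. *Conclusion.* Then $y$ is a Willmore surface: for every compact $K\subset M$ and every smooth variation $(y_t)_{|t|<\varepsilon}$ of $y=y_0$ through immersions $M\to S^{2m}$ with $y_t=y$ outside $K$, one has $\frac{d}{dt}\big|_{t=0}W_K(y_t)=0$. Here $W_K$ is the Willmore functional $W_K(y)=\int_K\frac12|\mathring h|^2\,dA$, where $\mathring h$ is the trace-free second fundamental form of the immersion into $S^{2m}$ and $dA$ is its area element; in a conformal coordinate $z=u+iv$ the integrand is $4\langle\kappa,\bar\kappa\rangle\,du\,dv=2i\langle\kappa,\bar\kappa\rangle\,dz\wedge d\bar z$. Moreover, in every local complex coordinate of $M$ the Willmore equation $$D_{\bar z}D_{\bar z}\kappa+\frac{\bar s}{2}\kappa=0$$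 holds. -/

import Mathlib

open scoped Manifold ContDiff ENNReal
open MeasureTheory

noncomputable section

namespace HIsotropic

/-! ### Calculus in a complex coordinate `z = u + i v` -/

section Wirtinger

variable {F : Type*} [NormedAddCommGroup F] [NormedSpace ℝ F]

/-- The partial derivative `∂f/∂u`. -/
def du (f : ℂ → F) (z : ℂ) : F := fderiv ℝ f z 1

/-- The partial derivative `∂f/∂v`. -/
def dv (f : ℂ → F) (z : ℂ) : F := fderiv ℝ f z Complex.I

/-- The Wirtinger derivative `∂f/∂z = (f_u - i f_v) / 2`. -/
def dz [NormedSpace ℂ F] (f : ℂ → F) (z : ℂ) : F :=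
  (1 / 2 : ℂ) • (du f z - Complex.I • dv f z)

/-- The Wirtinger derivative `∂f/∂z̄ = (f_u + i f_v) / 2`. -/
def dzbar [NormedSpace ℂ F] (f : ℂ → F) (z : ℂ) : F :=
  (1 / 2 : ℂ) • (du f z + Complex.I • dv f z)

end Wirtinger

/-! ### The complexified Minkowski space -/

/-- Euclidean space `ℝ^{d+1}`, which contains the sphere `S^d`. -/
abbrev Euc (d : ℕ) : Type := EuclideanSpace ℝ (Fin (d + 1))

/-- The unit sphere `S^d`. -/
abbrev Sph (d : ℕ) : Type := Metric.sphere (0 : Euc d) 1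

/-- The complexification `ℂ^{d+2}` of the Minkowski space `ℝ^{d+2}_1`; conjugation is `star`. -/
abbrev Mink (d : ℕ) : Type := Fin (d + 2) → ℂ

/-- The complex bilinear extension of the Lorentzian metric `-x₁y₁ + x₂y₂ + ⋯`. -/
def mink {d : ℕ} (a b : Mink d) : ℂ :=
  -(a 0 * b 0) + ∑ i : Fin (d + 1), a i.succ * b i.succ

/-- The point `(1, x)` of the forward light cone over a point `x` of the sphere. -/
def conePoint {d : ℕ} (x : Euc d) : Mink d :=
  Fin.cons (1 : ℂ) (fun i => ((x i : ℝ) : ℂ))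

/-! ### The conformal invariants of a surface in a complex coordinate

Here `f : ℂ → ℝ^{d+1}` is a conformal immersion into the sphere, written in a complex coordinate,
and `Y : ℂ → ℂ^{d+2}` is its canonical lift. -/

/-- `e^ω`, where `⟨f_z, f_z̄⟩ = e^{2ω} / 2`, that is `e^{2ω} = (|f_u|² + |f_v|²) / 2`. -/
def expOmega {d : ℕ} (f : ℂ → Euc d) (z : ℂ) : ℝ :=
  Real.sqrt ((‖du f z‖ ^ 2 + ‖dv f z‖ ^ 2) / 2)

/-- The canonical lift `Y = e^{-ω} (1, f)`, the lift to the forward light cone with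
`|dY|² = |dz|²`. -/
def canonicalLift {d : ℕ} (f : ℂ → Euc d) (z : ℂ) : Mink d :=
  (((expOmega f z)⁻¹ : ℝ) : ℂ) • conePoint (f z)

/-- The section `N = 2 Y_{z z̄} + 2 ⟨Y_{z z̄}, Y_{z z̄}⟩ Y` of `V`, determined by
`⟨N, Y_z⟩ = ⟨N, Y_z̄⟩ = ⟨N, N⟩ = 0` and `⟨N, Y⟩ = -1`. -/
def sectionN {d : ℕ} (Y : ℂ → Mink d) (z : ℂ) : Mink d :=
  let Yzz' := dzbar (dz Y) z
  (2 : ℂ) • Yzz' + (2 * mink Yzz' Yzz') • Y z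

/-- The fibre at `z` of `V^⊥_ℂ`, the complexified orthogonal complement of
`V = Span {Y, Re Y_z, Im Y_z, Y_{z z̄}}`. -/
def normalSpace {d : ℕ} (Y : ℂ → Mink d) (z : ℂ) : Set (Mink d) :=
  {ψ | mink ψ (Y z) = 0 ∧ mink ψ (dz Y z) = 0 ∧ mink ψ (dzbar Y z) = 0 ∧
    mink ψ (dzbar (dz Y) z) = 0}

/-- The orthogonal projection to `V^⊥_ℂ` at `z`, written out in the frame `Y, Y_z, Y_z̄, N` of
`V_ℂ`, in which the only non-zero products are `⟨Y, N⟩ = -1` and `⟨Y_z, Y_z̄⟩ = 1/2`. -/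
def normalProj {d : ℕ} (Y : ℂ → Mink d) (z : ℂ) (x : Mink d) : Mink d :=
  x + mink x (sectionN Y z) • Y z + mink x (Y z) • sectionN Y z
    - (2 * mink x (dzbar Y z)) • dz Y z - (2 * mink x (dz Y z)) • dzbar Y z

/-- The normal connection in the direction `∂/∂z̄`. -/
def normalDzbar {d : ℕ} (Y : ℂ → Mink d) (ψ : ℂ → Mink d) (z : ℂ) : Mink d :=
  normalProj Y z (dzbar ψ z)

/-- The Schwarzian `s`: pairing `Y_zz = -(s/2) Y + κ` with `N` gives `s = 2 ⟨Y_zz, N⟩`. -/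
def schwarzian {d : ℕ} (Y : ℂ → Mink d) (z : ℂ) : ℂ :=
  2 * mink (dz (dz Y) z) (sectionN Y z)

/-- The conformal Hopf differential `κ = Y_zz + (s/2) Y`. -/
def hopf {d : ℕ} (Y : ℂ → Mink d) (z : ℂ) : Mink d :=
  dz (dz Y) z + (schwarzian Y z / 2) • Y z

/-- The left hand side `D_z̄ D_z̄ κ + (s̄/2) κ` of the Willmore equation. -/
def willmoreOperator {d : ℕ} (Y : ℂ → Mink d) (z : ℂ) : Mink d :=
  normalDzbar Y (normalDzbar Y (hopf Y)) z + (star (schwarzian Y z) / 2) • hopf Y z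

/-- The conditions on a frame `E₁, …, E_m` over the coordinate domain `U` (indices outside
`1, …, m` are not used): it is smooth, `⟨E_j, E_l⟩ = 0`, `⟨E_j, Ē_l⟩ = 2 δ_{jl}`, the `j`-th
derivative of `Y` by `z` lies in the span of `Y, E₁, …, E_j`, and the `E_j, Ē_j` with
`2 ≤ j ≤ m` span `V^⊥_ℂ` (they are linearly independent by the preceding relations). -/
structure IsAdaptedIsotropicFrame {d : ℕ} (m : ℕ) (Y : ℂ → Mink d) (U : Set ℂ)
    (E : ℕ → ℂ → Mink d) : Prop where
  smooth : ∀ j ∈ Finset.Icc 1 m, ContDiffOn ℝ ∞ (E j) U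
  isotropic : ∀ z ∈ U, ∀ j ∈ Finset.Icc 1 m, ∀ l ∈ Finset.Icc 1 m, mink (E j z) (E l z) = 0
  hermitian : ∀ z ∈ U, ∀ j ∈ Finset.Icc 1 m, ∀ l ∈ Finset.Icc 1 m,
    mink (E j z) (star (E l z)) = if j = l then 2 else 0
  flag : ∀ z ∈ U, ∀ j ∈ Finset.Icc 1 m,
    (dz^[j] Y) z ∈ Submodule.span ℂ ({Y z} ∪ {x | ∃ l ∈ Finset.Icc 1 j, x = E l z})
  span_normal : ∀ z ∈ U,
    (Submodule.span ℂ {x | ∃ j ∈ Finset.Icc 2 m, x = E j z ∨ x = star (E j z)} : Set (Mink d))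
      = normalSpace Y z

/-! ### The Willmore density of an immersion in a real coordinate system -/

/-- The coordinate directions `∂/∂u, ∂/∂v`. -/
def coordDir : Fin 2 → ℂ := ![1, Complex.I]

/-- The coordinate vector fields `f_u, f_v`. -/
def partialDeriv {d : ℕ} (f : ℂ → Euc d) (i : Fin 2) (z : ℂ) : Euc d :=
  fderiv ℝ f z (coordDir i)

/-- The first fundamental form `g_{ij} = ⟨∂_i f, ∂_j f⟩`. -/
def firstForm {d : ℕ} (f : ℂ → Euc d) (z : ℂ) : Matrix (Fin 2) (Fin 2) ℝ :=
  Matrix.of fun i j => inner ℝ (partialDeriv f i z) (partialDeriv f j z)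

/-- The second fundamental form `h_{ij}` of the surface in the sphere: the component of
`∂_i ∂_j f` orthogonal to `f`, `f_u` and `f_v`. -/
def secondForm {d : ℕ} (f : ℂ → Euc d) (z : ℂ) (i j : Fin 2) : Euc d :=
  ((Submodule.span ℝ {f z, partialDeriv f 0 z, partialDeriv f 1 z})ᗮ).starProjection
    (partialDeriv (partialDeriv f j) i z)

/-- The mean curvature vector `H = (1/2) ∑ g^{ij} h_{ij}`. -/
def meanCurvature {d : ℕ} (f : ℂ → Euc d) (z : ℂ) : Euc d :=
  (1 / 2 : ℝ) • ∑ i, ∑ j, (firstForm f z)⁻¹ i j • secondForm f z i j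

/-- The trace-free second fundamental form `h_{ij} - g_{ij} H`. -/
def traceFreeForm {d : ℕ} (f : ℂ → Euc d) (z : ℂ) (i j : Fin 2) : Euc d :=
  secondForm f z i j - firstForm f z i j • meanCurvature f z

/-- The density with respect to `du dv` of `(1/2) |h - g H|² dA = (|H|² - K + 1) dA`. It makes
sense for an immersion in arbitrary coordinates (the members of a variation of a conformal
immersion are not conformal in the given coordinate); in a conformal coordinate it is
`4 ⟨κ, κ̄⟩`, by `willmoreDensity_eq` below, and then `(1/2) |h - g H|² dA` is
`2 i ⟨κ, κ̄⟩ dz ∧ dz̄`. -/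
def willmoreDensity {d : ℕ} (f : ℂ → Euc d) (z : ℂ) : ℝ :=
  (1 / 2) * (∑ i, ∑ j, ∑ k, ∑ l, (firstForm f z)⁻¹ i k * (firstForm f z)⁻¹ j l *
      inner ℝ (traceFreeForm f z i j) (traceFreeForm f z k l)) *
    Real.sqrt (firstForm f z).det

/-! ### The density in a conformal coordinate -/

section Conformal

/-- The point `(α, x)` of the real Minkowski space. -/
def realPoint {d : ℕ} (α : ℝ) (x : Euc d) : Mink d :=
  Fin.cons (α : ℂ) (fun i => ((x i : ℝ) : ℂ))

theorem mink_realPoint {d : ℕ} (α β : ℝ) (x y : Euc d) :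
    mink (realPoint α x) (realPoint β y) = ((-(α * β) + inner ℝ x y : ℝ) : ℂ) := by
  simp [mink, realPoint, PiLp.inner_apply, mul_comm]

theorem star_realPoint {d : ℕ} (α : ℝ) (x : Euc d) :
    star (realPoint α x) = realPoint α x := by
  funext i
  refine Fin.cases ?_ (fun i => ?_) i <;> simp [realPoint]

theorem realPoint_add {d : ℕ} (α β : ℝ) (x y : Euc d) :
    realPoint α x + realPoint β y = realPoint (α + β) (x + y) := by
  funext i
  refine Fin.cases ?_ (fun i => ?_) i <;> simp [realPoint]

theorem realPoint_sub {d : ℕ} (α β : ℝ) (x y : Euc d) :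
    realPoint α x - realPoint β y = realPoint (α - β) (x - y) := by
  funext i
  refine Fin.cases ?_ (fun i => ?_) i <;> simp [realPoint]

theorem fderiv_realPoint {d : ℕ} {α : ℂ → ℝ} {x : ℂ → Euc d} {z : ℂ}
    (hα : DifferentiableAt ℝ α z) (hx : DifferentiableAt ℝ x z) :
    DifferentiableAt ℝ (fun w => realPoint (α w) (x w)) z ∧
    ∀ e, fderiv ℝ (fun w => realPoint (α w) (x w)) z e =
      realPoint (fderiv ℝ α z e) (fderiv ℝ x z e) := by
  let C : (ℝ × Euc d) →ₗ[ℝ] Mink d :=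
    { toFun := fun q => realPoint q.1 q.2
      map_add' := fun p q => (realPoint_add _ _ _ _).symm
      map_smul' := fun c q => by
        funext i
        refine Fin.cases ?_ (fun i => ?_) i <;> simp [realPoint] }
  have h := (LinearMap.toContinuousLinearMap C).hasFDerivAt.comp z
    (hα.hasFDerivAt.prodMk hx.hasFDerivAt)
  have h' : HasFDerivAt (fun w => realPoint (α w) (x w)) _ z := h
  refine ⟨h'.differentiableAt, fun e => ?_⟩
  rw [h'.fderiv]
  rfl

theorem mink_combination {d : ℕ} (R S Y : Mink d) (c : ℂ) (hR : star R = R) (hS : star S = S)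
    (hY : star Y = Y) (hYY : mink Y Y = 0) (hRY : mink R Y = 0) (hSY : mink S Y = 0) :
    mink ((1 / 4 : ℂ) • (R - Complex.I • S) + c • Y)
      (star ((1 / 4 : ℂ) • (R - Complex.I • S) + c • Y)) = (mink R R + mink S S) / 16 := by
  have key : ∀ a b a' b' : ℂ, mink ((1 / 4 : ℂ) • (R - a • S) + b • Y)
      ((1 / 4 : ℂ) • (R - a' • S) + b' • Y) =
      (1 / 16) * (mink R R - (a + a') * mink R S + a * a' * mink S S) +
      (1 / 4) * ((b + b') * mink R Y - (a * b' + b * a') * mink S Y) + b * b' * mink Y Y := by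
    intro a b a' b'
    simp only [mink, Pi.add_apply, Pi.sub_apply, Pi.smul_apply, smul_eq_mul, mul_add, mul_sub,
      Finset.mul_sum]
    rw [← sub_eq_zero]
    ring_nf
    simp only [Finset.sum_add_distrib, ← Finset.mul_sum, ← Finset.sum_mul]
    ring_nf
  have hst : star ((1 / 4 : ℂ) • (R - Complex.I • S) + c • Y) =
      (1 / 4 : ℂ) • (R - (-Complex.I) • S) + (star c) • Y := by
    rw [star_add, star_smul, star_smul, star_sub, star_smul, hR, hS, hY]
    simp
  rw [hst, key, hYY, hRY, hSY]
  have : Complex.I * Complex.I = -1 := Complex.I_mul_I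
  linear_combination (-(1 / 16) * mink S S) * this

theorem contDiffAt_fderiv_apply {F : Type*} [NormedAddCommGroup F] [NormedSpace ℝ F] {h : ℂ → F}
    {z : ℂ} (hh : ContDiffAt ℝ ∞ h z) (e : ℂ) : ContDiffAt ℝ ∞ (fun w => fderiv ℝ h w e) z :=
  (hh.fderiv_right (m := ∞) (by simp)).clm_apply contDiffAt_const

theorem fderiv_fderiv_smul {F : Type*} [NormedAddCommGroup F] [NormedSpace ℝ F] {l : ℂ → ℝ}
    {h : ℂ → F} {U : Set ℂ} (hU : IsOpen U) (hl : ContDiffOn ℝ ∞ l U) (hh : ContDiffOn ℝ ∞ h U)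
    {z : ℂ} (hz : z ∈ U) (e e' : ℂ) :
    fderiv ℝ (fun w => fderiv ℝ (fun w => l w • h w) w e) z e' =
      fderiv ℝ (fun w => fderiv ℝ l w e) z e' • h z + fderiv ℝ l z e • fderiv ℝ h z e' +
      fderiv ℝ l z e' • fderiv ℝ h z e + l z • fderiv ℝ (fun w => fderiv ℝ h w e) z e' := by
  have hl' := fun w (hw : w ∈ U) => hl.contDiffAt (hU.mem_nhds hw)
  have hh' := fun w (hw : w ∈ U) => hh.contDiffAt (hU.mem_nhds hw)
  have h0 : (∞ : WithTop ℕ∞) ≠ 0 := by simp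
  have h1 : (fun w => fderiv ℝ (fun w => l w • h w) w e) =ᶠ[nhds z]
      fun w => l w • fderiv ℝ h w e + fderiv ℝ l w e • h w := by
    filter_upwards [hU.mem_nhds hz] with w hw
    rw [fderiv_fun_smul ((hl' w hw).differentiableAt h0) ((hh' w hw).differentiableAt h0)]
    simp
  have dl := (hl' z hz).differentiableAt h0
  have dh := (hh' z hz).differentiableAt h0
  have dl1 := (contDiffAt_fderiv_apply (hl' z hz) e).differentiableAt h0
  have dh1 := (contDiffAt_fderiv_apply (hh' z hz) e).differentiableAt h0
  rw [h1.fderiv_eq, fderiv_fun_add (dl.fun_smul dh1) (dl1.fun_smul dh), fderiv_fun_smul dl dh1,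
    fderiv_fun_smul dl1 dh]
  simp
  abel

theorem dz_dz_realPoint {d : ℕ} {α : ℂ → ℝ} {x : ℂ → Euc d} {U : Set ℂ} (hU : IsOpen U)
    (hα : ContDiffOn ℝ ∞ α U) (hx : ContDiffOn ℝ ∞ x U) {z : ℂ} (hz : z ∈ U) :
    dz (dz (fun w => realPoint (α w) (x w))) z = (1 / 4 : ℂ) •
      (realPoint (du (du α) z - dv (dv α) z) (du (du x) z - dv (dv x) z) -
        Complex.I • realPoint (du (dv α) z + dv (du α) z) (du (dv x) z + dv (du x) z)) := by
  have ha' := fun w (hw : w ∈ U) => hα.contDiffAt (hU.mem_nhds hw)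
  have hx' := fun w (hw : w ∈ U) => hx.contDiffAt (hU.mem_nhds hw)
  have h0 : (∞ : WithTop ℕ∞) ≠ 0 := by simp
  have h1 : dz (fun w => realPoint (α w) (x w)) =ᶠ[nhds z] fun w => (1 / 2 : ℂ) •
      (realPoint (du α w) (du x w) - Complex.I • realPoint (dv α w) (dv x w)) := by
    filter_upwards [hU.mem_nhds hz] with w hw
    have := (fderiv_realPoint ((ha' w hw).differentiableAt h0)
      ((hx' w hw).differentiableAt h0)).2
    simp only [dz, du, dv, this]
  have hR := fun e => fderiv_realPoint
    ((contDiffAt_fderiv_apply (ha' z hz) e).differentiableAt h0)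
    ((contDiffAt_fderiv_apply (hx' z hz) e).differentiableAt h0)
  have h2 : HasFDerivAt (fun w => (1 / 2 : ℂ) •
      (realPoint (du α w) (du x w) - Complex.I • realPoint (dv α w) (dv x w)))
      ((1 / 2 : ℂ) • (fderiv ℝ (fun w => realPoint (du α w) (du x w)) z -
        Complex.I • fderiv ℝ (fun w => realPoint (dv α w) (dv x w)) z)) z :=
    ((hR 1).1.hasFDerivAt.fun_sub
      ((hR Complex.I).1.hasFDerivAt.fun_const_smul Complex.I)).fun_const_smul (1 / 2 : ℂ)
  have h3 : ∀ e, fderiv ℝ (dz (fun w => realPoint (α w) (x w))) z e = (1 / 2 : ℂ) •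
      (realPoint (fderiv ℝ (du α) z e) (fderiv ℝ (du x) z e) -
        Complex.I • realPoint (fderiv ℝ (dv α) z e) (fderiv ℝ (dv x) z e)) := by
    intro e
    rw [h1.fderiv_eq, h2.fderiv]
    have e1 := (hR 1).2 e
    have e2 := (hR Complex.I).2 e
    simp only [du, dv]
    simp only [_root_.smul_apply, _root_.sub_apply, e1, e2]
    rfl
  rw [dz, du, dv, h3, h3]
  simp only [← realPoint_add, ← realPoint_sub]
  have hI : Complex.I * Complex.I = -1 := Complex.I_mul_I
  funext i
  have hd : ∀ {F : Type} [NormedAddCommGroup F] [NormedSpace ℝ F] (k : ℂ → F),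
      du k z = fderiv ℝ k z 1 ∧ dv k z = fderiv ℝ k z Complex.I := fun k => ⟨rfl, rfl⟩
  simp only [hd, Pi.smul_apply, Pi.sub_apply, Pi.add_apply, smul_eq_mul]
  linear_combination (1 / 4 : ℂ) * realPoint (fderiv ℝ (dv α) z Complex.I) (fderiv ℝ (dv x) z Complex.I) i * hI

theorem du_dv_comm {d : ℕ} {f : ℂ → Euc d} {z : ℂ} (hf : ContDiffAt ℝ ∞ f z) :
    dv (du f) z = du (dv f) z := by
  have hs : IsSymmSndFDerivAt ℝ f z :=
    hf.isSymmSndFDerivAt (by rw [minSmoothness_of_isRCLikeNormedField]; exact WithTop.coe_le_coe.2 le_top)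
  have hd : DifferentiableAt ℝ (fderiv ℝ f) z :=
    (hf.fderiv_right (m := ∞) (by simp)).differentiableAt (by simp)
  have h : ∀ e e' : ℂ, fderiv ℝ (fun w => fderiv ℝ f w e) z e' = fderiv ℝ (fderiv ℝ f) z e' e := by
    intro e e'
    rw [fderiv_clm_apply hd (differentiableAt_const e)]
    simp
  change fderiv ℝ (fun w => fderiv ℝ f w 1) z Complex.I =
    fderiv ℝ (fun w => fderiv ℝ f w Complex.I) z 1
  rw [h, h]
  exact hs _ _

theorem fderiv_inner_eqOn {d : ℕ} {f g : ℂ → Euc d} {c : ℂ → ℝ} {U : Set ℂ} (hU : IsOpen U)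
    (hc : ∀ w ∈ U, inner ℝ (f w) (g w) = c w) {z : ℂ} (hz : z ∈ U)
    (hf : DifferentiableAt ℝ f z) (hg : DifferentiableAt ℝ g z) (e : ℂ) :
    fderiv ℝ c z e = inner ℝ (f z) (fderiv ℝ g z e) + inner ℝ (fderiv ℝ f z e) (g z) := by
  have h : c =ᶠ[nhds z] fun w => inner ℝ (f w) (g w) := by
    filter_upwards [hU.mem_nhds hz] with w hw using (hc w hw).symm
  rw [h.fderiv_eq, fderiv_inner_apply ℝ hf hg]

theorem orthProj_eq {d : ℕ} {n a b : Euc d} {L : ℝ} (hL : L ≠ 0) (hn : inner ℝ n n = (1 : ℝ))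
    (ha : inner ℝ a a = L) (hb : inner ℝ b b = L) (hna : inner ℝ n a = (0 : ℝ))
    (hnb : inner ℝ n b = (0 : ℝ)) (hab : inner ℝ a b = (0 : ℝ)) (x : Euc d) :
    ((Submodule.span ℝ {n, a, b})ᗮ).starProjection x =
      x - (inner ℝ n x : ℝ) • n - (L⁻¹ * inner ℝ a x) • a - (L⁻¹ * inner ℝ b x) • b := by
  have han : inner ℝ a n = (0 : ℝ) := by rw [real_inner_comm, hna]
  have hbn : inner ℝ b n = (0 : ℝ) := by rw [real_inner_comm, hnb]
  have hba : inner ℝ b a = (0 : ℝ) := by rw [real_inner_comm, hab]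
  apply Submodule.eq_starProjection_of_mem_orthogonal
  · rw [Submodule.mem_orthogonal]
    intro u hu
    induction hu using Submodule.span_induction with
    | mem u hu =>
      simp only [Set.mem_insert_iff, Set.mem_singleton_iff] at hu
      rcases hu with rfl | rfl | rfl <;>
        simp only [inner_sub_right, inner_smul_right, *] <;> field_simp <;> ring
    | zero => simp
    | add u v _ _ hu hv => rw [inner_add_left, hu, hv, add_zero]
    | smul c u _ hu => rw [inner_smul_left, hu, mul_zero]
  · rw [Submodule.orthogonal_orthogonal]
    have h1 : n ∈ Submodule.span ℝ {n, a, b} := Submodule.subset_span (by simp)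
    have h2 : a ∈ Submodule.span ℝ {n, a, b} := Submodule.subset_span (by simp)
    have h3 : b ∈ Submodule.span ℝ {n, a, b} := Submodule.subset_span (by simp)
    have : x - (x - (inner ℝ n x : ℝ) • n - (L⁻¹ * inner ℝ a x) • a - (L⁻¹ * inner ℝ b x) • b) =
      (inner ℝ n x : ℝ) • n + (L⁻¹ * inner ℝ a x) • a + (L⁻¹ * inner ℝ b x) • b := by abel
    rw [this]
    exact add_mem (add_mem (Submodule.smul_mem _ _ h1) (Submodule.smul_mem _ _ h2))
      (Submodule.smul_mem _ _ h3)

theorem inner_orthProj {d : ℕ} {n a b : Euc d} {L : ℝ} (hL : L ≠ 0) (hn : inner ℝ n n = (1 : ℝ))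
    (ha : inner ℝ a a = L) (hb : inner ℝ b b = L) (hna : inner ℝ n a = (0 : ℝ))
    (hnb : inner ℝ n b = (0 : ℝ)) (hab : inner ℝ a b = (0 : ℝ)) (x : Euc d) :
    inner ℝ (((Submodule.span ℝ {n, a, b})ᗮ).starProjection x)
      (((Submodule.span ℝ {n, a, b})ᗮ).starProjection x) =
      (inner ℝ x x : ℝ) - (inner ℝ n x) ^ 2 - L⁻¹ * (inner ℝ a x) ^ 2 -
        L⁻¹ * (inner ℝ b x) ^ 2 := by
  rw [orthProj_eq hL hn ha hb hna hnb hab]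
  have han : inner ℝ a n = (0 : ℝ) := by rw [real_inner_comm, hna]
  have hbn : inner ℝ b n = (0 : ℝ) := by rw [real_inner_comm, hnb]
  have hba : inner ℝ b a = (0 : ℝ) := by rw [real_inner_comm, hab]
  have e1 := real_inner_comm n x
  have e2 := real_inner_comm a x
  have e3 := real_inner_comm b x
  simp only [inner_sub_right, inner_sub_left, inner_smul_right, real_inner_smul_left, hn, ha, hb,
    hna, hnb, hab, han, hbn, hba, e1, e2, e3]
  field_simp
  ring

theorem willmoreDensity_eq_second {d : ℕ} {f : ℂ → Euc d} {z : ℂ} {L : ℝ} (hL : 0 < L)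
    (ha : inner ℝ (du f z) (du f z) = L) (hb : inner ℝ (dv f z) (dv f z) = L)
    (hab : inner ℝ (du f z) (dv f z) = (0 : ℝ)) (hs : dv (du f) z = du (dv f) z) :
    willmoreDensity f z = L⁻¹ *
      (inner ℝ (secondForm f z 0 0 - secondForm f z 1 1)
        (secondForm f z 0 0 - secondForm f z 1 1) / 4 +
      inner ℝ (secondForm f z 0 1) (secondForm f z 0 1)) := by
  have hg : firstForm f z = Matrix.diagonal fun _ => L := by
    ext i j
    have hba : inner ℝ (dv f z) (du f z) = (0 : ℝ) := by rw [real_inner_comm, hab]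
    fin_cases i <;> fin_cases j <;>
      simp only [firstForm, partialDeriv, coordDir, Matrix.of_apply] <;>
      first
        | exact ha
        | exact hb
        | exact hab
        | exact hba
  have hinv : (firstForm f z)⁻¹ = Matrix.diagonal fun _ => L⁻¹ := by
    rw [hg]
    apply Matrix.inv_eq_right_inv
    rw [Matrix.diagonal_mul_diagonal]
    simp [hL.ne']
  have hdet : Real.sqrt (firstForm f z).det = L := by
    rw [hg, Matrix.det_diagonal]
    simp only [Finset.prod_const, Finset.card_univ, Fintype.card_fin]
    exact Real.sqrt_sq hL.le
  have hsym : secondForm f z 1 0 = secondForm f z 0 1 := by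
    have : partialDeriv (partialDeriv f 0) 1 z = partialDeriv (partialDeriv f 1) 0 z := hs
    rw [secondForm, secondForm, this]
  have hH : meanCurvature f z =
      (1 / 2 * L⁻¹ : ℝ) • (secondForm f z 0 0 + secondForm f z 1 1) := by
    rw [meanCurvature, hinv]
    simp [Fin.sum_univ_two, smul_smul, smul_add]
  have t00 : traceFreeForm f z 0 0 =
      (1 / 2 : ℝ) • (secondForm f z 0 0 - secondForm f z 1 1) := by
    rw [traceFreeForm, hH, hg, Matrix.diagonal_apply_eq, smul_smul,
      show L * (1 / 2 * L⁻¹) = 1 / 2 by field_simp]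
    module
  have t11 : traceFreeForm f z 1 1 =
      (-1 / 2 : ℝ) • (secondForm f z 0 0 - secondForm f z 1 1) := by
    rw [traceFreeForm, hH, hg, Matrix.diagonal_apply_eq, smul_smul,
      show L * (1 / 2 * L⁻¹) = 1 / 2 by field_simp]
    module
  have t01 : traceFreeForm f z 0 1 = secondForm f z 0 1 := by
    rw [traceFreeForm, hg, Matrix.diagonal_apply_ne _ (by decide)]
    simp
  have t10 : traceFreeForm f z 1 0 = secondForm f z 0 1 := by
    rw [traceFreeForm, hg, Matrix.diagonal_apply_ne _ (by decide), hsym]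
    simp
  rw [willmoreDensity, hdet, hinv]
  simp only [Fin.sum_univ_two, Matrix.diagonal_apply_eq, t00, t01, t10, t11,
    Matrix.diagonal_apply_ne _ (show (0 : Fin 2) ≠ 1 by decide),
    Matrix.diagonal_apply_ne _ (show (1 : Fin 2) ≠ 0 by decide), real_inner_smul_left,
    real_inner_smul_right]
  field_simp
  ring

theorem density_algebra {d : ℕ} (n a b p q r : Euc d) (l L lu lv Lu Lv x y x' y' : ℝ)
    (hl : l ^ 2 * L = 1) (hlu : 2 * lu = -l ^ 3 * Lu) (hlv : 2 * lv = -l ^ 3 * Lv)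
    (nn : inner ℝ n n = (1 : ℝ)) (na : inner ℝ n a = (0 : ℝ)) (nb : inner ℝ n b = (0 : ℝ))
    (ab : inner ℝ a b = (0 : ℝ)) (aa : inner ℝ a a = L) (bb : inner ℝ b b = L)
    (np : 0 = inner ℝ n p + inner ℝ a a) (nq : 0 = inner ℝ n q + inner ℝ a b)
    (nr : 0 = inner ℝ n r + inner ℝ b b) (ap : Lu = inner ℝ a p + inner ℝ p a)
    (aq : Lv = inner ℝ a q + inner ℝ q a) (bq : Lu = inner ℝ b q + inner ℝ q b)
    (br : Lv = inner ℝ b r + inner ℝ r b) (bp : 0 = inner ℝ a q + inner ℝ p b)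
    (ar : 0 = inner ℝ a r + inner ℝ q b) :
    L⁻¹ * ((inner ℝ (p - r) (p - r) - inner ℝ n (p - r) ^ 2 - L⁻¹ * inner ℝ a (p - r) ^ 2 -
        L⁻¹ * inner ℝ b (p - r) ^ 2) / 4 +
      (inner ℝ q q - inner ℝ n q ^ 2 - L⁻¹ * inner ℝ a q ^ 2 - L⁻¹ * inner ℝ b q ^ 2)) =
    4 * ((-((x - y) * (x - y)) + inner ℝ
        (x • n + lu • a + lu • a + l • p - (y • n + lv • b + lv • b + l • r))
        (x • n + lu • a + lu • a + l • p - (y • n + lv • b + lv • b + l • r)) +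
      (-((x' + y') * (x' + y')) + inner ℝ
        (x' • n + lv • a + lu • b + l • q + (y' • n + lu • b + lv • a + l • q))
        (x' • n + lv • a + lu • b + l • q + (y' • n + lu • b + lv • a + l • q)))) / 16) ∧
    inner ℝ (x • n + lu • a + lu • a + l • p - (y • n + lv • b + lv • b + l • r)) n = x - y ∧
    inner ℝ (x' • n + lv • a + lu • b + l • q + (y' • n + lu • b + lv • a + l • q)) n = x' + y' := by
  have hL : L⁻¹ = l ^ 2 := by
    have : L ≠ 0 := by rintro rfl; simp at hl
    field_simp
    linarith
  rw [real_inner_comm] at ap aq bq br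
  rw [real_inner_comm b p] at bp
  rw [real_inner_comm b q] at ar
  have np' : inner ℝ n p = -L := by linarith
  have nr' : inner ℝ n r = -L := by linarith
  have nq' : inner ℝ n q = (0 : ℝ) := by linarith
  have pa' : inner ℝ p a = Lu / 2 := by linarith [real_inner_comm a p]
  have qa' : inner ℝ q a = Lv / 2 := by linarith [real_inner_comm a q]
  have qb' : inner ℝ q b = Lu / 2 := by linarith [real_inner_comm b q]
  have rb' : inner ℝ r b = Lv / 2 := by linarith [real_inner_comm b r]
  have pb' : inner ℝ p b = -Lv / 2 := by linarith [real_inner_comm b p, real_inner_comm a q]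
  have ra' : inner ℝ r a = -Lu / 2 := by linarith [real_inner_comm a r, real_inner_comm b q]
  have hlu' : lu = -l ^ 3 * Lu / 2 := by linarith
  have hlv' : lv = -l ^ 3 * Lv / 2 := by linarith
  simp only [inner_sub_left, inner_sub_right, inner_add_left, inner_add_right,
    real_inner_smul_left, real_inner_smul_right, nn, aa, bb, na, nb, ab, np', nr', nq', pa', qa',
    qb', rb', pb', ra', hL, real_inner_comm n p, real_inner_comm n q, real_inner_comm n r,
    real_inner_comm n a, real_inner_comm n b, real_inner_comm a b, real_inner_comm p a,
    real_inner_comm q a, real_inner_comm r a, real_inner_comm p b, real_inner_comm q b,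
    real_inner_comm r b, real_inner_comm p r]
  refine ⟨?_, ?_, ?_⟩
  · rw [hlu', hlv']
    linear_combination (-(1 / 2) * l ^ 4 * (Lu ^ 2 + Lv ^ 2)) * hl
  · ring
  · ring

/-- In a conformal coordinate the Willmore density is `4 ⟨κ, κ̄⟩`. -/
theorem willmoreDensity_eq {d : ℕ} {f : ℂ → Euc d} {U : Set ℂ} (hU : IsOpen U)
    (hf : ContDiffOn ℝ ∞ f U) (hsph : ∀ w ∈ U, ‖f w‖ = 1) (himm : ∀ w ∈ U, du f w ≠ 0)
    (hconf : ∀ w ∈ U, ‖du f w‖ = ‖dv f w‖ ∧ inner ℝ (du f w) (dv f w) = (0 : ℝ))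
    {z : ℂ} (hz : z ∈ U) :
    (willmoreDensity f z : ℂ) =
      4 * mink (hopf (canonicalLift f) z) (star (hopf (canonicalLift f) z)) := by
  have h0 : (∞ : WithTop ℕ∞) ≠ 0 := by simp
  have hf' := fun w (hw : w ∈ U) => hf.contDiffAt (hU.mem_nhds hw)
  have hfu : ContDiffOn ℝ ∞ (du f) U := fun w hw =>
    (contDiffAt_fderiv_apply (hf' w hw) 1).contDiffWithinAt
  have hfv : ContDiffOn ℝ ∞ (dv f) U := fun w hw =>
    (contDiffAt_fderiv_apply (hf' w hw) Complex.I).contDiffWithinAt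
  have df := (hf' z hz).differentiableAt h0
  have dfu := (hfu.contDiffAt (hU.mem_nhds hz)).differentiableAt h0
  have dfv := (hfv.contDiffAt (hU.mem_nhds hz)).differentiableAt h0
  set L : ℂ → ℝ := fun w => inner ℝ (du f w) (du f w) with hLdef
  have hLv : ∀ w ∈ U, inner ℝ (dv f w) (dv f w) = L w := by
    intro w hw
    rw [hLdef]
    simp only [real_inner_self_eq_norm_sq, (hconf w hw).1]
  have hLpos : ∀ w ∈ U, 0 < L w := fun w hw => real_inner_self_pos.2 (himm w hw)
  have hLsm : ContDiffOn ℝ ∞ L U := hfu.inner ℝ hfu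
  set l : ℂ → ℝ := fun w => (expOmega f w)⁻¹ with hldef
  have hexp : ∀ w ∈ U, expOmega f w = Real.sqrt (L w) := by
    intro w hw
    rw [expOmega, ← (hconf w hw).1, hLdef]
    simp only [real_inner_self_eq_norm_sq]
    congr 1
    ring
  have hl2 : ∀ w ∈ U, l w ^ 2 * L w = 1 := by
    intro w hw
    have := hLpos w hw
    simp only [hldef, hexp w hw, inv_pow, Real.sq_sqrt this.le]
    exact inv_mul_cancel₀ this.ne'
  have hlsm : ContDiffOn ℝ ∞ l U := by
    have : ContDiffOn ℝ ∞ (fun w => (Real.sqrt (L w))⁻¹) U :=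
      (hLsm.sqrt fun w hw => (hLpos w hw).ne').inv fun w hw => (Real.sqrt_pos.2 (hLpos w hw)).ne'
    exact this.congr fun w hw => by simp only [hldef, hexp w hw]
  have dl := (hlsm.contDiffAt (hU.mem_nhds hz)).differentiableAt h0
  have dL := (hLsm.contDiffAt (hU.mem_nhds hz)).differentiableAt h0
  -- the derivative of `l ^ 2 * L = 1`
  have hdl : ∀ e, 2 * fderiv ℝ l z e = -(l z ^ 3) * fderiv ℝ L z e := by
    intro e
    have hev : (fun w => l w * l w * L w) =ᶠ[nhds z] fun _ => (1 : ℝ) := by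
      filter_upwards [hU.mem_nhds hz] with w hw using (by rw [← hl2 w hw]; ring)
    have h1 := hev.fderiv_eq (𝕜 := ℝ)
    rw [fderiv_fun_mul (dl.fun_mul dl) dL, fderiv_fun_mul dl dl] at h1
    have h2 := DFunLike.congr_fun h1 e
    have h3 := hl2 z hz
    simp only [_root_.add_apply, _root_.smul_apply, smul_eq_mul, fderiv_fun_const, Pi.zero_apply,
      _root_.zero_apply] at h2
    have h4 : l z * (l z ^ 2 * fderiv ℝ L z e + 2 * l z * fderiv ℝ l z e * L z) = 0 := by
      linear_combination l z * h2
    linear_combination h4 - 2 * fderiv ℝ l z e * h3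
  -- the products of the derivatives of `f`
  have hnn : ∀ w ∈ U, inner ℝ (f w) (f w) = (1 : ℝ) := by
    intro w hw
    rw [real_inner_self_eq_norm_sq, hsph w hw]
    norm_num
  have hna : ∀ w ∈ U, inner ℝ (f w) (du f w) = (0 : ℝ) := by
    intro w hw
    have h := fderiv_inner_eqOn hU hnn hw ((hf' w hw).differentiableAt h0)
      ((hf' w hw).differentiableAt h0) 1
    rw [real_inner_comm (f w)] at h
    simp only [fderiv_fun_const, Pi.zero_apply, _root_.zero_apply] at h
    change 0 = inner ℝ (f w) (du f w) + inner ℝ (f w) (du f w) at h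
    linarith
  have hnb : ∀ w ∈ U, inner ℝ (f w) (dv f w) = (0 : ℝ) := by
    intro w hw
    have h := fderiv_inner_eqOn hU hnn hw ((hf' w hw).differentiableAt h0)
      ((hf' w hw).differentiableAt h0) Complex.I
    rw [real_inner_comm (f w)] at h
    simp only [fderiv_fun_const, Pi.zero_apply, _root_.zero_apply] at h
    change 0 = inner ℝ (f w) (dv f w) + inner ℝ (f w) (dv f w) at h
    linarith
  have hsym := du_dv_comm (hf' z hz)
  have i_np := fderiv_inner_eqOn hU hna hz df dfu 1
  have i_nq := fderiv_inner_eqOn hU hnb hz df dfv 1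
  have i_nr := fderiv_inner_eqOn hU hnb hz df dfv Complex.I
  have i_ap := fderiv_inner_eqOn hU (c := L) (fun _ _ => rfl) hz dfu dfu 1
  have i_aq := fderiv_inner_eqOn hU (c := L) (fun _ _ => rfl) hz dfu dfu Complex.I
  have i_bq := fderiv_inner_eqOn hU hLv hz dfv dfv 1
  have i_br := fderiv_inner_eqOn hU hLv hz dfv dfv Complex.I
  have i_bp := fderiv_inner_eqOn hU (fun w hw => (hconf w hw).2) hz dfu dfv 1
  have i_ar := fderiv_inner_eqOn hU (fun w hw => (hconf w hw).2) hz dfu dfv Complex.I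
  simp only [fderiv_fun_const, Pi.zero_apply, _root_.zero_apply] at i_np i_nq i_nr i_bp i_ar
  change 0 = inner ℝ (f z) (du (du f) z) + inner ℝ (du f z) (du f z) at i_np
  change 0 = inner ℝ (f z) (du (dv f) z) + inner ℝ (du f z) (dv f z) at i_nq
  change 0 = inner ℝ (f z) (dv (dv f) z) + inner ℝ (dv f z) (dv f z) at i_nr
  change _ = inner ℝ (du f z) (du (du f) z) + inner ℝ (du (du f) z) (du f z) at i_ap
  change _ = inner ℝ (du f z) (dv (du f) z) + inner ℝ (dv (du f) z) (du f z) at i_aq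
  change _ = inner ℝ (dv f z) (du (dv f) z) + inner ℝ (du (dv f) z) (dv f z) at i_bq
  change _ = inner ℝ (dv f z) (dv (dv f) z) + inner ℝ (dv (dv f) z) (dv f z) at i_br
  change 0 = inner ℝ (du f z) (du (dv f) z) + inner ℝ (du (du f) z) (dv f z) at i_bp
  change 0 = inner ℝ (du f z) (dv (dv f) z) + inner ℝ (dv (du f) z) (dv f z) at i_ar
  have v_nn := hnn z hz
  have v_na := hna z hz
  have v_nb := hnb z hz
  have v_ab := (hconf z hz).2
  have v_aa : inner ℝ (du f z) (du f z) = L z := rfl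
  have v_bb := hLv z hz
  have Lz := hLpos z hz
  have hl2z := hl2 z hz
  have dlu := hdl 1
  have dlv := hdl Complex.I
  have hlift : canonicalLift f = fun w => realPoint (l w) (l w • f w) := by
    funext w i
    refine Fin.cases ?_ (fun i => ?_) i <;> simp [canonicalLift, conePoint, realPoint, hldef]
  have hYzz := dz_dz_realPoint hU hlsm (hlsm.smul hf) hz
  have e_uu := fderiv_fderiv_smul hU hlsm hf hz 1 1
  have e_vv := fderiv_fderiv_smul hU hlsm hf hz Complex.I Complex.I
  have e_uv := fderiv_fderiv_smul hU hlsm hf hz 1 Complex.I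
  have e_vu := fderiv_fderiv_smul hU hlsm hf hz Complex.I 1
  change du (du (fun w => l w • f w)) z = du (du l) z • f z + du l z • du f z + du l z • du f z
    + l z • du (du f) z at e_uu
  change dv (dv (fun w => l w • f w)) z = dv (dv l) z • f z + dv l z • dv f z + dv l z • dv f z
    + l z • dv (dv f) z at e_vv
  change dv (du (fun w => l w • f w)) z = dv (du l) z • f z + du l z • dv f z + dv l z • du f z
    + l z • dv (du f) z at e_uv
  change du (dv (fun w => l w • f w)) z = du (dv l) z • f z + dv l z • du f z + du l z • dv f z
    + l z • du (dv f) z at e_vu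
  change 2 * du l z = _ at dlu
  change 2 * dv l z = _ at dlv
  rw [hsym] at i_aq i_ar e_uv
  rw [willmoreDensity_eq_second Lz v_aa v_bb v_ab hsym]
  have hproj := fun x => inner_orthProj Lz.ne' v_nn v_aa v_bb v_na v_nb v_ab x
  have sF : secondForm f z 0 0 - secondForm f z 1 1 =
      ((Submodule.span ℝ {f z, du f z, dv f z})ᗮ).starProjection
        (du (du f) z - dv (dv f) z) := by
    rw [map_sub]; rfl
  have sG : secondForm f z 0 1 =
      ((Submodule.span ℝ {f z, du f z, dv f z})ᗮ).starProjection (du (dv f) z) := rfl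
  rw [sF, sG, hproj, hproj]
  clear hproj sF sG hnn hna hnb hLv hl2 hLpos hexp hdl hf' hsym
  rw [hopf, hlift]
  beta_reduce
  change dz (dz fun w => realPoint (l w) (l w • f w)) z = _ at hYzz
  change _ = (1 / 4 : ℂ) •
      (realPoint (du (du l) z - dv (dv l) z) (du (du (fun w => l w • f w)) z -
        dv (dv (fun w => l w • f w)) z) -
        Complex.I • realPoint (du (dv l) z + dv (du l) z)
          (du (dv (fun w => l w • f w)) z + dv (du (fun w => l w • f w)) z)) at hYzz
  have alg := density_algebra (f z) (du f z) (dv f z) (du (du f) z) (du (dv f) z) (dv (dv f) z)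
    (l z) (L z) (du l z) (dv l z) _ _ (du (du l) z) (dv (dv l) z) (du (dv l) z) (dv (du l) z)
    hl2z dlu dlv v_nn v_na v_nb v_ab v_aa v_bb i_np i_nq i_nr i_ap i_aq i_bq i_br i_bp i_ar
  rw [hYzz, e_uu, e_vv, e_uv, e_vu, mink_combination _ _ _ _ (star_realPoint _ _)
    (star_realPoint _ _) (star_realPoint _ _)]
  · rw [mink_realPoint, mink_realPoint]
    norm_cast
    exact (alg).1
  · rw [mink_realPoint, real_inner_smul_left, real_inner_smul_right, v_nn]
    norm_cast
    ring
  · rw [mink_realPoint, real_inner_smul_right, alg.2.1]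
    norm_cast
    ring
  · rw [mink_realPoint, real_inner_smul_right, alg.2.2]
    norm_cast
    ring

end Conformal

/-! ### Surfaces -/

section Surfaces

variable {M : Type*} [TopologicalSpace M] [ChartedSpace ℂ M] {d : ℕ}

/-- The local complex coordinates of the Riemann surface `M`. -/
def IsCoordinate (e : OpenPartialHomeomorph M ℂ) : Prop :=
  e ∈ IsManifold.maximalAtlas 𝓘(ℂ) ω M

/-- A map to the sphere, written in a local coordinate. -/
def inCoord (y : M → Sph d) (e : OpenPartialHomeomorph M ℂ) (z : ℂ) : Euc d :=
  (y (e.symm z) : Euc d)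

/-- The canonical lift of `y` with respect to a local coordinate. -/
def liftIn (y : M → Sph d) (e : OpenPartialHomeomorph M ℂ) : ℂ → Mink d :=
  canonicalLift (inCoord y e)

/-- Smooth immersions to the sphere. -/
structure IsSmoothImmersion (y : M → Sph d) : Prop where
  smooth : ∀ e : OpenPartialHomeomorph M ℂ, IsCoordinate e →
    ContDiffOn ℝ ∞ (inCoord y e) e.target
  immersion : ∀ e : OpenPartialHomeomorph M ℂ, IsCoordinate e → ∀ z ∈ e.target,
    Function.Injective (fderiv ℝ (inCoord y e) z)

/-- Conformal immersions to the sphere. -/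
structure IsConformalImmersion (y : M → Sph d) : Prop extends IsSmoothImmersion y where
  conformal : ∀ e : OpenPartialHomeomorph M ℂ, IsCoordinate e → ∀ z ∈ e.target,
    ‖du (inCoord y e) z‖ = ‖dv (inCoord y e) z‖ ∧
      inner ℝ (du (inCoord y e) z) (dv (inCoord y e) z) = 0

/-- Total isotropy: `⟨Y_z^{(j)}, Y_z^{(l)}⟩ = 0` for all `j, l ≥ 1`. -/
def IsTotallyIsotropic (y : M → Sph d) : Prop :=
  ∀ e : OpenPartialHomeomorph M ℂ, IsCoordinate e → ∀ z ∈ e.target, ∀ j l : ℕ, 1 ≤ j → 1 ≤ l →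
    mink ((dz^[j] (liftIn y e)) z) ((dz^[l] (liftIn y e)) z) = 0

/-- H-total isotropy of a surface in `S^{2m}`: it is totally isotropic and has, near every point,
an adapted isotropic frame with `D_z̄ E_j ∈ Span {E₂, …, E_m}` for `j = 2, …, m`. -/
def IsHTotallyIsotropic {m : ℕ} (y : M → Sph (2 * m)) : Prop :=
  IsTotallyIsotropic y ∧
  ∀ p : M, ∃ e : OpenPartialHomeomorph M ℂ, IsCoordinate e ∧ p ∈ e.source ∧
    ∃ E : ℕ → ℂ → Mink (2 * m),
      IsAdaptedIsotropicFrame m (liftIn y e) e.target E ∧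
      ∀ z ∈ e.target, ∀ j ∈ Finset.Icc 2 m,
        normalDzbar (liftIn y e) (E j) z ∈
          Submodule.span ℂ {x | ∃ l ∈ Finset.Icc 2 m, x = E l z}

/-- The Willmore energy of the part of the surface over `A ⊆ M`, that is the integral over `A` of
the Willmore density. As an integral of a non-negative density over a manifold it is the supremum
of the sums of coordinate integrals over finitely many disjoint measurable pieces of `A`, each
contained in a coordinate domain. -/
def willmoreEnergy (y : M → Sph d) (A : Set M) : ℝ≥0∞ :=
  ⨆ (n : ℕ) (e : Fin n → OpenPartialHomeomorph M ℂ) (B : Fin n → Set ℂ)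
    (_ : (∀ i, IsCoordinate (e i)) ∧ (∀ i, MeasurableSet (B i)) ∧ (∀ i, B i ⊆ (e i).target) ∧
      (∀ i, (e i).symm '' B i ⊆ A) ∧
      Pairwise (fun i j => Disjoint ((e i).symm '' B i) ((e j).symm '' B j))),
    ∑ i, ∫⁻ z in B i, ENNReal.ofReal (willmoreDensity (inCoord y (e i)) z)

/-- A smooth variation `Φ_t`, `|t| < ε`, of `y` through immersions that is constant outside `K`. -/
structure IsVariation (y : M → Sph d) (K : Set M) (ε : ℝ) (Φ : ℝ → M → Sph d) : Prop where
  pos : 0 < ε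
  init : Φ 0 = y
  smooth : ∀ e : OpenPartialHomeomorph M ℂ, IsCoordinate e →
    ContDiffOn ℝ ∞ (fun q : ℝ × ℂ => inCoord (Φ q.1) e q.2) (Set.Ioo (-ε) ε ×ˢ e.target)
  immersion : ∀ t ∈ Set.Ioo (-ε) ε, IsSmoothImmersion (Φ t)
  support : ∀ t ∈ Set.Ioo (-ε) ε, ∀ p, p ∉ K → Φ t p = y p

/-- Willmore surfaces: immersed surfaces that are critical for the Willmore functional, with
respect to all compactly supported variations. (If `M` is compact, `K = M` gives all
variations.) -/
def IsWillmore (y : M → Sph d) : Prop :=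
  IsSmoothImmersion y ∧
  ∀ (K : Set M) (ε : ℝ) (Φ : ℝ → M → Sph d), IsCompact K → IsVariation y K ε Φ →
    HasDerivAt (fun t => (willmoreEnergy (Φ t) K).toReal) 0 0

end Surfaces

end HIsotropic

end

/-! Let P be the conformal Gauss map: at each point the orthogonal projection of the complexified
Minkowski space onto V_ℂ, regarded as a field of real self-adjoint idempotent matrices. Written with
the first and second fundamental forms (`gaussOp`, `gaussMap`), it makes sense for an immersion in
arbitrary coordinates and does not depend on them (`IsFamily.gaussMap_comp`). For a conformal
immersion it is the projection along the frame Y, Y_z, Y_z̄, N (`gaussMap_eq_liftOp`), so it links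
variations through non-conformal immersions to the invariants κ and s.

The Willmore equation. One has P_z Y = P_z Y_z̄ = 0, P_z Y_z = κ and P_z Y_{z z̄} = D_z̄ κ.
Differentiating once more, the component V → V^⊥ of P_{z z̄} is x ↦ -2⟨x, Y⟩ W, where W = D_z̄ D_z̄
κ + (s̄/2) κ (`laplacian_gaussMap`). As P_{z z̄} is a quarter of the Laplacian of a real matrix, W
is real (`star_willmoreOperator`). Put L = Span {E₂, …, E_m}. The flag condition places κ in L
(`hopf_mem`), and D_z̄ preserves sections of L (`normalDzbar_mem`), so W lies in L. But L is
isotropic: a real vector of L has ⟨W, Ē_j⟩ = conj ⟨W, E_j⟩ = 0 for all j, hence is zero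
(`eq_zero_of_real`). A holomorphic change of coordinate φ only multiplies P_{z z̄} by |φ'|², so the
equation passes from the coordinates carrying a frame to all others (`willmoreOperator_comp`).

Criticality. The metric induced by P is tr(P_i P_j) = |h°|² g_{ij} (`energyForm_eq`), where h° is
the trace-free second fundamental form. So the Willmore density is half the area density of P; it is
at most a quarter of the Dirichlet density of P, with equality for conformal immersions. Along a
variation of a conformal immersion the difference is therefore minimal at t = 0, and the two
densities have the same first derivative (`hasDerivAt_willmoreDensity`). This replaces any
computation of Euler–Lagrange equations for non-conformal surfaces. The derivative of the Dirichlet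
density is a pairing of dP with dṖ. If W = 0, then P_{z z̄} is block diagonal for V ⊕ V^⊥, while Ṗ
is block off-diagonal because P² = P; hence tr(P_{z z̄} Ṗ) = 0 and the pairing is a divergence
(`dirichletPairing_eq_divergence`).

Globally, K is cut into finitely many disjoint Borel pieces in coordinate domains, which computes
the energy (`willmoreEnergy_eq`) and permits differentiation under the integral. A subordinate
smooth partition of unity then splits Ṗ into parts with support in a single coordinate domain. For
each part the pieces reassemble, by invariance of densities, to one integral over that domain, which
is the integral of a divergence with compact support. -/

noncomputable section

namespace HIsotropic

open scoped Matrix.Norms.Elementwise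

/-! ### Rules for the Wirtinger derivatives -/

section Calculus

variable {X : Type*} [NormedAddCommGroup X] [NormedSpace ℝ X]
variable {E : Type*} [NormedAddCommGroup E] [NormedSpace ℂ E] [FiniteDimensional ℂ E]
variable {F : Type*} [NormedAddCommGroup F] [NormedSpace ℂ F] [FiniteDimensional ℂ F]
variable {G : Type*} [NormedAddCommGroup G] [NormedSpace ℂ G]

/-- A single Leibniz rule for all the products that occur: `minkB`, `appB`, `mulB`, `traceB` and
scalar multiplication. The real domain `X` stays general because differentiation takes place in z,
in t and on ℝ × ℂ. -/
theorem fderiv_bilin (b : E →ₗ[ℂ] F →ₗ[ℂ] G) {f : X → E} {g : X → F} {z : X}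
    (hf : DifferentiableAt ℝ f z) (hg : DifferentiableAt ℝ g z) (e : X) :
    fderiv ℝ (fun w => b (f w) (g w)) z e =
      b (f z) (fderiv ℝ g z e) + b (fderiv ℝ f z e) (g z) := by
  have h := (b.toContinuousBilinearMap.bilinearRestrictScalars ℝ).fderiv_of_bilinear hf hg
  exact DFunLike.congr_fun h e

theorem contDiffOn_bilin (b : E →ₗ[ℂ] F →ₗ[ℂ] G) {f : X → E} {g : X → F} {U : Set X}
    {n : WithTop ℕ∞} (hf : ContDiffOn ℝ n f U) (hg : ContDiffOn ℝ n g U) :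
    ContDiffOn ℝ n (fun w => b (f w) (g w)) U :=
  (b.toContinuousBilinearMap.bilinearRestrictScalars ℝ).isBoundedBilinearMap.contDiff.comp_contDiffOn
    (hf.prodMk hg)

theorem dz_bilin (b : E →ₗ[ℂ] F →ₗ[ℂ] G) {f : ℂ → E} {g : ℂ → F} {z : ℂ}
    (hf : DifferentiableAt ℝ f z) (hg : DifferentiableAt ℝ g z) :
    dz (fun w => b (f w) (g w)) z = b (f z) (dz g z) + b (dz f z) (g z) := by
  simp only [dz, du, dv, fderiv_bilin b hf hg, map_smul, map_sub, LinearMap.smul_apply,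
    LinearMap.sub_apply]
  module

theorem dzbar_bilin (b : E →ₗ[ℂ] F →ₗ[ℂ] G) {f : ℂ → E} {g : ℂ → F} {z : ℂ}
    (hf : DifferentiableAt ℝ f z) (hg : DifferentiableAt ℝ g z) :
    dzbar (fun w => b (f w) (g w)) z = b (f z) (dzbar g z) + b (dzbar f z) (g z) := by
  simp only [dzbar, du, dv, fderiv_bilin b hf hg, map_smul, map_add, LinearMap.smul_apply,
    LinearMap.add_apply]
  module

theorem contDiffOn_fderiv_apply {Y : Type*} [NormedAddCommGroup Y] [NormedSpace ℝ Y]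
    {h : X → Y} {U : Set X} (hU : IsOpen U) (hh : ContDiffOn ℝ ∞ h U) (e : X) :
    ContDiffOn ℝ ∞ (fun w => fderiv ℝ h w e) U :=
  (hh.fderiv_of_isOpen hU (by simp)).clm_apply contDiffOn_const

theorem diffAt {Y : Type*} [NormedAddCommGroup Y] [NormedSpace ℝ Y] {h : X → Y}
    {U : Set X} (hU : IsOpen U) (hh : ContDiffOn ℝ ∞ h U) {z : X} (hz : z ∈ U) :
    DifferentiableAt ℝ h z :=
  (hh.contDiffAt (hU.mem_nhds hz)).differentiableAt (by simp)

/-- Besides the symmetry in u and v, this serves on ℝ × ℂ to exchange the time derivative of a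
variation with its space derivatives. -/
theorem fderiv_fderiv_comm {Y : Type*} [NormedAddCommGroup Y] [NormedSpace ℝ Y] {h : X → Y}
    {U : Set X} (hU : IsOpen U) (hh : ContDiffOn ℝ ∞ h U) {z : X} (hz : z ∈ U) (e e' : X) :
    fderiv ℝ (fun w => fderiv ℝ h w e) z e' = fderiv ℝ (fun w => fderiv ℝ h w e') z e := by
  have hf := hh.contDiffAt (hU.mem_nhds hz)
  have hs : IsSymmSndFDerivAt ℝ h z :=
    hf.isSymmSndFDerivAt
      (by rw [minSmoothness_of_isRCLikeNormedField]; exact WithTop.coe_le_coe.2 le_top)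
  have hd : DifferentiableAt ℝ (fderiv ℝ h) z :=
    (hf.fderiv_right (m := ∞) (by simp)).differentiableAt (by simp)
  have h : ∀ e e' : X, fderiv ℝ (fun w => fderiv ℝ h w e) z e' = fderiv ℝ (fderiv ℝ h) z e' e := by
    intro e e'
    rw [fderiv_clm_apply hd (differentiableAt_const e)]
    simp
  rw [h, h]
  exact hs _ _

variable {U : Set ℂ} {f : ℂ → G}

theorem contDiffOn_dz (hU : IsOpen U) (hf : ContDiffOn ℝ ∞ f U) : ContDiffOn ℝ ∞ (dz f) U :=
  ((contDiffOn_fderiv_apply hU hf 1).sub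
    ((contDiffOn_fderiv_apply hU hf Complex.I).const_smul Complex.I)).const_smul (1 / 2 : ℂ)

theorem contDiffOn_dzbar (hU : IsOpen U) (hf : ContDiffOn ℝ ∞ f U) : ContDiffOn ℝ ∞ (dzbar f) U :=
  ((contDiffOn_fderiv_apply hU hf 1).add
    ((contDiffOn_fderiv_apply hU hf Complex.I).const_smul Complex.I)).const_smul (1 / 2 : ℂ)

theorem dz_congr {g : ℂ → G} (hU : IsOpen U) (h : ∀ w ∈ U, f w = g w) {z : ℂ} (hz : z ∈ U) :
    dz f z = dz g z := by
  have : f =ᶠ[nhds z] g := Filter.eventually_of_mem (hU.mem_nhds hz) h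
  simp only [dz, du, dv, this.fderiv_eq]

theorem dzbar_congr {g : ℂ → G} (hU : IsOpen U) (h : ∀ w ∈ U, f w = g w) {z : ℂ} (hz : z ∈ U) :
    dzbar f z = dzbar g z := by
  have : f =ᶠ[nhds z] g := Filter.eventually_of_mem (hU.mem_nhds hz) h
  simp only [dzbar, du, dv, this.fderiv_eq]

theorem fderiv_dz (hU : IsOpen U) (hf : ContDiffOn ℝ ∞ f U) {z : ℂ} (hz : z ∈ U) (e : ℂ) :
    fderiv ℝ (dz f) z e = (1 / 2 : ℂ) • (fderiv ℝ (du f) z e - Complex.I • fderiv ℝ (dv f) z e) := by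
  have h1 := (diffAt hU (contDiffOn_fderiv_apply hU hf 1) hz).hasFDerivAt
  have h2 := (diffAt hU (contDiffOn_fderiv_apply hU hf Complex.I) hz).hasFDerivAt
  have h3 := (h1.fun_sub (h2.fun_const_smul Complex.I)).fun_const_smul (1 / 2 : ℂ)
  exact DFunLike.congr_fun h3.fderiv e

theorem fderiv_dzbar (hU : IsOpen U) (hf : ContDiffOn ℝ ∞ f U) {z : ℂ} (hz : z ∈ U) (e : ℂ) :
    fderiv ℝ (dzbar f) z e =
      (1 / 2 : ℂ) • (fderiv ℝ (du f) z e + Complex.I • fderiv ℝ (dv f) z e) := by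
  have h1 := (diffAt hU (contDiffOn_fderiv_apply hU hf 1) hz).hasFDerivAt
  have h2 := (diffAt hU (contDiffOn_fderiv_apply hU hf Complex.I) hz).hasFDerivAt
  have h3 := (h1.fun_add (h2.fun_const_smul Complex.I)).fun_const_smul (1 / 2 : ℂ)
  exact DFunLike.congr_fun h3.fderiv e

/-- `4 f_{z z̄}` is the Laplacian. -/
theorem dzbar_dz_eq (hU : IsOpen U) (hf : ContDiffOn ℝ ∞ f U) {z : ℂ} (hz : z ∈ U) :
    dzbar (dz f) z = (1 / 4 : ℂ) • (du (du f) z + dv (dv f) z) := by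
  have hs : du (dv f) z = dv (du f) z := fderiv_fderiv_comm hU hf hz Complex.I 1
  rw [dzbar, du, dv, fderiv_dz hU hf hz, fderiv_dz hU hf hz]
  change (1 / 2 : ℂ) • ((1 / 2 : ℂ) • (du (du f) z - Complex.I • du (dv f) z) +
    Complex.I • (1 / 2 : ℂ) • (dv (du f) z - Complex.I • dv (dv f) z)) = _
  rw [hs]
  match_scalars <;> (ring_nf; try (simp [Complex.I_sq]; norm_num))

theorem dz_dzbar_comm (hU : IsOpen U) (hf : ContDiffOn ℝ ∞ f U) {z : ℂ} (hz : z ∈ U) :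
    dz (dzbar f) z = dzbar (dz f) z := by
  have hs : du (dv f) z = dv (du f) z := fderiv_fderiv_comm hU hf hz Complex.I 1
  rw [dzbar_dz_eq hU hf hz, dz, du, dv, fderiv_dzbar hU hf hz, fderiv_dzbar hU hf hz]
  change (1 / 2 : ℂ) • ((1 / 2 : ℂ) • (du (du f) z + Complex.I • du (dv f) z) -
    Complex.I • (1 / 2 : ℂ) • (dv (du f) z + Complex.I • dv (dv f) z)) = _
  rw [hs]
  match_scalars <;> (ring_nf; try (simp [Complex.I_sq]; norm_num))

section Star

variable [StarAddMonoid G] [NormedStarGroup G] [StarModule ℂ G]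

theorem fderiv_star {f : X → G} {z : X} (hf : DifferentiableAt ℝ f z) (e : X) :
    fderiv ℝ (fun w => star (f w)) z e = star (fderiv ℝ f z e) := by
  have h : HasFDerivAt (fun w => star (f w))
      (((starL' ℝ : G ≃L[ℝ] G) : G →L[ℝ] G).comp (fderiv ℝ f z)) z :=
    ((starL' ℝ : G ≃L[ℝ] G) : G →L[ℝ] G).hasFDerivAt.comp z hf.hasFDerivAt
  rw [h.fderiv]
  rfl

theorem contDiffOn_star {f : X → G} {U : Set X} (hf : ContDiffOn ℝ ∞ f U) :
    ContDiffOn ℝ ∞ (fun w => star (f w)) U :=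
  ((starL' ℝ : G ≃L[ℝ] G) : G →L[ℝ] G).contDiff.comp_contDiffOn hf

theorem dzbar_star {z : ℂ} (hf : DifferentiableAt ℝ f z) :
    dzbar (fun w => star (f w)) z = star (dz f z) := by
  simp only [dz, dzbar, du, dv, fderiv_star hf, star_smul, star_sub]
  simp

theorem dz_star {z : ℂ} (hf : DifferentiableAt ℝ f z) :
    dz (fun w => star (f w)) z = star (dzbar f z) := by
  simp only [dz, dzbar, du, dv, fderiv_star hf, star_smul, star_add]
  simp [sub_eq_add_neg]

end Star

end Calculus

/-! ### Rank one operators on the Minkowski space -/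

section Algebra

variable {d : ℕ}

/-- The linear form `⟨·, b⟩`, as a row vector. -/
def lower : Mink d →ₗ[ℂ] Mink d where
  toFun b := Fin.cons (-(b 0)) (Fin.tail b)
  map_add' a b := by
    funext i
    refine Fin.cases ?_ (fun i => ?_) i <;> simp [Fin.tail, add_comm]
  map_smul' c b := by
    funext i
    refine Fin.cases ?_ (fun i => ?_) i <;> simp [Fin.tail]

theorem mink_eq_dotProduct (a b : Mink d) : mink a b = lower b ⬝ᵥ a := by
  simp [mink, lower, dotProduct, Fin.sum_univ_succ, Fin.tail, mul_comm]

theorem mink_comm (a b : Mink d) : mink a b = mink b a := by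
  simp [mink, mul_comm]

theorem mink_add_left (a b c : Mink d) : mink (a + b) c = mink a c + mink b c := by
  simp [mink_eq_dotProduct, dotProduct_add]

theorem mink_smul_left (r : ℂ) (a c : Mink d) : mink (r • a) c = r * mink a c := by
  simp [mink_eq_dotProduct]

theorem mink_add_right (a b c : Mink d) : mink c (a + b) = mink c a + mink c b := by
  rw [mink_comm, mink_add_left, mink_comm a, mink_comm b]

theorem mink_smul_right (r : ℂ) (a c : Mink d) : mink c (r • a) = r * mink c a := by
  rw [mink_comm, mink_smul_left, mink_comm]

/-- The Lorentzian product as a bilinear map. -/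
def minkB : Mink d →ₗ[ℂ] Mink d →ₗ[ℂ] ℂ :=
  LinearMap.mk₂ ℂ mink mink_add_left mink_smul_left (fun a b c => mink_add_right b c a)
    (fun r a b => mink_smul_right r b a)

theorem minkB_apply (a b : Mink d) : minkB a b = mink a b := rfl

theorem mink_sub_left (a b c : Mink d) : mink (a - b) c = mink a c - mink b c := by
  simp [← minkB_apply]

theorem mink_sub_right (a b c : Mink d) : mink c (a - b) = mink c a - mink c b := by
  simp [← minkB_apply]

theorem mink_zero_left (c : Mink d) : mink 0 c = 0 := by simp [← minkB_apply]

theorem mink_zero_right (c : Mink d) : mink c 0 = 0 := by simp [← minkB_apply]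

theorem mink_sum_left {ι : Type*} (s : Finset ι) (a : ι → Mink d) (c : Mink d) :
    mink (∑ i ∈ s, a i) c = ∑ i ∈ s, mink (a i) c := by
  simp [← minkB_apply]

theorem star_mink (a b : Mink d) : star (mink a b) = mink (star a) (star b) := by
  simp [mink]

/-- Nondegeneracy of the Lorentzian product, tested on the standard basis vectors. -/
theorem mink_left_injective {a b : Mink d} (h : ∀ c, mink a c = mink b c) : a = b := by
  funext i
  refine Fin.cases ?_ (fun i => ?_) i
  · simpa [mink, Fin.succ_ne_zero] using h (Pi.single 0 1)
  · have := h (Pi.single i.succ 1)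
    simpa [mink, Pi.single_apply, Fin.succ_inj, (Fin.succ_ne_zero _).symm] using this

/-- Operators on the complexified Minkowski space. -/
abbrev Op (d : ℕ) : Type := Matrix (Fin (d + 2)) (Fin (d + 2)) ℂ

/-- The operator `x ↦ ⟨b, x⟩ a`. -/
def rk (a b : Mink d) : Op d := Matrix.vecMulVec a (lower b)

/-- `rk` as a bilinear map. -/
def rkB : Mink d →ₗ[ℂ] Mink d →ₗ[ℂ] Op d :=
  LinearMap.mk₂ ℂ rk (fun a b c => Matrix.add_vecMulVec _ _ _)
    (fun r a b => Matrix.smul_vecMulVec _ _ _)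
    (fun a b c => by simp [rk, Matrix.vecMulVec_add])
    (fun r a b => by simp [rk, Matrix.vecMulVec_smul])

theorem rkB_apply (a b : Mink d) : rkB a b = rk a b := rfl

theorem rk_mulVec (a b x : Mink d) : (rk a b).mulVec x = mink b x • a := by
  rw [rk, Matrix.vecMulVec_mulVec, mink_comm, mink_eq_dotProduct]
  simp

theorem mul_rk (A : Op d) (a b : Mink d) : A * rk a b = rk (A.mulVec a) b := by
  rw [rk, Matrix.mul_vecMulVec, rk]

theorem trace_rk (a b : Mink d) : (rk a b).trace = mink a b := by
  rw [rk, Matrix.trace_vecMulVec, mink_eq_dotProduct, dotProduct_comm]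

theorem star_rk (a b : Mink d) : (rk a b).map star = rk (star a) (star b) := by
  ext i j
  refine Fin.cases ?_ (fun j => ?_) j <;> simp [rk, Matrix.vecMulVec_apply, lower, Fin.tail]

theorem op_ext {A B : Op d} (h : ∀ x, A.mulVec x = B.mulVec x) : A = B := by
  apply Matrix.toLin'.injective
  ext1 i
  exact LinearMap.ext fun c => h _

/-- Application of operators to vectors as a bilinear map. -/
def appB : Op d →ₗ[ℂ] Mink d →ₗ[ℂ] Mink d :=
  LinearMap.mk₂ ℂ Matrix.mulVec Matrix.add_mulVec (fun r A x => Matrix.smul_mulVec r A x)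
    (fun A x y => Matrix.mulVec_add A x y) (fun r A x => Matrix.mulVec_smul A r x)

theorem appB_apply (A : Op d) (x : Mink d) : appB A x = A.mulVec x := rfl

/-- The bilinear form `tr (A B)`. -/
def traceB : Op d →ₗ[ℂ] Op d →ₗ[ℂ] ℂ :=
  (LinearMap.mul ℂ (Op d)).compr₂ (Matrix.traceLinearMap _ ℂ ℂ)

theorem traceB_apply (A B : Op d) : traceB A B = (A * B).trace := rfl

/-- Multiplication of operators as a bilinear map. -/
def mulB : Op d →ₗ[ℂ] Op d →ₗ[ℂ] Op d := LinearMap.mul ℂ (Op d)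

theorem mulB_apply (A B : Op d) : mulB A B = A * B := rfl

end Algebra

/-! ### The conformal Gauss map as a field of projections: pointwise algebra -/

section GaussOp

variable {d : ℕ}

theorem realPoint_smul (r α : ℝ) (x : Euc d) :
    (r : ℂ) • realPoint α x = realPoint (r * α) (r • x) := by
  funext i
  refine Fin.cases ?_ (fun i => ?_) i <;> simp [realPoint]

theorem realPoint_sum {ι : Type*} (s : Finset ι) (x : ι → Euc d) :
    ∑ i ∈ s, realPoint 0 (x i) = realPoint 0 (∑ i ∈ s, x i) := by
  classical
  induction s using Finset.induction_on with
  | empty =>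
    funext i
    refine Fin.cases ?_ (fun i => ?_) i <;> simp [realPoint]
  | insert a s ha ih => rw [Finset.sum_insert ha, Finset.sum_insert ha, ih, realPoint_add, add_zero]

/-- The Gram matrix of two vectors. -/
def gram (a : Fin 2 → Euc d) : Matrix (Fin 2) (Fin 2) ℝ :=
  Matrix.of fun i j => inner ℝ (a i) (a j)

theorem gram_apply (a : Fin 2 → Euc d) (i j : Fin 2) : gram a i j = inner ℝ (a i) (a j) := rfl

theorem gram_transpose (a : Fin 2 → Euc d) : (gram a).transpose = gram a := by
  ext i j
  exact real_inner_comm (a i) (a j)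

theorem gram_inv_symm (a : Fin 2 → Euc d) (i j : Fin 2) : (gram a)⁻¹ i j = (gram a)⁻¹ j i := by
  conv_lhs => rw [← gram_transpose a, ← Matrix.transpose_nonsing_inv]
  rfl

theorem gram_det (a : Fin 2 → Euc d) :
    (gram a).det = inner ℝ (a 0) (a 0) * inner ℝ (a 1) (a 1) - inner ℝ (a 0) (a 1) ^ 2 := by
  rw [Matrix.det_fin_two]
  simp only [gram_apply, real_inner_comm (a 0) (a 1)]
  ring

/-- The relation g g⁻¹ = 1 in index form; it makes the formulas for `perp` and `gaussOp` act as
projections. -/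
theorem sum_gram_mul_inv {a : Fin 2 → Euc d} (hg : IsUnit (gram a).det) (k j : Fin 2) :
    ∑ i, (gram a)⁻¹ i j * inner ℝ (a k) (a i) = if k = j then 1 else 0 := by
  rw [← Matrix.one_apply, ← Matrix.mul_nonsing_inv _ hg, Matrix.mul_apply]
  exact Finset.sum_congr rfl fun i _ => mul_comm _ _

/-- A frame `n, a₀, a₁` with `|n| = 1` and `a₀, a₁` independent and orthogonal to `n`. -/
structure IsSphFrame (n : Euc d) (a : Fin 2 → Euc d) : Prop where
  nn : inner ℝ n n = (1 : ℝ)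
  na : ∀ i, inner ℝ n (a i) = (0 : ℝ)
  det : IsUnit (gram a).det

/-- The orthogonal projection to the complement of `n, a₀, a₁`. -/
def perp (n : Euc d) (a : Fin 2 → Euc d) (x : Euc d) : Euc d :=
  x - (inner ℝ n x : ℝ) • n - ∑ i, ∑ j, ((gram a)⁻¹ i j * inner ℝ (a j) x) • a i

variable {n : Euc d} {a : Fin 2 → Euc d}

theorem inner_n_perp (h : IsSphFrame n a) (x : Euc d) : inner ℝ n (perp n a x) = (0 : ℝ) := by
  simp only [perp, inner_sub_right, inner_smul_right, inner_sum, h.nn, h.na]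
  simp

theorem inner_a_perp (h : IsSphFrame n a) (x : Euc d) (k : Fin 2) :
    inner ℝ (a k) (perp n a x) = (0 : ℝ) := by
  have h1 : ∑ i, ∑ j, (gram a)⁻¹ i j * inner ℝ (a j) x * inner ℝ (a k) (a i) =
      inner ℝ (a k) x := by
    rw [Finset.sum_comm]
    have : ∀ j, ∑ i, (gram a)⁻¹ i j * inner ℝ (a j) x * inner ℝ (a k) (a i) =
        (if k = j then 1 else 0) * inner ℝ (a j) x := by
      intro j
      rw [← sum_gram_mul_inv h.det k j, Finset.sum_mul]
      exact Finset.sum_congr rfl fun i _ => by ring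
    simp [this]
  simp only [perp, inner_sub_right, inner_smul_right, inner_sum, h1,
    real_inner_comm n (a k), h.na]
  ring

/-- Replaces the abstract projection in the definition of the second fundamental form by a formula
that is rational in the inner products, so that smooth dependence on parameters becomes visible. -/
theorem starProjection_eq_perp (h : IsSphFrame n a) (x : Euc d) :
    ((Submodule.span ℝ {n, a 0, a 1})ᗮ).starProjection x = perp n a x := by
  apply Submodule.eq_starProjection_of_mem_orthogonal
  · rw [Submodule.mem_orthogonal]
    intro u hu
    induction hu using Submodule.span_induction with
    | mem u hu =>
      simp only [Set.mem_insert_iff, Set.mem_singleton_iff] at hu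
      rcases hu with rfl | rfl | rfl
      · exact inner_n_perp h x
      · exact inner_a_perp h x 0
      · exact inner_a_perp h x 1
    | zero => simp
    | add u v _ _ hu hv => rw [inner_add_left, hu, hv, add_zero]
    | smul c u _ hu => rw [inner_smul_left, hu, mul_zero]
  · rw [Submodule.orthogonal_orthogonal]
    have h1 : n ∈ Submodule.span ℝ {n, a 0, a 1} := Submodule.subset_span (by simp)
    have h2 : ∀ i, a i ∈ Submodule.span ℝ {n, a 0, a 1} := fun i =>
      Submodule.subset_span (by fin_cases i <;> simp)
    have : x - perp n a x =
      (inner ℝ n x : ℝ) • n + ∑ i, ∑ j, ((gram a)⁻¹ i j * inner ℝ (a j) x) • a i := by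
      rw [perp]; abel
    rw [this]
    exact add_mem (Submodule.smul_mem _ _ h1)
      (sum_mem fun i _ => sum_mem fun j _ => Submodule.smul_mem _ _ (h2 i))

/-- The null vector `F*` with `⟨F, F*⟩ = -1`, where `F = (1, n)`, of the central sphere with mean
curvature vector `H`. -/
def dualPoint (n H : Euc d) : Mink d :=
  realPoint (1 / 2 + inner ℝ H H / 2) (H + ((inner ℝ H H - 1) / 2 : ℝ) • n)

/-- The projection to the span of `F = (1, n)`, `a₀`, `a₁`, `F*`. -/
def gaussOp (n : Euc d) (a : Fin 2 → Euc d) (H : Euc d) : Op d :=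
  (∑ i, ∑ j, (((gram a)⁻¹ i j : ℝ) : ℂ) • rk (realPoint 0 (a i)) (realPoint 0 (a j))) -
    rk (realPoint 1 n) (dualPoint n H) - rk (dualPoint n H) (realPoint 1 n)

theorem gaussOp_mulVec (n : Euc d) (a : Fin 2 → Euc d) (H : Euc d) (x : Mink d) :
    (gaussOp n a H).mulVec x =
      (∑ i, ∑ j, ((((gram a)⁻¹ i j : ℝ) : ℂ) * mink (realPoint 0 (a j)) x) • realPoint 0 (a i)) -
      mink (dualPoint n H) x • realPoint 1 n - mink (realPoint 1 n) x • dualPoint n H := by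
  rw [← appB_apply, gaussOp]
  simp only [map_sub, LinearMap.sub_apply, map_sum, LinearMap.sum_apply, map_smul,
    LinearMap.smul_apply, appB_apply, rk_mulVec, smul_smul]

/-- The inverse Gram matrix is symmetric, and the two rank one terms with the cone point and its
dual are adjoint to each other. -/
theorem gaussOp_selfadjoint (n : Euc d) (a : Fin 2 → Euc d) (H : Euc d) (x y : Mink d) :
    mink ((gaussOp n a H).mulVec x) y = mink x ((gaussOp n a H).mulVec y) := by
  simp only [gaussOp_mulVec, mink_sub_left, mink_sum_left, mink_smul_left, mink_comm x]
  have : ∑ i, ∑ j, (((gram a)⁻¹ i j : ℝ) : ℂ) * mink (realPoint 0 (a j)) x *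
        mink (realPoint 0 (a i)) y =
      ∑ i, ∑ j, (((gram a)⁻¹ i j : ℝ) : ℂ) * mink (realPoint 0 (a j)) y *
        mink (realPoint 0 (a i)) x := by
    rw [Finset.sum_comm]
    refine Finset.sum_congr rfl fun i _ => Finset.sum_congr rfl fun j _ => ?_
    rw [gram_inv_symm]
    ring
  rw [this]
  ring

/-- The vector `H` is normal. -/
structure IsNormalVec (n : Euc d) (a : Fin 2 → Euc d) (H : Euc d) : Prop where
  n : inner ℝ n H = (0 : ℝ)
  a : ∀ i, inner ℝ (a i) H = (0 : ℝ)

variable {H : Euc d}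

/-- This and the next four lemmas say that F = (1, n) and F* form a null pair with product -1,
orthogonal to the tangent vectors (0, a_i). Hence `gaussOp` is the orthogonal projection to their
span. -/
theorem mink_dual_dual (h : IsSphFrame n a) (hH : IsNormalVec n a H) :
    mink (dualPoint n H) (dualPoint n H) = 0 := by
  rw [dualPoint, mink_realPoint]
  simp only [inner_add_left, inner_add_right, inner_smul_right, real_inner_smul_left, h.nn, hH.n,
    real_inner_comm n H]
  norm_cast
  ring

theorem mink_cone_dual (h : IsSphFrame n a) (hH : IsNormalVec n a H) :
    mink (realPoint 1 n) (dualPoint n H) = -1 := by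
  rw [dualPoint, mink_realPoint]
  simp only [inner_add_right, inner_smul_right, h.nn, hH.n]
  push_cast
  ring

theorem mink_cone_cone (h : IsSphFrame n a) : mink (realPoint 1 n) (realPoint 1 n) = 0 := by
  rw [mink_realPoint, h.nn]
  norm_num

theorem mink_tang_cone (h : IsSphFrame n a) (i : Fin 2) :
    mink (realPoint 0 (a i)) (realPoint 1 n) = 0 := by
  rw [mink_realPoint, real_inner_comm, h.na]
  norm_num

theorem mink_tang_dual (h : IsSphFrame n a) (hH : IsNormalVec n a H) (i : Fin 2) :
    mink (realPoint 0 (a i)) (dualPoint n H) = 0 := by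
  rw [dualPoint, mink_realPoint]
  simp only [inner_add_right, inner_smul_right, hH.a, real_inner_comm n (a i), h.na]
  norm_num

theorem gaussOp_cone (h : IsSphFrame n a) (hH : IsNormalVec n a H) :
    (gaussOp n a H).mulVec (realPoint 1 n) = realPoint 1 n := by
  rw [gaussOp_mulVec]
  simp [mink_tang_cone h, mink_cone_cone h, mink_comm (dualPoint n H), mink_cone_dual h hH]

theorem gaussOp_dual (h : IsSphFrame n a) (hH : IsNormalVec n a H) :
    (gaussOp n a H).mulVec (dualPoint n H) = dualPoint n H := by
  rw [gaussOp_mulVec]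
  simp [mink_tang_dual h hH, mink_cone_dual h hH, mink_dual_dual h hH]

theorem gaussOp_tang (h : IsSphFrame n a) (hH : IsNormalVec n a H) (k : Fin 2) :
    (gaussOp n a H).mulVec (realPoint 0 (a k)) = realPoint 0 (a k) := by
  rw [gaussOp_mulVec, mink_comm (dualPoint n H), mink_comm (realPoint 1 n), mink_tang_dual h hH,
    mink_tang_cone h, zero_smul, zero_smul, sub_zero, sub_zero]
  have : ∀ i, ∑ j, (((gram a)⁻¹ i j : ℝ) : ℂ) * mink (realPoint 0 (a j)) (realPoint 0 (a k)) =
      if k = i then 1 else 0 := by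
    intro i
    have := sum_gram_mul_inv h.det k i
    simp only [mink_realPoint, mul_zero, neg_zero, zero_add]
    simp only [gram_inv_symm a i, real_inner_comm (a k)]
    norm_cast
    rw [this]
    split_ifs <;> simp
  simp only [← Finset.sum_smul, this]
  simp

/-- Every rank one summand of `gaussOp` takes values in the line of one of the vectors F, (0, a_k),
F*. Besides idempotence, this yields half of the comparison of `gaussOp` with `liftOp`. -/
theorem gaussOp_mul_of_fix {A : Op d} (h1 : A.mulVec (realPoint 1 n) = realPoint 1 n)
    (h2 : ∀ k, A.mulVec (realPoint 0 (a k)) = realPoint 0 (a k))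
    (h3 : A.mulVec (dualPoint n H) = dualPoint n H) : A * gaussOp n a H = gaussOp n a H := by
  simp only [gaussOp, ← mulB_apply, map_sub, map_sum, map_smul]
  simp only [mulB_apply, mul_rk, h1, h2, h3]

theorem gaussOp_idem (h : IsSphFrame n a) (hH : IsNormalVec n a H) :
    gaussOp n a H * gaussOp n a H = gaussOp n a H :=
  gaussOp_mul_of_fix (gaussOp_cone h hH) (gaussOp_tang h hH) (gaussOp_dual h hH)

/-- The normal vector of the central sphere over a normal vector `w` of the surface. -/
def normalLift (n H w : Euc d) : Mink d := realPoint (inner ℝ H w) (w + (inner ℝ H w : ℝ) • n)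

/-- Source of the trace-free form. For x = ∂_k ∂_i f the normal part is h_{ki} and ⟨n, x⟩ = -g_{ki},
so the vector being lifted is h_{ki} - g_{ki} H. -/
theorem gaussOp_compl (hH : IsNormalVec n a H) (x : Euc d) :
    realPoint 0 x - (gaussOp n a H).mulVec (realPoint 0 x) =
      normalLift n H (perp n a x + (inner ℝ n x : ℝ) • H) := by
  have hHp : inner ℝ H (perp n a x) = (inner ℝ H x : ℝ) := by
    simp only [perp, inner_sub_right, inner_smul_right, inner_sum, real_inner_comm n H, hH.n,
      fun i => real_inner_comm (a i) H, hH.a]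
    simp
  have h1 : ∑ i, ∑ j, ((((gram a)⁻¹ i j : ℝ) : ℂ) * mink (realPoint 0 (a j)) (realPoint 0 x)) •
      realPoint 0 (a i) = realPoint 0 (∑ i, ∑ j, ((gram a)⁻¹ i j * inner ℝ (a j) x) • a i) := by
    rw [← realPoint_sum]
    refine Finset.sum_congr rfl fun i _ => ?_
    rw [← realPoint_sum]
    refine Finset.sum_congr rfl fun j _ => ?_
    rw [mink_realPoint, ← Complex.ofReal_mul, realPoint_smul]
    simp
  rw [gaussOp_mulVec, h1, dualPoint, mink_realPoint, mink_realPoint, realPoint_smul, realPoint_smul,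
    realPoint_sub, realPoint_sub, realPoint_sub, normalLift]
  simp only [inner_add_right, inner_add_left, inner_smul_right, real_inner_smul_left, hHp]
  congr 1
  · ring
  · rw [perp]
    module

/-- The component of the lift along F = (1, n) is null and orthogonal to the rest, so it does not
contribute. -/
theorem mink_normalLift (h : IsSphFrame n a) {w w' : Euc d} (hw : IsNormalVec n a w)
    (hw' : IsNormalVec n a w') :
    mink (normalLift n H w) (normalLift n H w') = ((inner ℝ w w' : ℝ) : ℂ) := by
  rw [normalLift, normalLift, mink_realPoint]
  simp only [inner_add_left, inner_add_right, inner_smul_right, real_inner_smul_left, h.nn, hw.n,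
    hw'.n, real_inner_comm n w]
  norm_cast
  ring

theorem star_gaussOp (n : Euc d) (a : Fin 2 → Euc d) (H : Euc d) :
    (gaussOp n a H).map star = gaussOp n a H := by
  have hs : ∀ A B : Op d, (A - B).map star = A.map star - B.map star := fun A B => by ext; simp
  have h0 : ∀ (r : ℝ) (A : Op d), ((r : ℂ) • A).map star = (r : ℂ) • A.map star :=
    fun r A => by ext; simp
  have h2 : ∀ (A : Fin 2 → Op d), (∑ i, A i).map star = ∑ i, (A i).map star := by
    intro A
    ext i j
    simp [Matrix.sum_apply]
  simp only [gaussOp, hs, h0, h2, star_rk, star_realPoint, dualPoint]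

end GaussOp

/-! ### The conformal Gauss map of a family of immersions -/

section Family

variable {d : ℕ}

/-! ### Derivatives along the factors of ℝ × ℂ -/

section Slices

variable {Y : Type*} [NormedAddCommGroup Y] [NormedSpace ℝ Y]

theorem fderiv_slice_right {G : ℝ × ℂ → Y} {t : ℝ} {z : ℂ} (hG : DifferentiableAt ℝ G (t, z))
    (e : ℂ) : fderiv ℝ (fun w => G (t, w)) z e = fderiv ℝ G (t, z) (0, e) := by
  have h : HasFDerivAt (fun w => G (t, w))
      ((fderiv ℝ G (t, z)).comp (ContinuousLinearMap.inr ℝ ℝ ℂ)) z :=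
    hG.hasFDerivAt.comp z (hasFDerivAt_prodMk_right t z)
  rw [h.fderiv]
  rfl

theorem hasDerivAt_slice_left {G : ℝ × ℂ → Y} {t : ℝ} {z : ℂ}
    (hG : DifferentiableAt ℝ G (t, z)) :
    HasDerivAt (fun s => G (s, z)) (fderiv ℝ G (t, z) (1, 0)) t := by
  have h : HasFDerivAt (fun s => G (s, z))
      ((fderiv ℝ G (t, z)).comp (ContinuousLinearMap.inl ℝ ℝ ℂ)) t :=
    hG.hasFDerivAt.comp t (hasFDerivAt_prodMk_left t z)
  exact h.hasDerivAt

end Slices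

/-! ### Smooth dependence of the Gauss map on its ingredients -/

section Smoothness

variable {X : Type*} [NormedAddCommGroup X] [NormedSpace ℝ X] {s : Set X}

/-- Cramer's rule: the entries of the adjugate and the determinant are polynomials in the inner
products. -/
theorem contDiffOn_gram_inv {a : Fin 2 → X → Euc d} (ha : ∀ i, ContDiffOn ℝ ∞ (a i) s)
    (hdet : ∀ x ∈ s, IsUnit (gram fun i => a i x).det) (i j : Fin 2) :
    ContDiffOn ℝ ∞ (fun x => (gram fun i => a i x)⁻¹ i j) s := by
  have hd : ContDiffOn ℝ ∞ (fun x => ((gram fun i => a i x).det)⁻¹) s := by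
    refine ContDiffOn.inv ?_ fun x hx => (hdet x hx).ne_zero
    simp only [gram_det]
    exact (((ha 0).inner ℝ (ha 0)).mul ((ha 1).inner ℝ (ha 1))).sub (((ha 0).inner ℝ (ha 1)).pow 2)
  have hadj : ContDiffOn ℝ ∞ (fun x => (gram fun i => a i x).adjugate i j) s := by
    simp only [Matrix.adjugate_fin_two]
    fin_cases i <;> fin_cases j <;> simp [gram_apply] <;>
      first
        | exact (ha _).inner ℝ (ha _)
        | exact ((ha _).inner ℝ (ha _)).neg
        | exact (ha _).norm_sq ℝ
  have : (fun x => (gram fun i => a i x)⁻¹ i j) = fun x =>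
      ((gram fun i => a i x).det)⁻¹ * (gram fun i => a i x).adjugate i j := by
    funext x
    rw [Matrix.inv_def, Ring.inverse_eq_inv', Matrix.smul_apply, smul_eq_mul]
  rw [this]
  exact hd.mul hadj

theorem contDiffOn_perp {n : X → Euc d} {a : Fin 2 → X → Euc d} {x : X → Euc d}
    (hn : ContDiffOn ℝ ∞ n s) (ha : ∀ i, ContDiffOn ℝ ∞ (a i) s)
    (hdet : ∀ x ∈ s, IsUnit (gram fun i => a i x).det) (hx : ContDiffOn ℝ ∞ x s) :
    ContDiffOn ℝ ∞ (fun q => perp (n q) (fun i => a i q) (x q)) s := by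
  refine (hx.sub ((hn.inner ℝ hx).smul hn)).sub ?_
  refine ContDiffOn.sum fun i _ => ContDiffOn.sum fun j _ => ?_
  exact ((contDiffOn_gram_inv ha hdet i j).mul ((ha j).inner ℝ hx)).smul (ha i)

/-- `realPoint` as a real linear map. -/
def realPointL : (ℝ × Euc d) →L[ℝ] Mink d :=
  LinearMap.toContinuousLinearMap
    { toFun := fun q => realPoint q.1 q.2
      map_add' := fun p q => (realPoint_add _ _ _ _).symm
      map_smul' := fun c q => by
        funext i
        refine Fin.cases ?_ (fun i => ?_) i <;> simp [realPoint] }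

theorem contDiffOn_realPoint {α : X → ℝ} {x : X → Euc d} (hα : ContDiffOn ℝ ∞ α s)
    (hx : ContDiffOn ℝ ∞ x s) : ContDiffOn ℝ ∞ (fun q => realPoint (α q) (x q)) s :=
  (realPointL (d := d)).contDiff.comp_contDiffOn (hα.prodMk hx)

theorem fderiv_realPoint_apply {α : X → ℝ} {x : X → Euc d} {q : X}
    (hα : DifferentiableAt ℝ α q) (hx : DifferentiableAt ℝ x q) (e : X) :
    fderiv ℝ (fun w => realPoint (α w) (x w)) q e =
      realPoint (fderiv ℝ α q e) (fderiv ℝ x q e) := by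
  have h : HasFDerivAt (fun w => realPoint (α w) (x w))
      ((realPointL (d := d)).comp ((fderiv ℝ α q).prod (fderiv ℝ x q))) q :=
    (realPointL (d := d)).hasFDerivAt.comp q (hα.hasFDerivAt.prodMk hx.hasFDerivAt)
  rw [h.fderiv]
  rfl

theorem contDiffOn_ofReal {g : X → ℝ} (hg : ContDiffOn ℝ ∞ g s) :
    ContDiffOn ℝ ∞ (fun q => (g q : ℂ)) s :=
  Complex.ofRealCLM.contDiff.comp_contDiffOn hg

theorem contDiffOn_dualPoint {n H : X → Euc d} (hn : ContDiffOn ℝ ∞ n s)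
    (hH : ContDiffOn ℝ ∞ H s) : ContDiffOn ℝ ∞ (fun q => dualPoint (n q) (H q)) s :=
  contDiffOn_realPoint (contDiffOn_const.add ((hH.inner ℝ hH).div_const 2))
    (hH.add ((((hH.inner ℝ hH).sub contDiffOn_const).div_const 2).smul hn))

theorem contDiffOn_gaussOp {n H : X → Euc d} {a : Fin 2 → X → Euc d}
    (hn : ContDiffOn ℝ ∞ n s) (ha : ∀ i, ContDiffOn ℝ ∞ (a i) s)
    (hdet : ∀ x ∈ s, IsUnit (gram fun i => a i x).det) (hH : ContDiffOn ℝ ∞ H s) :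
    ContDiffOn ℝ ∞ (fun q => gaussOp (n q) (fun i => a i q) (H q)) s := by
  have h1 := contDiffOn_realPoint (contDiffOn_const (c := (1 : ℝ))) hn
  have h2 := contDiffOn_dualPoint hn hH
  refine ((ContDiffOn.sum fun i _ => ContDiffOn.sum fun j _ => ?_).sub
    (contDiffOn_bilin rkB h1 h2)).sub (contDiffOn_bilin rkB h2 h1)
  exact (contDiffOn_ofReal (contDiffOn_gram_inv ha hdet i j)).smul
    (contDiffOn_bilin rkB (contDiffOn_realPoint contDiffOn_const (ha i))
      (contDiffOn_realPoint contDiffOn_const (ha j)))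

end Smoothness

/-- A smooth family of immersions of `U` into the unit sphere. -/
structure IsFamily (Φ : ℝ → ℂ → Euc d) (I : Set ℝ) (U : Set ℂ) : Prop where
  openI : IsOpen I
  openU : IsOpen U
  smooth : ContDiffOn ℝ ∞ (fun q : ℝ × ℂ => Φ q.1 q.2) (I ×ˢ U)
  sph : ∀ t ∈ I, ∀ z ∈ U, ‖Φ t z‖ = 1
  inj : ∀ t ∈ I, ∀ z ∈ U, Function.Injective (fderiv ℝ (Φ t) z)

/-- The field of projections that is the conformal Gauss map. -/
def gaussMap (f : ℂ → Euc d) (z : ℂ) : Op d :=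
  gaussOp (f z) (fun i => partialDeriv f i z) (meanCurvature f z)

theorem firstForm_eq_gram (f : ℂ → Euc d) (z : ℂ) :
    firstForm f z = gram fun i => partialDeriv f i z := rfl

namespace IsFamily

variable {Φ : ℝ → ℂ → Euc d} {I : Set ℝ} {U : Set ℂ}

theorem isOpen_prod (h : IsFamily Φ I U) : IsOpen (I ×ˢ U) := h.openI.prod h.openU

theorem slice (h : IsFamily Φ I U) {t : ℝ} (ht : t ∈ I) : ContDiffOn ℝ ∞ (Φ t) U :=
  h.smooth.comp ((contDiff_const.prodMk contDiff_id).contDiffOn (s := U)) fun _ hz => ⟨ht, hz⟩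

theorem contDiffOn_partialDeriv_of {Y : Type*} [NormedAddCommGroup Y] [NormedSpace ℝ Y]
    {G : ℝ → ℂ → Y} (hI : IsOpen I) (hU : IsOpen U)
    (hG : ContDiffOn ℝ ∞ (fun q : ℝ × ℂ => G q.1 q.2) (I ×ˢ U)) (e : ℂ) :
    ContDiffOn ℝ ∞ (fun q : ℝ × ℂ => fderiv ℝ (G q.1) q.2 e) (I ×ˢ U) := by
  refine (contDiffOn_fderiv_apply (hI.prod hU) hG (0, e)).congr fun q hq => ?_
  exact fderiv_slice_right (G := fun q : ℝ × ℂ => G q.1 q.2) (diffAt (hI.prod hU) hG hq) e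

theorem smooth_partialDeriv (h : IsFamily Φ I U) (i : Fin 2) :
    ContDiffOn ℝ ∞ (fun q : ℝ × ℂ => partialDeriv (Φ q.1) i q.2) (I ×ˢ U) :=
  contDiffOn_partialDeriv_of h.openI h.openU h.smooth _

theorem smooth_partialDeriv₂ (h : IsFamily Φ I U) (i j : Fin 2) :
    ContDiffOn ℝ ∞ (fun q : ℝ × ℂ => partialDeriv (partialDeriv (Φ q.1) j) i q.2) (I ×ˢ U) :=
  contDiffOn_partialDeriv_of (G := fun t => partialDeriv (Φ t) j) h.openI h.openU
    (h.smooth_partialDeriv j) _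

theorem inner_self (h : IsFamily Φ I U) {t : ℝ} (ht : t ∈ I) {z : ℂ} (hz : z ∈ U) :
    inner ℝ (Φ t z) (Φ t z) = (1 : ℝ) := by
  rw [real_inner_self_eq_norm_sq, h.sph t ht z hz]
  norm_num

theorem inner_partialDeriv (h : IsFamily Φ I U) {t : ℝ} (ht : t ∈ I) {z : ℂ} (hz : z ∈ U)
    (i : Fin 2) : inner ℝ (Φ t z) (partialDeriv (Φ t) i z) = (0 : ℝ) := by
  have hd := diffAt h.openU (h.slice ht) hz
  have h1 := fderiv_inner_eqOn h.openU (fun w hw => h.inner_self ht hw) hz hd hd (coordDir i)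
  rw [real_inner_comm (Φ t z)] at h1
  simp only [fderiv_fun_const, Pi.zero_apply, _root_.zero_apply] at h1
  change (0 : ℝ) = inner ℝ (Φ t z) (partialDeriv (Φ t) i z) +
    inner ℝ (Φ t z) (partialDeriv (Φ t) i z) at h1
  linarith

/-- Cauchy–Schwarz for the two coordinate fields; in the case of equality the differential would
have a kernel. -/
theorem det_pos (h : IsFamily Φ I U) {t : ℝ} (ht : t ∈ I) {z : ℂ} (hz : z ∈ U) :
    0 < (firstForm (Φ t) z).det := by
  set a := partialDeriv (Φ t) 0 z with ha
  set b := partialDeriv (Φ t) 1 z with hb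
  have h0 : (firstForm (Φ t) z).det = inner ℝ a a * inner ℝ b b - inner ℝ a b ^ 2 := by
    rw [firstForm_eq_gram, gram_det]
  have hle : 0 ≤ inner ℝ a a * inner ℝ b b - (inner ℝ a b : ℝ) ^ 2 := by
    have := real_inner_mul_inner_self_le a b
    nlinarith
  rw [h0]
  refine lt_of_le_of_ne hle fun h1 => ?_
  -- The squared norm of this vector is |b|² times the Gram determinant, which is zero here.
  -- Injectivity of the differential then forces |b|² = 0, contradicting injectivity once more in
  -- the direction of `coordDir 1`.
  have hw : (inner ℝ b b : ℝ) • a - (inner ℝ a b : ℝ) • b = 0 := by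
    rw [← inner_self_eq_zero (𝕜 := ℝ)]
    simp only [inner_sub_left, inner_sub_right, inner_smul_right, real_inner_smul_left,
      real_inner_comm a b]
    linear_combination (-(inner ℝ b b : ℝ)) * h1
  have hinj := h.inj t ht z hz
  have hlin : fderiv ℝ (Φ t) z
      ((inner ℝ b b : ℝ) • coordDir 0 - (inner ℝ a b : ℝ) • coordDir 1) = fderiv ℝ (Φ t) z 0 := by
    rw [map_sub, map_smul, map_smul, map_zero]
    exact hw
  have h2 := congrArg Complex.re (hinj hlin)
  simp only [coordDir] at h2
  simp at h2
  have h3 : b = 0 := by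
    rw [← norm_eq_zero, ← sq_eq_zero_iff]
    exact_mod_cast h2
  have h4 : fderiv ℝ (Φ t) z (coordDir 1) = fderiv ℝ (Φ t) z 0 := by
    rw [map_zero]; exact h3
  have h5 := hinj h4
  simp [coordDir] at h5

theorem isUnit_det (h : IsFamily Φ I U) {q : ℝ × ℂ} (hq : q ∈ I ×ˢ U) :
    IsUnit (gram fun i => partialDeriv (Φ q.1) i q.2).det :=
  (h.det_pos hq.1 hq.2).ne'.isUnit

theorem isSphFrame (h : IsFamily Φ I U) {t : ℝ} (ht : t ∈ I) {z : ℂ} (hz : z ∈ U) :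
    IsSphFrame (Φ t z) fun i => partialDeriv (Φ t) i z :=
  ⟨h.inner_self ht hz, h.inner_partialDeriv ht hz, (h.det_pos ht hz).ne'.isUnit⟩

theorem secondForm_eq (h : IsFamily Φ I U) {t : ℝ} (ht : t ∈ I) {z : ℂ} (hz : z ∈ U)
    (i j : Fin 2) : secondForm (Φ t) z i j =
      perp (Φ t z) (fun i => partialDeriv (Φ t) i z) (partialDeriv (partialDeriv (Φ t) j) i z) :=
  starProjection_eq_perp (h.isSphFrame ht hz) _

theorem smooth_secondForm (h : IsFamily Φ I U) (i j : Fin 2) :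
    ContDiffOn ℝ ∞ (fun q : ℝ × ℂ => secondForm (Φ q.1) q.2 i j) (I ×ˢ U) :=
  (contDiffOn_perp h.smooth h.smooth_partialDeriv (fun _ hq => h.isUnit_det hq)
    (h.smooth_partialDeriv₂ i j)).congr fun _ hq => h.secondForm_eq hq.1 hq.2 i j

theorem smooth_meanCurvature (h : IsFamily Φ I U) :
    ContDiffOn ℝ ∞ (fun q : ℝ × ℂ => meanCurvature (Φ q.1) q.2) (I ×ˢ U) :=
  (ContDiffOn.sum fun i _ => ContDiffOn.sum fun j _ =>
    (contDiffOn_gram_inv h.smooth_partialDeriv (fun _ hq => h.isUnit_det hq) i j).smul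
      (h.smooth_secondForm i j)).const_smul (1 / 2 : ℝ)

theorem smooth_gaussMap (h : IsFamily Φ I U) :
    ContDiffOn ℝ ∞ (fun q : ℝ × ℂ => gaussMap (Φ q.1) q.2) (I ×ˢ U) :=
  contDiffOn_gaussOp h.smooth h.smooth_partialDeriv (fun _ hq => h.isUnit_det hq)
    h.smooth_meanCurvature

theorem smooth_firstForm (h : IsFamily Φ I U) (i j : Fin 2) :
    ContDiffOn ℝ ∞ (fun q : ℝ × ℂ => firstForm (Φ q.1) q.2 i j) (I ×ˢ U) :=
  (h.smooth_partialDeriv i).inner ℝ (h.smooth_partialDeriv j)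

theorem smooth_traceFreeForm (h : IsFamily Φ I U) (i j : Fin 2) :
    ContDiffOn ℝ ∞ (fun q : ℝ × ℂ => traceFreeForm (Φ q.1) q.2 i j) (I ×ˢ U) :=
  (h.smooth_secondForm i j).sub ((h.smooth_firstForm i j).smul h.smooth_meanCurvature)

theorem smooth_willmoreDensity (h : IsFamily Φ I U) :
    ContDiffOn ℝ ∞ (fun q : ℝ × ℂ => willmoreDensity (Φ q.1) q.2) (I ×ˢ U) := by
  have hi := contDiffOn_gram_inv h.smooth_partialDeriv (fun _ hq => h.isUnit_det hq)
  have hd : ContDiffOn ℝ ∞ (fun q : ℝ × ℂ => (firstForm (Φ q.1) q.2).det) (I ×ˢ U) := by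
    simp only [Matrix.det_fin_two]
    exact ((h.smooth_firstForm 0 0).mul (h.smooth_firstForm 1 1)).sub
      ((h.smooth_firstForm 0 1).mul (h.smooth_firstForm 1 0))
  refine (contDiffOn_const.mul ?_).mul (hd.sqrt fun q hq => (h.det_pos hq.1 hq.2).ne')
  exact ContDiffOn.sum fun i _ => ContDiffOn.sum fun j _ => ContDiffOn.sum fun k _ =>
    ContDiffOn.sum fun l _ => ((hi i k).mul (hi j l)).mul
      ((h.smooth_traceFreeForm i j).inner ℝ (h.smooth_traceFreeForm k l))

theorem isNormalVec_secondForm (h : IsFamily Φ I U) {t : ℝ} (ht : t ∈ I) {z : ℂ} (hz : z ∈ U)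
    (i j : Fin 2) :
    IsNormalVec (Φ t z) (fun i => partialDeriv (Φ t) i z) (secondForm (Φ t) z i j) := by
  rw [h.secondForm_eq ht hz]
  exact ⟨inner_n_perp (h.isSphFrame ht hz) _, inner_a_perp (h.isSphFrame ht hz) _⟩

theorem isNormalVec_meanCurvature (h : IsFamily Φ I U) {t : ℝ} (ht : t ∈ I) {z : ℂ} (hz : z ∈ U) :
    IsNormalVec (Φ t z) (fun i => partialDeriv (Φ t) i z) (meanCurvature (Φ t) z) := by
  have hs := h.isNormalVec_secondForm ht hz
  refine ⟨?_, fun k => ?_⟩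
  · simp only [meanCurvature, inner_smul_right, inner_sum, (hs _ _).n]
    simp
  · simp only [meanCurvature, inner_smul_right, inner_sum, (hs _ _).a]
    simp

theorem isNormalVec_traceFreeForm (h : IsFamily Φ I U) {t : ℝ} (ht : t ∈ I) {z : ℂ} (hz : z ∈ U)
    (i j : Fin 2) :
    IsNormalVec (Φ t z) (fun i => partialDeriv (Φ t) i z) (traceFreeForm (Φ t) z i j) := by
  have hs := h.isNormalVec_secondForm ht hz i j
  have hm := h.isNormalVec_meanCurvature ht hz
  refine ⟨?_, fun k => ?_⟩
  · simp [traceFreeForm, inner_sub_right, inner_smul_right, hs.n, hm.n]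
  · simp [traceFreeForm, inner_sub_right, inner_smul_right, hs.a, hm.a]

theorem gaussMap_idem (h : IsFamily Φ I U) {t : ℝ} (ht : t ∈ I) {z : ℂ} (hz : z ∈ U) :
    gaussMap (Φ t) z * gaussMap (Φ t) z = gaussMap (Φ t) z :=
  gaussOp_idem (h.isSphFrame ht hz) (h.isNormalVec_meanCurvature ht hz)

theorem gaussMap_slice (h : IsFamily Φ I U) {t : ℝ} (ht : t ∈ I) :
    ContDiffOn ℝ ∞ (gaussMap (Φ t)) U := by
  have h1 : ContDiffOn ℝ ∞ (fun w : ℂ => (t, w)) U :=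
    (contDiff_const.prodMk contDiff_id).contDiffOn
  have h2 : Set.MapsTo (fun w : ℂ => (t, w)) U (I ×ˢ U) := fun _ hz => ⟨ht, hz⟩
  have h3 := ContDiffOn.comp (g := fun q : ℝ × ℂ => gaussMap (Φ q.1) q.2) h.smooth_gaussMap h1 h2
  exact h3

end IsFamily

end Family

/-! ### The metric induced by the conformal Gauss map -/

section Energy

variable {d : ℕ}

theorem fderiv_lin {X E G : Type*} [NormedAddCommGroup X] [NormedSpace ℝ X]
    [NormedAddCommGroup E] [NormedSpace ℂ E] [FiniteDimensional ℂ E] [NormedAddCommGroup G]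
    [NormedSpace ℂ G] (b : E →ₗ[ℂ] G) {f : X → E} {z : X} (hf : DifferentiableAt ℝ f z) (e : X) :
    fderiv ℝ (fun w => b (f w)) z e = b (fderiv ℝ f z e) := by
  have h : HasFDerivAt (fun w => b (f w))
      (((LinearMap.toContinuousLinearMap b).restrictScalars ℝ).comp (fderiv ℝ f z)) z :=
    ((LinearMap.toContinuousLinearMap b).restrictScalars ℝ).hasFDerivAt.comp z hf.hasFDerivAt
  rw [h.fderiv]
  rfl

theorem trace_mul_gaussOp (n : Euc d) (a : Fin 2 → Euc d) (H : Euc d) (A : Op d) :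
    (A * gaussOp n a H).trace =
      (∑ i, ∑ j, (((gram a)⁻¹ i j : ℝ) : ℂ) *
        mink (A.mulVec (realPoint 0 (a i))) (realPoint 0 (a j))) -
      mink (A.mulVec (realPoint 1 n)) (dualPoint n H) -
      mink (A.mulVec (dualPoint n H)) (realPoint 1 n) := by
  rw [← traceB_apply, gaussOp]
  simp only [map_sub, map_sum, map_smul, traceB_apply, mul_rk, trace_rk, smul_eq_mul]

/-- By cyclicity of the trace. An off-diagonal `A` can thus be paired with `B` by testing on the
image of P only, where the derivatives of the Gauss map are known explicitly. -/
theorem trace_mul_of_split {P A : Op d} (hA : A = A * P + P * A) (B : Op d) :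
    (A * B).trace = (A * B * P).trace + (B * A * P).trace := by
  conv_lhs => rw [hA]
  rw [add_mul, Matrix.trace_add, add_comm, mul_assoc P A B, Matrix.trace_mul_comm P,
    Matrix.trace_mul_comm (A * P) B, mul_assoc B A P]

/-- The metric `tr (P_i P_j)` induced by the conformal Gauss map `P`. -/
def energyForm (P : ℂ → Op d) (z : ℂ) (k l : Fin 2) : ℂ :=
  (fderiv ℝ P z (coordDir k) * fderiv ℝ P z (coordDir l)).trace

theorem firstForm_apply (f : ℂ → Euc d) (z : ℂ) (i j : Fin 2) :
    firstForm f z i j = inner ℝ (partialDeriv f i z) (partialDeriv f j z) := rfl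

theorem firstForm_symm (f : ℂ → Euc d) (z : ℂ) (i j : Fin 2) :
    firstForm f z i j = firstForm f z j i := by
  rw [firstForm_apply, firstForm_apply, real_inner_comm]

theorem firstForm_self_nonneg (f : ℂ → Euc d) (z : ℂ) (i : Fin 2) : 0 ≤ firstForm f z i i := by
  rw [firstForm_apply]
  exact real_inner_self_nonneg

/-- The squared norm of the trace-free second fundamental form. -/
def normSqTraceFree (f : ℂ → Euc d) (z : ℂ) : ℝ :=
  ∑ i, ∑ j, ∑ k, ∑ l, (firstForm f z)⁻¹ i k * (firstForm f z)⁻¹ j l *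
    inner ℝ (traceFreeForm f z i j) (traceFreeForm f z k l)

theorem willmoreDensity_eq_normSq (f : ℂ → Euc d) (z : ℂ) :
    willmoreDensity f z = 1 / 2 * normSqTraceFree f z * Real.sqrt (firstForm f z).det := rfl

/-- Special to dimension two: in an orthonormal frame a symmetric trace-free q has rows (u, v) and
(v, -u), which have equal length and are orthogonal, also when u and v are vectors. The proof
carries this out in a general frame, by eliminating one entry of q with the trace and one entry of g
with the determinant. -/
theorem traceFree_algebra {g : Matrix (Fin 2) (Fin 2) ℝ} (hsymm : g 1 0 = g 0 1) (h0 : 0 < g 0 0)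
    (hdet : 0 < g.det) {q : Fin 2 → Fin 2 → Euc d} (hq : q 1 0 = q 0 1)
    (htr : ∑ i, ∑ j, g⁻¹ i j • q i j = 0) :
    (∀ k l, 2 * ∑ i, ∑ j, g⁻¹ i j * inner ℝ (q l i) (q k j) =
      (∑ i, ∑ j, ∑ k, ∑ l, g⁻¹ i k * g⁻¹ j l * inner ℝ (q i j) (q k l)) * g k l) ∧
    (0 : ℝ) ≤ ∑ i, ∑ j, ∑ k, ∑ l, g⁻¹ i k * g⁻¹ j l * inner ℝ (q i j) (q k l) := by
  have hD : g.det = g 0 0 * g 1 1 - g 0 1 ^ 2 := by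
    rw [Matrix.det_fin_two, hsymm]; ring
  have e00 : g⁻¹ 0 0 = g 1 1 / g.det := by
    rw [Matrix.inv_def, Matrix.adjugate_fin_two, Ring.inverse_eq_inv']
    simp [div_eq_inv_mul]
  have e01 : g⁻¹ 0 1 = -g 0 1 / g.det := by
    rw [Matrix.inv_def, Matrix.adjugate_fin_two, Ring.inverse_eq_inv']
    simp [div_eq_inv_mul]
  have e10 : g⁻¹ 1 0 = -g 0 1 / g.det := by
    rw [Matrix.inv_def, Matrix.adjugate_fin_two, Ring.inverse_eq_inv']
    simp [div_eq_inv_mul, hsymm]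
  have e11 : g⁻¹ 1 1 = g 0 0 / g.det := by
    rw [Matrix.inv_def, Matrix.adjugate_fin_two, Ring.inverse_eq_inv']
    simp [div_eq_inv_mul]
  generalize g.det = D at *
  generalize ha : g 0 0 = a at *
  generalize hb : g 0 1 = b at *
  generalize hc' : g 1 1 = c at *
  generalize hu : q 0 0 = u at *
  generalize hv : q 0 1 = v at *
  -- The trace condition c u - 2 b v + a q₁₁ = 0, solved for the last entry.
  have hw : q 1 1 = ((2 * b) / a) • v - (c / a) • u := by
    simp only [Fin.sum_univ_two, e00, e01, e10, e11, hq, hu, hv] at htr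
    have h1 : q 1 1 = (D / a) • ((a / D) • q 1 1) := by
      rw [smul_smul]
      field_simp
      simp
    have h2 : (a / D) • q 1 1 = (2 * b / D) • v - (c / D) • u := by
      rw [← sub_eq_zero, ← htr]
      module
    rw [h1, h2, smul_sub, smul_smul, smul_smul]
    congr 2 <;> field_simp
  have hc : c = (D + b ^ 2) / a := by
    field_simp
    linarith
  -- Completing the square displays the squared norm as a sum of two visibly non-negative terms.
  have hval : ∑ i, ∑ j, ∑ k, ∑ l, g⁻¹ i k * g⁻¹ j l * inner ℝ (q i j) (q k l) =
      2 * (inner ℝ (a • v - b • u) (a • v - b • u) + D * inner ℝ u u) / (a ^ 2 * D) := by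
    simp only [Fin.sum_univ_two, e00, e01, e10, e11, hq, hw, hu, hv, inner_sub_left, inner_sub_right,
      inner_smul_right, real_inner_smul_left, real_inner_comm u v]
    rw [hc]
    field_simp
    ring
  refine ⟨?_, ?_⟩
  · rw [hval]
    intro k l
    fin_cases k <;> fin_cases l <;>
    · simp only [Fin.sum_univ_two, Fin.zero_eta, Fin.mk_one, e00, e01, e10, e11, hq, hw, hu, hv,
        hsymm, ha, hb, hc',
        inner_sub_left, inner_sub_right, inner_smul_right, real_inner_smul_left,
        real_inner_comm u v]
      rw [hc]
      field_simp
      ring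
  · rw [hval]
    have h1 : (0 : ℝ) ≤ inner ℝ (a • v - b • u) (a • v - b • u) := real_inner_self_nonneg
    have h2 : (0 : ℝ) ≤ inner ℝ u u := real_inner_self_nonneg
    positivity

namespace IsFamily

variable {Φ : ℝ → ℂ → Euc d} {I : Set ℝ} {U : Set ℂ}

theorem traceFreeForm_symm (h : IsFamily Φ I U) {t : ℝ} (ht : t ∈ I) {z : ℂ} (hz : z ∈ U) :
    traceFreeForm (Φ t) z 1 0 = traceFreeForm (Φ t) z 0 1 := by
  have hs : partialDeriv (partialDeriv (Φ t) 0) 1 z = partialDeriv (partialDeriv (Φ t) 1) 0 z :=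
    fderiv_fderiv_comm h.openU (h.slice ht) hz _ _
  have hg : firstForm (Φ t) z 1 0 = firstForm (Φ t) z 0 1 := firstForm_symm _ _ _ _
  rw [traceFreeForm, traceFreeForm, secondForm, secondForm, hs, hg]

theorem trace_traceFreeForm (h : IsFamily Φ I U) {t : ℝ} (ht : t ∈ I) {z : ℂ} (hz : z ∈ U) :
    ∑ i, ∑ j, (firstForm (Φ t) z)⁻¹ i j • traceFreeForm (Φ t) z i j = 0 := by
  have h1 : ∑ i, ∑ j, (firstForm (Φ t) z)⁻¹ i j * firstForm (Φ t) z i j = 2 := by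
    have hs := fun k j => sum_gram_mul_inv (h.isSphFrame ht hz).det k j
    rw [Finset.sum_comm]
    have : ∀ j, ∑ i, (firstForm (Φ t) z)⁻¹ i j * firstForm (Φ t) z i j = 1 := by
      intro j
      have := hs j j
      rw [if_pos rfl] at this
      rw [← this]
      refine Finset.sum_congr rfl fun i _ => ?_
      rw [firstForm_eq_gram, gram_apply, real_inner_comm]
    simp [this]
  simp only [traceFreeForm, smul_sub, Finset.sum_sub_distrib, smul_smul, ← Finset.sum_smul, h1]
  rw [meanCurvature, smul_smul]
  norm_num

/-- `traceFree_algebra` applied to h - g H; positivity of g₀₀ follows from that of the determinant.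
-/
theorem normSqTraceFree_spec (h : IsFamily Φ I U) {t : ℝ} (ht : t ∈ I) {z : ℂ} (hz : z ∈ U) :
    (∀ k l, 2 * ∑ i, ∑ j, (firstForm (Φ t) z)⁻¹ i j *
        inner ℝ (traceFreeForm (Φ t) z l i) (traceFreeForm (Φ t) z k j) =
      normSqTraceFree (Φ t) z * firstForm (Φ t) z k l) ∧ 0 ≤ normSqTraceFree (Φ t) z := by
  have hd := h.det_pos ht hz
  have hg : firstForm (Φ t) z 1 0 = firstForm (Φ t) z 0 1 := firstForm_symm _ _ _ _
  refine traceFree_algebra hg ?_ hd (h.traceFreeForm_symm ht hz) (h.trace_traceFreeForm ht hz)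
  have h0 : 0 ≤ firstForm (Φ t) z 0 0 := firstForm_self_nonneg _ _ _
  rcases h0.lt_or_eq with h1 | h1
  · exact h1
  · rw [Matrix.det_fin_two, ← h1, hg] at hd
    nlinarith [sq_nonneg (firstForm (Φ t) z 0 1)]

theorem inner_partialDeriv₂ (h : IsFamily Φ I U) {t : ℝ} (ht : t ∈ I) {z : ℂ} (hz : z ∈ U)
    (k i : Fin 2) :
    inner ℝ (Φ t z) (partialDeriv (partialDeriv (Φ t) i) k z) = -firstForm (Φ t) z k i := by
  have hd := diffAt h.openU (h.slice ht) hz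
  have hd' := diffAt h.openU (contDiffOn_fderiv_apply h.openU (h.slice ht) (coordDir i)) hz
  have h1 := fderiv_inner_eqOn h.openU (fun w hw => h.inner_partialDeriv ht hw i) hz hd hd'
    (coordDir k)
  simp only [fderiv_fun_const, Pi.zero_apply, _root_.zero_apply] at h1
  change (0 : ℝ) = inner ℝ (Φ t z) (partialDeriv (partialDeriv (Φ t) i) k z) +
    firstForm (Φ t) z k i at h1
  linarith

/-- The derivative of a field of projections applied to a fixed section. -/
theorem fderiv_mulVec_of_fix {P : ℂ → Op d} {v : ℂ → Mink d} (hU : IsOpen U)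
    (hP : ContDiffOn ℝ ∞ P U) (hv : ContDiffOn ℝ ∞ v U) (hPv : ∀ w ∈ U, (P w).mulVec (v w) = v w)
    {z : ℂ} (hz : z ∈ U) (e : ℂ) :
    (fderiv ℝ P z e).mulVec (v z) = fderiv ℝ v z e - (P z).mulVec (fderiv ℝ v z e) := by
  have h1 := fderiv_bilin appB (diffAt hU hP hz) (diffAt hU hv hz) e
  have h2 : (fun w => appB (P w) (v w)) =ᶠ[nhds z] v :=
    Filter.eventually_of_mem (hU.mem_nhds hz) hPv
  rw [h2.fderiv_eq] at h1
  simp only [appB_apply] at h1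
  exact eq_sub_of_add_eq' h1.symm

/-- Differentiate P² = P: derivatives of idempotents exchange image and kernel. The domain is
general so that derivatives in time are included. -/
theorem fderiv_split {X : Type*} [NormedAddCommGroup X] [NormedSpace ℝ X] {U : Set X}
    {P : X → Op d} (hU : IsOpen U) (hP : ContDiffOn ℝ ∞ P U)
    (hPP : ∀ w ∈ U, P w * P w = P w) {z : X} (hz : z ∈ U) (e : X) :
    fderiv ℝ P z e = fderiv ℝ P z e * P z + P z * fderiv ℝ P z e := by
  have h1 := fderiv_bilin mulB (diffAt hU hP hz) (diffAt hU hP hz) e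
  have h2 : (fun w => mulB (P w) (P w)) =ᶠ[nhds z] P :=
    Filter.eventually_of_mem (hU.mem_nhds hz) hPP
  exact ((DFunLike.congr_fun (h2.fderiv_eq (𝕜 := ℝ)) e).symm.trans h1).trans (add_comm _ _)

theorem fderiv_selfadjoint {P : ℂ → Op d} (hU : IsOpen U) (hP : ContDiffOn ℝ ∞ P U)
    (hPs : ∀ w ∈ U, ∀ x y, mink ((P w).mulVec x) y = mink x ((P w).mulVec y))
    {z : ℂ} (hz : z ∈ U) (e : ℂ) (x y : Mink d) :
    mink ((fderiv ℝ P z e).mulVec x) y = mink x ((fderiv ℝ P z e).mulVec y) := by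
  let L : Op d →ₗ[ℂ] ℂ := (minkB.flip y).comp (appB.flip x) - (minkB x).comp (appB.flip y)
  have h1 := fderiv_lin L (diffAt hU hP hz) e
  have h2 : (fun w => L (P w)) =ᶠ[nhds z] fun _ => 0 :=
    Filter.eventually_of_mem (hU.mem_nhds hz) fun w hw => sub_eq_zero.2 (hPs w hw x y)
  rw [h2.fderiv_eq] at h1
  simp only [fderiv_fun_const, Pi.zero_apply, _root_.zero_apply] at h1
  exact sub_eq_zero.1 h1.symm

/-- The derivative (0, f_k) of F = (1, f) lies again in V, so it has no normal part. -/
theorem fderiv_gaussMap_cone (h : IsFamily Φ I U) {t : ℝ} (ht : t ∈ I) {z : ℂ} (hz : z ∈ U)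
    (k : Fin 2) :
    (fderiv ℝ (gaussMap (Φ t)) z (coordDir k)).mulVec (realPoint 1 (Φ t z)) = 0 := by
  have hv : ContDiffOn ℝ ∞ (fun w => realPoint 1 (Φ t w)) U :=
    contDiffOn_realPoint contDiffOn_const (h.slice ht)
  rw [fderiv_mulVec_of_fix h.openU (h.gaussMap_slice ht) hv (fun w hw =>
    gaussOp_cone (h.isSphFrame ht hw) (h.isNormalVec_meanCurvature ht hw)) hz,
    fderiv_realPoint_apply (differentiableAt_const _) (diffAt h.openU (h.slice ht) hz)]
  simp only [fderiv_fun_const, Pi.zero_apply, _root_.zero_apply]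
  exact sub_eq_zero.2
    (gaussOp_tang (h.isSphFrame ht hz) (h.isNormalVec_meanCurvature ht hz) k).symm

/-- On a section of V the derivative of P gives the normal part of the derivative of the section;
`gaussOp_compl` evaluates it for (0, f_i). -/
theorem fderiv_gaussMap_tang (h : IsFamily Φ I U) {t : ℝ} (ht : t ∈ I) {z : ℂ} (hz : z ∈ U)
    (k i : Fin 2) :
    (fderiv ℝ (gaussMap (Φ t)) z (coordDir k)).mulVec (realPoint 0 (partialDeriv (Φ t) i z)) =
      normalLift (Φ t z) (meanCurvature (Φ t) z) (traceFreeForm (Φ t) z k i) := by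
  have hp : ContDiffOn ℝ ∞ (partialDeriv (Φ t) i) U :=
    contDiffOn_fderiv_apply h.openU (h.slice ht) (coordDir i)
  have hv : ContDiffOn ℝ ∞ (fun w => realPoint 0 (partialDeriv (Φ t) i w)) U :=
    contDiffOn_realPoint contDiffOn_const hp
  rw [fderiv_mulVec_of_fix h.openU (h.gaussMap_slice ht) hv (fun w hw =>
    gaussOp_tang (h.isSphFrame ht hw) (h.isNormalVec_meanCurvature ht hw) i) hz,
    fderiv_realPoint_apply (differentiableAt_const _) (diffAt h.openU hp hz)]
  simp only [fderiv_fun_const, Pi.zero_apply, _root_.zero_apply]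
  rw [gaussMap, gaussOp_compl (h.isNormalVec_meanCurvature ht hz)]
  congr 1
  change perp _ _ (partialDeriv (partialDeriv (Φ t) i) k z) +
    (inner ℝ (Φ t z) (partialDeriv (partialDeriv (Φ t) i) k z) : ℝ) • _ = _
  rw [h.inner_partialDeriv₂ ht hz, ← h.secondForm_eq ht hz, traceFreeForm, neg_smul,
    sub_eq_add_neg]

/-- The Gauss map is weakly conformal, with factor |h°|². In the trace over V the null pair F, F*
drops out, since dP kills F and is self-adjoint; the tangent vectors contribute the contraction of
h° with itself, which in dimension two is a multiple of g. -/
theorem energyForm_eq (h : IsFamily Φ I U) {t : ℝ} (ht : t ∈ I) {z : ℂ} (hz : z ∈ U)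
    (k l : Fin 2) :
    energyForm (gaussMap (Φ t)) z k l =
      ((normSqTraceFree (Φ t) z * firstForm (Φ t) z k l : ℝ) : ℂ) := by
  have hsa := fun (m : Fin 2) => fderiv_selfadjoint h.openU (h.gaussMap_slice ht)
    (fun w _ => gaussOp_selfadjoint _ _ _) hz (coordDir m)
  have key : ∀ k l : Fin 2, (fderiv ℝ (gaussMap (Φ t)) z (coordDir k) *
      fderiv ℝ (gaussMap (Φ t)) z (coordDir l) * gaussMap (Φ t) z).trace =
      ((∑ i, ∑ j, (firstForm (Φ t) z)⁻¹ i j *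
        inner ℝ (traceFreeForm (Φ t) z l i) (traceFreeForm (Φ t) z k j) : ℝ) : ℂ) := by
    intro k l
    conv_lhs => rw [show gaussMap (Φ t) z = gaussOp _ _ _ from rfl, trace_mul_gaussOp]
    simp only [← Matrix.mulVec_mulVec, hsa, h.fderiv_gaussMap_cone ht hz,
      h.fderiv_gaussMap_tang ht hz, mink_normalLift (h.isSphFrame ht hz)
        (h.isNormalVec_traceFreeForm ht hz _ _) (h.isNormalVec_traceFreeForm ht hz _ _)]
    simp only [Matrix.mulVec_zero, mink_zero_left, mink_zero_right, sub_zero]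
    push_cast
    rfl
  rw [energyForm, trace_mul_of_split (fderiv_split h.openU (h.gaussMap_slice ht)
    (fun w hw => h.gaussMap_idem ht hw) hz _), key, key, ← Complex.ofReal_add]
  have h1 := (h.normSqTraceFree_spec ht hz).1 k l
  have h2 := (h.normSqTraceFree_spec ht hz).1 l k
  have hg : firstForm (Φ t) z l k = firstForm (Φ t) z k l := firstForm_symm _ _ _ _
  rw [hg] at h2
  congr 1
  linarith

/-- The Willmore density is the area density of the conformal Gauss map. -/
theorem willmoreDensity_eq_sqrt (h : IsFamily Φ I U) {t : ℝ} (ht : t ∈ I) {z : ℂ} (hz : z ∈ U) :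
    willmoreDensity (Φ t) z = 1 / 2 * Real.sqrt
      ((energyForm (gaussMap (Φ t)) z 0 0 * energyForm (gaussMap (Φ t)) z 1 1 -
        energyForm (gaussMap (Φ t)) z 0 1 * energyForm (gaussMap (Φ t)) z 1 0).re) := by
  have h0 := (h.normSqTraceFree_spec ht hz).2
  simp only [h.energyForm_eq ht hz, ← Complex.ofReal_mul, ← Complex.ofReal_sub, Complex.ofReal_re]
  rw [willmoreDensity_eq_normSq, mul_assoc]
  congr 1
  conv_lhs => rw [← Real.sqrt_sq h0]
  rw [← Real.sqrt_mul (sq_nonneg _), Matrix.det_fin_two]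
  congr 1
  ring

/-- The Willmore density is at most half of the energy density of the conformal Gauss map. -/
theorem willmoreDensity_le (h : IsFamily Φ I U) {t : ℝ} (ht : t ∈ I) {z : ℂ} (hz : z ∈ U) :
    willmoreDensity (Φ t) z ≤
      1 / 4 * (∑ k, energyForm (gaussMap (Φ t)) z k k).re := by
  have h0 := (h.normSqTraceFree_spec ht hz).2
  have h1 : 2 * Real.sqrt (firstForm (Φ t) z).det ≤
      firstForm (Φ t) z 0 0 + firstForm (Φ t) z 1 1 := by
    have ha : 0 ≤ firstForm (Φ t) z 0 0 := firstForm_self_nonneg _ _ _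
    have hb : 0 ≤ firstForm (Φ t) z 1 1 := firstForm_self_nonneg _ _ _
    have hg : firstForm (Φ t) z 1 0 = firstForm (Φ t) z 0 1 := firstForm_symm _ _ _ _
    have : Real.sqrt (firstForm (Φ t) z).det ≤
        (firstForm (Φ t) z 0 0 + firstForm (Φ t) z 1 1) / 2 := by
      apply Real.sqrt_le_iff.2 ⟨by linarith, ?_⟩
      rw [Matrix.det_fin_two, hg]
      nlinarith [sq_nonneg (firstForm (Φ t) z 0 0 - firstForm (Φ t) z 1 1),
        sq_nonneg (firstForm (Φ t) z 0 1)]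
    linarith
  simp only [Fin.sum_univ_two, h.energyForm_eq ht hz, Complex.add_re, Complex.ofReal_re]
  rw [willmoreDensity_eq_normSq]
  nlinarith

/-- The equality case of `willmoreDensity_le`: for g = λ·1 the arithmetic and geometric means of the
eigenvalues agree. -/
theorem willmoreDensity_eq_of_conformal (h : IsFamily Φ I U) {t : ℝ} (ht : t ∈ I) {z : ℂ}
    (hz : z ∈ U) (hc : ‖du (Φ t) z‖ = ‖dv (Φ t) z‖ ∧ inner ℝ (du (Φ t) z) (dv (Φ t) z) = (0 : ℝ)) :
    willmoreDensity (Φ t) z =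
      1 / 4 * (∑ k, energyForm (gaussMap (Φ t)) z k k).re := by
  have h00 : firstForm (Φ t) z 0 0 = ‖du (Φ t) z‖ ^ 2 :=
    real_inner_self_eq_norm_sq (du (Φ t) z)
  have h11 : firstForm (Φ t) z 1 1 = ‖du (Φ t) z‖ ^ 2 := by
    rw [hc.1]; exact real_inner_self_eq_norm_sq (dv (Φ t) z)
  have h01 : firstForm (Φ t) z 0 1 = 0 := hc.2
  simp only [Fin.sum_univ_two, h.energyForm_eq ht hz, Complex.add_re, Complex.ofReal_re]
  rw [willmoreDensity_eq_normSq, Matrix.det_fin_two, h00, h11, h01, zero_mul, sub_zero,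
    Real.sqrt_mul_self (sq_nonneg _)]
  ring

end IsFamily

end Energy

/-! ### Change of coordinates -/

section ChangeOfCoordinates

variable {d : ℕ}

/-- The contraction of a covariant 2-tensor with the inverse metric is invariant, because A (Aᵀ g
A)⁻¹ Aᵀ = g⁻¹. It applies to `perp`, to `gaussOp` and to the mean curvature alike. -/
theorem sum_change {V : Type*} [AddCommGroup V] [Module ℝ V] {g A : Matrix (Fin 2) (Fin 2) ℝ}
    (hA : IsUnit A.det) (X : Fin 2 → Fin 2 → V) :
    ∑ i, ∑ j, (A.transpose * g * A)⁻¹ i j • ∑ k, ∑ l, (A k i * A l j) • X k l =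
      ∑ k, ∑ l, g⁻¹ k l • X k l := by
  have hAt : IsUnit A.transpose.det := by rwa [Matrix.det_transpose]
  have h1 : A * (A.transpose * g * A)⁻¹ * A.transpose = g⁻¹ := by
    rw [Matrix.mul_inv_rev, Matrix.mul_inv_rev, ← mul_assoc, Matrix.mul_nonsing_inv _ hA, one_mul,
      mul_assoc, Matrix.nonsing_inv_mul _ hAt, mul_one]
  rw [← h1]
  simp only [Matrix.mul_apply, Fin.sum_univ_two, Matrix.transpose_apply]
  module

/-- The coordinates of a complex number in the basis `coordDir`. -/
def coordComp (k : Fin 2) : ℂ →L[ℝ] ℝ := if k = 0 then Complex.reCLM else Complex.imCLM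

theorem apply_eq_sum_coord {V : Type*} [AddCommGroup V] [Module ℝ V] [TopologicalSpace V]
    (L : ℂ →L[ℝ] V) (c : ℂ) : L c = ∑ k, coordComp k c • L (coordDir k) := by
  have h : c = c.re • (1 : ℂ) + c.im • Complex.I := by
    apply Complex.ext <;> simp
  conv_lhs => rw [h, map_add, map_smul, map_smul]
  simp [coordComp, coordDir, Fin.sum_univ_two]

/-- The Jacobian matrix. -/
def jacobian (φ : ℂ → ℂ) (w : ℂ) : Matrix (Fin 2) (Fin 2) ℝ :=
  Matrix.of fun k i => coordComp k (fderiv ℝ φ w (coordDir i))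

theorem jacobian_apply (φ : ℂ → ℂ) (w : ℂ) (k i : Fin 2) :
    jacobian φ w k i = coordComp k (fderiv ℝ φ w (coordDir i)) := rfl

theorem fderiv_comp_coordDir {V : Type*} [NormedAddCommGroup V] [NormedSpace ℝ V] {f : ℂ → V}
    {φ : ℂ → ℂ} {w : ℂ} (hf : DifferentiableAt ℝ f (φ w)) (hφ : DifferentiableAt ℝ φ w)
    (i : Fin 2) : fderiv ℝ (fun x => f (φ x)) w (coordDir i) =
      ∑ k, jacobian φ w k i • fderiv ℝ f (φ w) (coordDir k) := by
  have h : HasFDerivAt (fun x => f (φ x)) ((fderiv ℝ f (φ w)).comp (fderiv ℝ φ w)) w :=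
    hf.hasFDerivAt.comp w hφ.hasFDerivAt
  rw [h.fderiv]
  exact apply_eq_sum_coord (fderiv ℝ f (φ w)) _

theorem gram_comb {a a' : Fin 2 → Euc d} {A : Matrix (Fin 2) (Fin 2) ℝ}
    (ha : ∀ i, a' i = ∑ k, A k i • a k) : gram a' = A.transpose * gram a * A := by
  ext i j
  simp only [gram_apply, ha, Matrix.mul_apply, Matrix.transpose_apply, Fin.sum_univ_two,
    inner_add_left, inner_add_right, inner_smul_right, real_inner_smul_left]
  ring

theorem isUnit_det_of_gram {a a' : Fin 2 → Euc d} {A : Matrix (Fin 2) (Fin 2) ℝ}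
    (ha : ∀ i, a' i = ∑ k, A k i • a k) (h : IsUnit (gram a').det) : IsUnit A.det := by
  rw [gram_comb ha, Matrix.det_mul, Matrix.det_mul] at h
  exact isUnit_of_mul_isUnit_right h

theorem perp_comb {n : Euc d} {a a' : Fin 2 → Euc d} {A : Matrix (Fin 2) (Fin 2) ℝ}
    (ha : ∀ i, a' i = ∑ k, A k i • a k) (hA : IsUnit A.det) (x : Euc d) :
    perp n a' x = perp n a x := by
  rw [perp, perp]
  congr 1
  have h := sum_change (g := gram a) hA fun k l => (inner ℝ (a l) x : ℝ) • a k
  simp only [smul_smul] at h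
  rw [← h, gram_comb ha]
  refine Finset.sum_congr rfl fun i _ => Finset.sum_congr rfl fun j _ => ?_
  rw [mul_smul, ha]
  congr 1
  simp only [ha, Fin.sum_univ_two, inner_add_left, real_inner_smul_left]
  module

theorem gaussOp_comb {n : Euc d} {a a' : Fin 2 → Euc d} {H : Euc d}
    {A : Matrix (Fin 2) (Fin 2) ℝ} (ha : ∀ i, a' i = ∑ k, A k i • a k) (hA : IsUnit A.det) :
    gaussOp n a' H = gaussOp n a H := by
  rw [gaussOp, gaussOp]
  congr 2
  have h := sum_change (g := gram a) hA fun k l => rk (realPoint 0 (a k)) (realPoint 0 (a l))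
  simp only [Complex.coe_smul]
  rw [← h, gram_comb ha]
  refine Finset.sum_congr rfl fun i _ => Finset.sum_congr rfl fun j _ => ?_
  congr 1
  have hr : ∀ i, realPoint 0 (a' i) = ∑ k, (A k i : ℂ) • realPoint 0 (a k) := by
    intro i
    simp only [realPoint_smul, mul_zero, realPoint_sum, ha]
  rw [hr, hr, ← rkB_apply]
  simp only [map_add, LinearMap.add_apply, map_smul, LinearMap.smul_apply,
    Fin.sum_univ_two, ← Complex.coe_smul]
  simp only [rkB_apply]
  push_cast
  module

theorem perp_tang {n : Euc d} {a : Fin 2 → Euc d} (h : IsSphFrame n a) (k : Fin 2) :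
    perp n a (a k) = 0 := by
  have h1 : ∀ i, ∑ j, (gram a)⁻¹ i j * inner ℝ (a j) (a k) = if k = i then 1 else 0 := by
    intro i
    rw [← sum_gram_mul_inv h.det k i]
    exact Finset.sum_congr rfl fun j _ => by rw [gram_inv_symm, real_inner_comm]
  simp only [perp, h.na, ← Finset.sum_smul, h1]
  simp

theorem perp_add (n : Euc d) (a : Fin 2 → Euc d) (x y : Euc d) :
    perp n a (x + y) = perp n a x + perp n a y := by
  simp only [perp, inner_add_right, mul_add, add_smul, Finset.sum_add_distrib]
  abel

theorem perp_smul (n : Euc d) (a : Fin 2 → Euc d) (r : ℝ) (x : Euc d) :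
    perp n a (r • x) = r • perp n a x := by
  simp only [perp, inner_smul_right, smul_sub, Finset.smul_sum, smul_smul, mul_left_comm r]

namespace IsFamily

variable {Φ Φ' : ℝ → ℂ → Euc d} {I : Set ℝ} {U W : Set ℂ} {φ : ℂ → ℂ}

theorem partialDeriv_comp (h : IsFamily Φ I U) (hW : IsOpen W) (hφ : ContDiffOn ℝ ∞ φ W)
    (hm : Set.MapsTo φ W U) (hΦ : ∀ t ∈ I, ∀ w ∈ W, Φ' t w = Φ t (φ w)) {t : ℝ} (ht : t ∈ I)
    {w : ℂ} (hw : w ∈ W) (i : Fin 2) :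
    partialDeriv (Φ' t) i w = ∑ k, jacobian φ w k i • partialDeriv (Φ t) k (φ w) := by
  have h1 : Φ' t =ᶠ[nhds w] fun x => Φ t (φ x) :=
    Filter.eventually_of_mem (hW.mem_nhds hw) (hΦ t ht)
  rw [partialDeriv, h1.fderiv_eq,
    fderiv_comp_coordDir (diffAt h.openU (h.slice ht) (hm hw)) (diffAt hW hφ hw)]
  rfl

theorem partialDeriv₂_comp (h : IsFamily Φ I U) (hW : IsOpen W) (hφ : ContDiffOn ℝ ∞ φ W)
    (hm : Set.MapsTo φ W U) (hΦ : ∀ t ∈ I, ∀ w ∈ W, Φ' t w = Φ t (φ w)) {t : ℝ} (ht : t ∈ I)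
    {w : ℂ} (hw : w ∈ W) (i j : Fin 2) :
    partialDeriv (partialDeriv (Φ' t) j) i w =
      ∑ k, (fderiv ℝ (fun x => jacobian φ x k j) w (coordDir i) • partialDeriv (Φ t) k (φ w) +
        jacobian φ w k j • ∑ l, jacobian φ w l i •
          partialDeriv (partialDeriv (Φ t) k) l (φ w)) := by
  have h1 : partialDeriv (Φ' t) j =ᶠ[nhds w] fun x =>
      ∑ k, jacobian φ x k j • partialDeriv (Φ t) k (φ x) :=
    Filter.eventually_of_mem (hW.mem_nhds hw) fun x hx =>
      h.partialDeriv_comp hW hφ hm hΦ ht hx j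
  have hJ : ∀ k, DifferentiableAt ℝ (fun x => jacobian φ x k j) w := fun k =>
    (coordComp k).differentiableAt.comp w
      (diffAt hW (contDiffOn_fderiv_apply hW hφ (coordDir j)) hw)
  have hp : ∀ k, DifferentiableAt ℝ (partialDeriv (Φ t) k) (φ w) := fun k =>
    diffAt h.openU (contDiffOn_fderiv_apply h.openU (h.slice ht) (coordDir k)) (hm hw)
  have hp' : ∀ k, DifferentiableAt ℝ (fun x => partialDeriv (Φ t) k (φ x)) w := fun k =>
    (hp k).comp w (diffAt hW hφ hw)
  conv_lhs => rw [partialDeriv, h1.fderiv_eq]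
  rw [fderiv_fun_sum fun k _ => (hJ k).fun_smul (hp' k), _root_.sum_apply]
  refine Finset.sum_congr rfl fun k _ => ?_
  rw [fderiv_fun_smul (hJ k) (hp' k)]
  simp only [_root_.add_apply, _root_.smul_apply, ContinuousLinearMap.smulRight_apply,
    fderiv_comp_coordDir (hp k) (diffAt hW hφ hw)]
  rw [add_comm]
  rfl

/-- The conformal Gauss map does not depend on the coordinates. -/
theorem gaussMap_comp (h : IsFamily Φ I U) (h' : IsFamily Φ' I W) (hφ : ContDiffOn ℝ ∞ φ W)
    (hm : Set.MapsTo φ W U) (hΦ : ∀ t ∈ I, ∀ w ∈ W, Φ' t w = Φ t (φ w)) {t : ℝ} (ht : t ∈ I)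
    {w : ℂ} (hw : w ∈ W) : gaussMap (Φ' t) w = gaussMap (Φ t) (φ w) := by
  have hW := h'.openU
  have ha := h.partialDeriv_comp hW hφ hm hΦ ht hw
  have hA : IsUnit (jacobian φ w).det :=
    isUnit_det_of_gram (a := fun k => partialDeriv (Φ t) k (φ w))
      (a' := fun i => partialDeriv (Φ' t) i w) ha (h'.isSphFrame ht hw).det
  have hf := h.isSphFrame ht (hm hw)
  -- The second derivatives of φ only multiply tangent vectors, which `perp` kills; what remains
  -- transforms like a tensor.
  have hII : ∀ i j, secondForm (Φ' t) w i j =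
      ∑ k, ∑ l, (jacobian φ w k i * jacobian φ w l j) • secondForm (Φ t) (φ w) k l := by
    intro i j
    rw [h'.secondForm_eq ht hw, perp_comb (a := fun k => partialDeriv (Φ t) k (φ w)) ha hA,
      h.partialDeriv₂_comp hW hφ hm hΦ ht hw, hΦ t ht w hw]
    have hk := perp_tang hf
    simp only [Fin.sum_univ_two, perp_add, perp_smul, hk, h.secondForm_eq ht (hm hw)]
    module
  have hH : meanCurvature (Φ' t) w = meanCurvature (Φ t) (φ w) := by
    rw [meanCurvature, meanCurvature]
    congr 1
    rw [firstForm_eq_gram (Φ' t), gram_comb (a := fun k => partialDeriv (Φ t) k (φ w)) ha]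
    simp only [hII]
    exact sum_change hA _
  rw [gaussMap, gaussMap, hH, hΦ t ht w hw]
  exact gaussOp_comb ha hA

/-- The Willmore density is a density. -/
theorem willmoreDensity_comp (h : IsFamily Φ I U) (h' : IsFamily Φ' I W)
    (hφ : ContDiffOn ℝ ∞ φ W) (hm : Set.MapsTo φ W U)
    (hΦ : ∀ t ∈ I, ∀ w ∈ W, Φ' t w = Φ t (φ w)) {t : ℝ} (ht : t ∈ I) {w : ℂ} (hw : w ∈ W) :
    willmoreDensity (Φ' t) w = |(jacobian φ w).det| * willmoreDensity (Φ t) (φ w) := by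
  have hW := h'.openU
  have hP : ∀ i, fderiv ℝ (gaussMap (Φ' t)) w (coordDir i) =
      ∑ k, jacobian φ w k i • fderiv ℝ (gaussMap (Φ t)) (φ w) (coordDir k) := by
    intro i
    have h1 : gaussMap (Φ' t) =ᶠ[nhds w] fun x => gaussMap (Φ t) (φ x) :=
      Filter.eventually_of_mem (hW.mem_nhds hw) fun x hx => h.gaussMap_comp h' hφ hm hΦ ht hx
    exact (DFunLike.congr_fun (h1.fderiv_eq (𝕜 := ℝ)) _).trans
      (fderiv_comp_coordDir (diffAt h.openU (h.gaussMap_slice ht) (hm hw)) (diffAt hW hφ hw) i)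
  have hG : ∀ i j, energyForm (gaussMap (Φ' t)) w i j = ∑ k, ∑ l,
      ((jacobian φ w k i : ℂ) * jacobian φ w l j) * energyForm (gaussMap (Φ t)) (φ w) k l := by
    intro i j
    rw [energyForm, hP, hP]
    simp only [← Complex.coe_smul, Fin.sum_univ_two, energyForm, ← traceB_apply, map_add, map_smul,
      LinearMap.add_apply, LinearMap.smul_apply, smul_eq_mul]
    ring
  rw [h'.willmoreDensity_eq_sqrt ht hw, h.willmoreDensity_eq_sqrt ht (hm hw)]
  -- The 2 × 2 determinant of the induced metric is multiplied by the square of the Jacobian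
  -- determinant, which comes out of the root as an absolute value.
  rw [show ∀ a b c : ℝ, a * (b * c) = b * (a * c) by intros; ring, ← Real.sqrt_sq_eq_abs,
    ← Real.sqrt_mul (sq_nonneg _)]
  congr 2
  rw [← Complex.re_ofReal_mul]
  congr 1
  simp only [hG, Fin.sum_univ_two, Matrix.det_fin_two]
  push_cast
  ring

end IsFamily

end ChangeOfCoordinates

/-! ### Conformal immersions and the canonical lift -/

section Canonical

variable {d : ℕ}

/-- A conformal immersion of `U` into the unit sphere. -/
structure IsConformalOn (f : ℂ → Euc d) (U : Set ℂ) : Prop where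
  fam : IsFamily (fun _ => f) Set.univ U
  conf : ∀ z ∈ U, ‖du f z‖ = ‖dv f z‖ ∧ inner ℝ (du f z) (dv f z) = (0 : ℝ)

variable {f : ℂ → Euc d} {U : Set ℂ}

theorem star_dz_of_real {Y : ℂ → Mink d} (hU : IsOpen U) (hY : ContDiffOn ℝ ∞ Y U)
    (hr : ∀ z, star (Y z) = Y z) {z : ℂ} (hz : z ∈ U) : star (dz Y z) = dzbar Y z := by
  rw [← dzbar_star (diffAt hU hY hz)]
  simp only [hr]

namespace IsConformalOn

theorem smooth (h : IsConformalOn f U) : ContDiffOn ℝ ∞ f U := h.fam.slice (Set.mem_univ 0)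

theorem gaussMap_smooth (h : IsConformalOn f U) : ContDiffOn ℝ ∞ (gaussMap f) U :=
  h.fam.gaussMap_slice (Set.mem_univ 0)

theorem expOmega_sq (h : IsConformalOn f U) {z : ℂ} (hz : z ∈ U) :
    expOmega f z ^ 2 = inner ℝ (du f z) (du f z) ∧ expOmega f z ^ 2 = inner ℝ (dv f z) (dv f z) := by
  have h1 : expOmega f z ^ 2 = ‖du f z‖ ^ 2 := by
    rw [expOmega, Real.sq_sqrt (by positivity), ← (h.conf z hz).1]
    ring
  rw [real_inner_self_eq_norm_sq, real_inner_self_eq_norm_sq, ← (h.conf z hz).1]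
  exact ⟨h1, h1⟩

theorem du_sq_pos (h : IsConformalOn f U) {z : ℂ} (hz : z ∈ U) :
    0 < (‖du f z‖ ^ 2 + ‖dv f z‖ ^ 2) / 2 := by
  have hd := h.fam.det_pos (Set.mem_univ 0) hz
  have h0 : du f z ≠ 0 := by
    intro h0
    have h1 : partialDeriv f 0 z = 0 := h0
    rw [firstForm_eq_gram, gram_det, h1] at hd
    simp at hd
  have := norm_pos_iff.2 h0
  positivity

theorem expOmega_pos (h : IsConformalOn f U) {z : ℂ} (hz : z ∈ U) : 0 < expOmega f z :=
  Real.sqrt_pos.2 (h.du_sq_pos hz)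

theorem smooth_lam (h : IsConformalOn f U) : ContDiffOn ℝ ∞ (fun z => (expOmega f z)⁻¹) U := by
  have h1 : ContDiffOn ℝ ∞ (fun z => (‖du f z‖ ^ 2 + ‖dv f z‖ ^ 2) / 2) U :=
    (((contDiffOn_fderiv_apply h.fam.openU h.smooth 1).norm_sq ℝ).add
      ((contDiffOn_fderiv_apply h.fam.openU h.smooth Complex.I).norm_sq ℝ)).div_const 2
  exact (h1.sqrt fun z hz => (h.du_sq_pos hz).ne').inv fun z hz => (h.expOmega_pos hz).ne'

theorem smooth_cone (h : IsConformalOn f U) : ContDiffOn ℝ ∞ (fun z => conePoint (f z)) U := by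
  have h1 := contDiffOn_realPoint (contDiffOn_const (c := (1 : ℝ))) h.smooth
  refine h1.congr fun z _ => ?_
  simp [conePoint, realPoint]

theorem smooth_lift (h : IsConformalOn f U) : ContDiffOn ℝ ∞ (canonicalLift f) U :=
  (contDiffOn_ofReal h.smooth_lam).smul h.smooth_cone

end IsConformalOn

theorem conePoint_eq (x : Euc d) : conePoint x = realPoint 1 x := by simp [conePoint, realPoint]

theorem star_canonicalLift (f : ℂ → Euc d) (z : ℂ) : star (canonicalLift f z) = canonicalLift f z := by
  rw [canonicalLift, star_smul, conePoint_eq, star_realPoint]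
  simp

namespace IsConformalOn

theorem dz_cone (h : IsConformalOn f U) {z : ℂ} (hz : z ∈ U) :
    dz (fun w => conePoint (f w)) z = (1 / 2 : ℂ) •
      (realPoint 0 (partialDeriv f 0 z) - Complex.I • realPoint 0 (partialDeriv f 1 z)) := by
  have h1 := fderiv_realPoint_apply (differentiableAt_const (1 : ℝ))
    (diffAt h.fam.openU h.smooth hz)
  simp only [fderiv_fun_const, Pi.zero_apply, _root_.zero_apply] at h1
  simp only [dz, du, dv, conePoint_eq, h1]
  rfl

/-- The decomposition `Y_z = λ F_z + λ_z F`. -/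
theorem dz_lift (h : IsConformalOn f U) {z : ℂ} (hz : z ∈ U) :
    dz (canonicalLift f) z =
      ((((expOmega f z)⁻¹ : ℝ) : ℂ) / 2) • (realPoint 0 (partialDeriv f 0 z) -
        Complex.I • realPoint 0 (partialDeriv f 1 z)) +
      dz (fun w => (((expOmega f w)⁻¹ : ℝ) : ℂ)) z • realPoint 1 (f z) := by
  have h1 := dz_bilin (LinearMap.lsmul ℂ (Mink d))
    (diffAt h.fam.openU (contDiffOn_ofReal h.smooth_lam) hz)
    (diffAt h.fam.openU h.smooth_cone hz)
  simp only [LinearMap.lsmul_apply] at h1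
  rw [h.dz_cone hz, conePoint_eq, smul_smul] at h1
  rw [div_eq_mul_one_div]
  exact h1

theorem mink_lift_lift (h : IsConformalOn f U) {z : ℂ} (hz : z ∈ U) :
    mink (canonicalLift f z) (canonicalLift f z) = 0 := by
  rw [canonicalLift, mink_smul_left, mink_smul_right, conePoint_eq,
    mink_cone_cone (h.fam.isSphFrame (Set.mem_univ 0) hz)]
  simp

theorem mink_tangents (h : IsConformalOn f U) {z : ℂ} (hz : z ∈ U) :
    mink (realPoint 0 (partialDeriv f 0 z)) (realPoint 0 (partialDeriv f 0 z)) =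
      ((expOmega f z : ℝ) : ℂ) ^ 2 ∧
    mink (realPoint 0 (partialDeriv f 1 z)) (realPoint 0 (partialDeriv f 1 z)) =
      ((expOmega f z : ℝ) : ℂ) ^ 2 ∧
    mink (realPoint 0 (partialDeriv f 0 z)) (realPoint 0 (partialDeriv f 1 z)) = 0 := by
  refine ⟨?_, ?_, ?_⟩
  · rw [mink_realPoint, ← Complex.ofReal_pow, (h.expOmega_sq hz).1]
    simp [partialDeriv, coordDir, du]
  · rw [mink_realPoint, ← Complex.ofReal_pow, (h.expOmega_sq hz).2]
    simp [partialDeriv, coordDir, dv]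
  · rw [mink_realPoint]
    have : inner ℝ (partialDeriv f 0 z) (partialDeriv f 1 z) = (0 : ℝ) := (h.conf z hz).2
    simp [this]

/-- The part of Y_z along F is null and orthogonal to the tangent vectors, so conformality leaves
|f_u|² - |f_v|² = 0. -/
theorem mink_dz_dz (h : IsConformalOn f U) {z : ℂ} (hz : z ∈ U) :
    mink (dz (canonicalLift f) z) (dz (canonicalLift f) z) = 0 := by
  have hf := h.fam.isSphFrame (Set.mem_univ 0) hz
  obtain ⟨h00, h11, h01⟩ := h.mink_tangents hz
  rw [h.dz_lift hz]
  simp only [mink_add_left, mink_add_right, mink_sub_left, mink_sub_right, mink_smul_left,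
    mink_smul_right, h00, h11, h01, mink_comm (realPoint 1 (f z)), mink_tang_cone hf,
    mink_comm _ (realPoint 0 (partialDeriv f 0 z)), mink_cone_cone hf]
  linear_combination ((((expOmega f z)⁻¹ : ℝ) : ℂ) / 2) ^ 2 * ((expOmega f z : ℝ) : ℂ) ^ 2 *
    Complex.I_mul_I

theorem mink_dz_dzbar (h : IsConformalOn f U) {z : ℂ} (hz : z ∈ U) :
    mink (dz (canonicalLift f) z) (dzbar (canonicalLift f) z) = 1 / 2 := by
  have hf := h.fam.isSphFrame (Set.mem_univ 0) hz
  obtain ⟨h00, h11, h01⟩ := h.mink_tangents hz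
  have hl : ((((expOmega f z)⁻¹ : ℝ) : ℂ)) * ((expOmega f z : ℝ) : ℂ) = 1 := by
    rw [← Complex.ofReal_mul, inv_mul_cancel₀ (h.expOmega_pos hz).ne', Complex.ofReal_one]
  have hst : ∀ c : ℝ, star ((c : ℂ) / 2) = (c : ℂ) / 2 := by intro c; simp
  rw [← star_dz_of_real h.fam.openU h.smooth_lift (star_canonicalLift f) hz, h.dz_lift hz]
  simp only [star_add, star_smul, star_sub, star_realPoint, hst, Complex.star_def, Complex.conj_I]
  simp only [mink_add_left, mink_add_right, mink_sub_left, mink_sub_right, mink_smul_left,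
    mink_smul_right, h00, h11, h01, mink_comm (realPoint 1 (f z)), mink_tang_cone hf,
    mink_comm _ (realPoint 0 (partialDeriv f 0 z)), mink_cone_cone hf]
  generalize ((((expOmega f z)⁻¹ : ℝ) : ℂ)) = l at *
  generalize ((expOmega f z : ℝ) : ℂ) = o at *
  linear_combination (1 / 2) * (l * o + 1) * hl - (1 / 4) * l ^ 2 * o ^ 2 * Complex.I_mul_I

/-- Differentiation of a constant product. -/
theorem mink_dz_const {a b : ℂ → Mink d} {c : ℂ} (hU : IsOpen U) (ha : ContDiffOn ℝ ∞ a U)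
    (hb : ContDiffOn ℝ ∞ b U) (hab : ∀ w ∈ U, mink (a w) (b w) = c) {z : ℂ} (hz : z ∈ U) :
    mink (a z) (dz b z) = -mink (dz a z) (b z) := by
  have h1 := dz_bilin minkB (diffAt hU ha hz) (diffAt hU hb hz)
  rw [dz_congr (f := fun w => minkB (a w) (b w)) (g := fun _ => c) hU hab hz] at h1
  have h2 : dz (fun _ : ℂ => c) z = 0 := by simp [dz, du, dv]
  rw [h2] at h1
  exact eq_neg_of_add_eq_zero_left h1.symm

theorem mink_dzbar_const {a b : ℂ → Mink d} {c : ℂ} (hU : IsOpen U) (ha : ContDiffOn ℝ ∞ a U)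
    (hb : ContDiffOn ℝ ∞ b U) (hab : ∀ w ∈ U, mink (a w) (b w) = c) {z : ℂ} (hz : z ∈ U) :
    mink (a z) (dzbar b z) = -mink (dzbar a z) (b z) := by
  have h1 := dzbar_bilin minkB (diffAt hU ha hz) (diffAt hU hb hz)
  rw [dzbar_congr (f := fun w => minkB (a w) (b w)) (g := fun _ => c) hU hab hz] at h1
  have h2 : dzbar (fun _ : ℂ => c) z = 0 := by simp [dzbar, du, dv]
  rw [h2] at h1
  exact eq_neg_of_add_eq_zero_left h1.symm

/-- The products of the derivatives of the canonical lift. -/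
structure LiftRel (Y : ℂ → Mink d) (z : ℂ) : Prop where
  yy : mink (Y z) (Y z) = 0
  y1 : mink (Y z) (dz Y z) = 0
  y2 : mink (Y z) (dzbar Y z) = 0
  r11 : mink (dz Y z) (dz Y z) = 0
  r12 : mink (dz Y z) (dzbar Y z) = 1 / 2
  r22 : mink (dzbar Y z) (dzbar Y z) = 0
  y3 : mink (Y z) (dzbar (dz Y) z) = -1 / 2
  r13 : mink (dz Y z) (dzbar (dz Y) z) = 0
  r23 : mink (dzbar Y z) (dzbar (dz Y) z) = 0
  yzz : mink (Y z) (dz (dz Y) z) = 0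
  r1zz : mink (dz Y z) (dz (dz Y) z) = 0
  r2zz : mink (dzbar Y z) (dz (dz Y) z) = 0

/-- Everything follows by differentiating the three constant products ⟨Y, Y⟩ = 0, ⟨Y_z, Y_z⟩ = 0,
⟨Y_z, Y_z̄⟩ = 1/2 and conjugating. -/
theorem liftRel (h : IsConformalOn f U) {z : ℂ} (hz : z ∈ U) : LiftRel (canonicalLift f) z := by
  have hU := h.fam.openU
  have hY := h.smooth_lift
  have hY1 := contDiffOn_dz hU hY
  have hY2 := contDiffOn_dzbar hU hY
  have y1 : ∀ w ∈ U, mink (canonicalLift f w) (dz (canonicalLift f) w) = 0 := fun w hw => by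
    have := mink_dz_const hU hY hY (fun x hx => h.mink_lift_lift hx) hw
    rw [mink_comm (dz _ w)] at this
    linear_combination this / 2
  have y2 : ∀ w ∈ U, mink (canonicalLift f w) (dzbar (canonicalLift f) w) = 0 := fun w hw => by
    have := mink_dzbar_const hU hY hY (fun x hx => h.mink_lift_lift hx) hw
    rw [mink_comm (dzbar _ w)] at this
    linear_combination this / 2
  have r22 : ∀ w ∈ U, mink (dzbar (canonicalLift f) w) (dzbar (canonicalLift f) w) = 0 := by
    intro w hw
    rw [← star_dz_of_real hU hY (star_canonicalLift f) hw, ← star_mink, h.mink_dz_dz hw, star_zero]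
  have r13 : mink (dz (canonicalLift f) z) (dzbar (dz (canonicalLift f)) z) = 0 := by
    have := mink_dzbar_const hU hY1 hY1 (fun x hx => h.mink_dz_dz hx) hz
    rw [mink_comm (dzbar _ z)] at this
    linear_combination this / 2
  have r23 : mink (dzbar (canonicalLift f) z) (dzbar (dz (canonicalLift f)) z) = 0 := by
    have := mink_dz_const hU hY2 hY2 r22 hz
    rw [dz_dzbar_comm hU hY hz, mink_comm (dzbar (dz _) z)] at this
    linear_combination this / 2
  have r1zz : mink (dz (canonicalLift f) z) (dz (dz (canonicalLift f)) z) = 0 := by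
    have := mink_dz_const hU hY1 hY1 (fun x hx => h.mink_dz_dz hx) hz
    rw [mink_comm (dz (dz _) z)] at this
    linear_combination this / 2
  refine ⟨h.mink_lift_lift hz, y1 z hz, y2 z hz, h.mink_dz_dz hz, h.mink_dz_dzbar hz, r22 z hz,
    ?_, r13, r23, ?_, r1zz, ?_⟩
  · rw [mink_dzbar_const hU hY hY1 y1 hz, mink_comm, h.mink_dz_dzbar hz]
    norm_num
  · rw [mink_dz_const hU hY hY1 y1 hz, h.mink_dz_dz hz, neg_zero]
  · have := mink_dz_const hU hY2 hY1 (c := 1 / 2)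
      (fun x hx => by rw [mink_comm]; exact h.mink_dz_dzbar hx) hz
    rw [this, dz_dzbar_comm hU hY hz, mink_comm, r13, neg_zero]

end IsConformalOn

/-! ### The projection along the moving frame of the canonical lift -/

section Pointwise

variable {Y : ℂ → Mink d} {z : ℂ}

open IsConformalOn

theorem mink_sectionN (r : LiftRel Y z) :
    mink (Y z) (sectionN Y z) = -1 ∧ mink (dz Y z) (sectionN Y z) = 0 ∧
    mink (dzbar Y z) (sectionN Y z) = 0 ∧ mink (sectionN Y z) (sectionN Y z) = 0 := by
  simp only [sectionN, mink_add_left, mink_add_right, mink_smul_left, mink_smul_right, r.yy, r.y3,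
    r.r13, r.r23, mink_comm _ (Y z), r.y1, r.y2]
  refine ⟨?_, ?_, ?_, ?_⟩ <;> ring

/-- The projection to `V_ℂ` in the frame given by the canonical lift. -/
def liftOp (Y : ℂ → Mink d) (z : ℂ) : Op d :=
  (2 : ℂ) • rk (dz Y z) (dzbar Y z) + (2 : ℂ) • rk (dzbar Y z) (dz Y z) - rk (Y z) (sectionN Y z) -
    rk (sectionN Y z) (Y z)

theorem liftOp_mulVec (Y : ℂ → Mink d) (z : ℂ) (x : Mink d) :
    (liftOp Y z).mulVec x = (2 * mink x (dzbar Y z)) • dz Y z + (2 * mink x (dz Y z)) • dzbar Y z -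
      mink x (sectionN Y z) • Y z - mink x (Y z) • sectionN Y z := by
  rw [← appB_apply, liftOp]
  simp only [map_sub, map_add, LinearMap.sub_apply, LinearMap.add_apply, map_smul,
    LinearMap.smul_apply, appB_apply, rk_mulVec, smul_smul, mink_comm x]

theorem normalProj_eq (Y : ℂ → Mink d) (z : ℂ) (x : Mink d) :
    normalProj Y z x = x - (liftOp Y z).mulVec x := by
  rw [liftOp_mulVec, normalProj]
  abel

theorem liftOp_selfadjoint (Y : ℂ → Mink d) (z : ℂ) (x y : Mink d) :
    mink ((liftOp Y z).mulVec x) y = mink x ((liftOp Y z).mulVec y) := by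
  simp only [liftOp_mulVec, mink_sub_left, mink_add_left, mink_smul_left, mink_comm x,
    mink_comm y]
  ring

theorem liftOp_fix (r : LiftRel Y z) :
    (liftOp Y z).mulVec (Y z) = Y z ∧ (liftOp Y z).mulVec (dz Y z) = dz Y z ∧
    (liftOp Y z).mulVec (dzbar Y z) = dzbar Y z ∧
    (liftOp Y z).mulVec (sectionN Y z) = sectionN Y z := by
  obtain ⟨n0, n1, n2, n3⟩ := mink_sectionN r
  have e21 : mink (dzbar Y z) (dz Y z) = 1 / 2 := by rw [mink_comm, r.r12]
  simp only [liftOp_mulVec, r.yy, r.y1, r.y2, r.r11, r.r12, r.r22, e21, n0, n1, n2, n3,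
    mink_comm _ (Y z), mink_comm (sectionN Y z) (dz Y z), mink_comm (sectionN Y z) (dzbar Y z)]
  refine ⟨?_, ?_, ?_, ?_⟩ <;> module

/-- Each operator is the identity on the image of the other. Taking adjoints, A = A* = (B A)* = A B
= B. -/
theorem op_eq_of_selfadjoint {A B : Op d}
    (hA : ∀ x y, mink (A.mulVec x) y = mink x (A.mulVec y))
    (hB : ∀ x y, mink (B.mulVec x) y = mink x (B.mulVec y)) (hAB : A * B = B) (hBA : B * A = A) :
    A = B := by
  apply op_ext
  intro x
  apply mink_left_injective
  intro y
  conv_lhs => rw [← hBA, ← Matrix.mulVec_mulVec, hB, hA, Matrix.mulVec_mulVec, hAB]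
  rw [hB]

end Pointwise

end Canonical

/-! ### Harmonicity of the conformal Gauss map and the Willmore equation -/

section Harmonic

variable {d : ℕ} {f : ℂ → Euc d} {U : Set ℂ}

/-- From P v = v one gets P_z v = (1 - P) v_z: on a section of V the derivative of P is the second
fundamental form of the bundle V. -/
theorem dz_mulVec_of_fix {P : ℂ → Op d} {v : ℂ → Mink d} (hU : IsOpen U)
    (hP : ContDiffOn ℝ ∞ P U) (hv : ContDiffOn ℝ ∞ v U) (hPv : ∀ w ∈ U, (P w).mulVec (v w) = v w)
    {z : ℂ} (hz : z ∈ U) : (dz P z).mulVec (v z) = dz v z - (P z).mulVec (dz v z) := by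
  have h1 := dz_bilin appB (diffAt hU hP hz) (diffAt hU hv hz)
  rw [dz_congr (f := fun w => appB (P w) (v w)) (g := v) hU hPv hz] at h1
  exact eq_sub_of_add_eq' h1.symm

theorem dzbar_mulVec_of_fix {P : ℂ → Op d} {v : ℂ → Mink d} (hU : IsOpen U)
    (hP : ContDiffOn ℝ ∞ P U) (hv : ContDiffOn ℝ ∞ v U) (hPv : ∀ w ∈ U, (P w).mulVec (v w) = v w)
    {z : ℂ} (hz : z ∈ U) : (dzbar P z).mulVec (v z) = dzbar v z - (P z).mulVec (dzbar v z) := by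
  have h1 := dzbar_bilin appB (diffAt hU hP hz) (diffAt hU hv hz)
  rw [dzbar_congr (f := fun w => appB (P w) (v w)) (g := v) hU hPv hz] at h1
  exact eq_sub_of_add_eq' h1.symm

/-- Differentiation of `A v = u`. -/
theorem dzbar_mulVec_eq {A : ℂ → Op d} {v u : ℂ → Mink d} (hU : IsOpen U)
    (hA : ContDiffOn ℝ ∞ A U) (hv : ContDiffOn ℝ ∞ v U) (hAv : ∀ w ∈ U, (A w).mulVec (v w) = u w)
    {z : ℂ} (hz : z ∈ U) : (dzbar A z).mulVec (v z) = dzbar u z - (A z).mulVec (dzbar v z) := by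
  have h1 := dzbar_bilin appB (diffAt hU hA hz) (diffAt hU hv hz)
  rw [dzbar_congr (f := fun w => appB (A w) (v w)) (g := u) hU hAv hz] at h1
  exact eq_sub_of_add_eq' h1.symm

theorem dz_split {P : ℂ → Op d} (hU : IsOpen U) (hP : ContDiffOn ℝ ∞ P U)
    (hPP : ∀ w ∈ U, P w * P w = P w) {z : ℂ} (hz : z ∈ U) :
    dz P z = P z * dz P z + dz P z * P z := by
  have h1 := dz_bilin mulB (diffAt hU hP hz) (diffAt hU hP hz)
  rw [dz_congr (f := fun w => mulB (P w) (P w)) (g := P) hU hPP hz] at h1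
  exact h1

theorem traceFree_of_conformal (h : IsConformalOn f U) {z : ℂ} (hz : z ∈ U) :
    traceFreeForm f z 0 0 + traceFreeForm f z 1 1 = 0 := by
  have h0 := h.fam.trace_traceFreeForm (Set.mem_univ 0) hz
  have hL := h.expOmega_pos hz
  have hg : firstForm f z = (expOmega f z ^ 2) • (1 : Matrix (Fin 2) (Fin 2) ℝ) := by
    have h01 : inner ℝ (partialDeriv f 0 z) (partialDeriv f 1 z) = (0 : ℝ) := (h.conf z hz).2
    have e00 : firstForm f z 0 0 = expOmega f z ^ 2 := (h.expOmega_sq hz).1.symm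
    have e11 : firstForm f z 1 1 = expOmega f z ^ 2 := (h.expOmega_sq hz).2.symm
    have e01 : firstForm f z 0 1 = 0 := h01
    have e10 : firstForm f z 1 0 = 0 := by rw [firstForm_symm, e01]
    ext i j
    fin_cases i <;> fin_cases j <;> simp [e00, e01, e10, e11]
  have hi : (firstForm f z)⁻¹ = ((expOmega f z ^ 2)⁻¹) • (1 : Matrix (Fin 2) (Fin 2) ℝ) := by
    rw [hg]
    apply Matrix.inv_eq_right_inv
    rw [smul_mul_smul_comm, mul_one, mul_inv_cancel₀ (by positivity), one_smul]
  rw [hi] at h0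
  simp only [Fin.sum_univ_two, Matrix.smul_apply, Matrix.one_apply_eq, smul_eq_mul, mul_one,
    Matrix.one_apply_ne (show (0 : Fin 2) ≠ 1 by decide),
    Matrix.one_apply_ne (show (1 : Fin 2) ≠ 0 by decide), mul_zero, zero_smul, add_zero,
    zero_add, ← smul_add] at h0
  exact (smul_eq_zero.1 h0).resolve_left (by positivity)

theorem normalLift_add (n H w w' : Euc d) :
    normalLift n H w + normalLift n H w' = normalLift n H (w + w') := by
  rw [normalLift, normalLift, normalLift, realPoint_add, inner_add_right]
  congr 1
  module

namespace IsConformalOn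

theorem gaussMap_lift (h : IsConformalOn f U) {z : ℂ} (hz : z ∈ U) :
    (gaussMap f z).mulVec (canonicalLift f z) = canonicalLift f z := by
  rw [canonicalLift, conePoint_eq, Matrix.mulVec_smul]
  congr 1
  exact gaussOp_cone (h.fam.isSphFrame (Set.mem_univ 0) hz)
    (h.fam.isNormalVec_meanCurvature (Set.mem_univ 0) hz)

theorem gaussMap_tang (h : IsConformalOn f U) {z : ℂ} (hz : z ∈ U) (i : Fin 2) :
    (gaussMap f z).mulVec (realPoint 0 (partialDeriv f i z)) = realPoint 0 (partialDeriv f i z) :=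
  gaussOp_tang (h.fam.isSphFrame (Set.mem_univ 0) hz)
    (h.fam.isNormalVec_meanCurvature (Set.mem_univ 0) hz) i

theorem gaussMap_cone (h : IsConformalOn f U) {z : ℂ} (hz : z ∈ U) :
    (gaussMap f z).mulVec (realPoint 1 (f z)) = realPoint 1 (f z) :=
  gaussOp_cone (h.fam.isSphFrame (Set.mem_univ 0) hz)
    (h.fam.isNormalVec_meanCurvature (Set.mem_univ 0) hz)

theorem gaussMap_dz_lift (h : IsConformalOn f U) {z : ℂ} (hz : z ∈ U) :
    (gaussMap f z).mulVec (dz (canonicalLift f) z) = dz (canonicalLift f) z := by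
  rw [h.dz_lift hz]
  simp only [Matrix.mulVec_add, Matrix.mulVec_smul, Matrix.mulVec_sub, h.gaussMap_tang hz,
    h.gaussMap_cone hz]

theorem star_mulVec_of_real {A : Op d} (hA : A.map star = A) (x : Mink d) :
    star (A.mulVec x) = A.mulVec (star x) := by
  funext i
  have : ∀ j, star (A i j) = A i j := fun j => congrFun (congrFun hA i) j
  simp only [Matrix.mulVec, dotProduct, Pi.star_apply, star_sum, star_mul']
  simp only [this]

theorem star_gaussMap (f : ℂ → Euc d) (z : ℂ) : (gaussMap f z).map star = gaussMap f z :=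
  star_gaussOp _ _ _

theorem gaussMap_dzbar_lift (h : IsConformalOn f U) {z : ℂ} (hz : z ∈ U) :
    (gaussMap f z).mulVec (dzbar (canonicalLift f) z) = dzbar (canonicalLift f) z := by
  rw [← star_dz_of_real h.fam.openU h.smooth_lift (star_canonicalLift f) hz,
    ← star_mulVec_of_real (star_gaussMap f z), h.gaussMap_dz_lift hz]

/-- Up to a factor this is (P_u + i P_v)(f_u - i f_v), the lift of q₀₀ + q₁₁ + i (q₁₀ - q₀₁) for the
trace-free form q. It vanishes because q is symmetric and, in a conformal coordinate, q₀₀ + q₁₁ = 0.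
-/
theorem dzbar_gaussMap_dz_lift (h : IsConformalOn f U) {z : ℂ} (hz : z ∈ U) :
    (dzbar (gaussMap f) z).mulVec (dz (canonicalLift f) z) = 0 := by
  have hc := h.fam.fderiv_gaussMap_cone (Set.mem_univ 0) hz
  have ht := h.fam.fderiv_gaussMap_tang (Set.mem_univ 0) hz
  have hs := h.fam.traceFreeForm_symm (Set.mem_univ 0) hz
  have h0 := traceFree_of_conformal h hz
  have hz0 : normalLift (f z) (meanCurvature f z) (traceFreeForm f z 0 0) +
      normalLift (f z) (meanCurvature f z) (traceFreeForm f z 1 1) = 0 := by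
    rw [normalLift_add, h0]
    funext i
    refine Fin.cases ?_ (fun i => ?_) i <;> simp [normalLift, realPoint]
  rw [h.dz_lift hz]
  change ((1 / 2 : ℂ) • (fderiv ℝ (gaussMap f) z (coordDir 0) +
    Complex.I • fderiv ℝ (gaussMap f) z (coordDir 1))).mulVec _ = 0
  simp only [← appB_apply] at hc ht ⊢
  simp only [map_add, map_smul, map_sub, LinearMap.add_apply, LinearMap.smul_apply, hc, ht, hs]
  rw [eq_neg_of_add_eq_zero_left hz0]
  match_scalars <;> (ring_nf; try simp [Complex.I_sq])

/-- The previous lemma says that Y_{z z̄} has no component outside the image of P; hence the mean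
curvature sphere contains the whole space V. -/
theorem gaussMap_dzbar_dz_lift (h : IsConformalOn f U) {z : ℂ} (hz : z ∈ U) :
    (gaussMap f z).mulVec (dzbar (dz (canonicalLift f)) z) = dzbar (dz (canonicalLift f)) z := by
  have h1 := dzbar_mulVec_of_fix h.fam.openU h.gaussMap_smooth
    (contDiffOn_dz h.fam.openU h.smooth_lift) (fun w hw => h.gaussMap_dz_lift hw) hz
  rw [h.dzbar_gaussMap_dz_lift hz] at h1
  exact (sub_eq_zero.1 h1.symm).symm

/-- Y, Y_z, Y_z̄ have the same span as F, (0, f_u), (0, f_v); the latter are recovered by adding Y_z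
and Y_z̄ and dividing by the conformal factor. -/
theorem liftOp_fix_tang (h : IsConformalOn f U) {z : ℂ} (hz : z ∈ U) :
    (liftOp (canonicalLift f) z).mulVec (realPoint 1 (f z)) = realPoint 1 (f z) ∧
    ∀ i, (liftOp (canonicalLift f) z).mulVec (realPoint 0 (partialDeriv f i z)) =
      realPoint 0 (partialDeriv f i z) := by
  obtain ⟨e0, e1, e2, -⟩ := liftOp_fix (h.liftRel hz)
  have hl : (((expOmega f z)⁻¹ : ℝ) : ℂ) ≠ 0 :=
    Complex.ofReal_ne_zero.2 (inv_pos.2 (h.expOmega_pos hz)).ne'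
  have hF : (liftOp (canonicalLift f) z).mulVec (realPoint 1 (f z)) = realPoint 1 (f z) := by
    rw [canonicalLift, conePoint_eq, Matrix.mulVec_smul] at e0
    exact smul_right_injective _ hl e0
  refine ⟨hF, ?_⟩
  have h1 := h.dz_lift hz
  have h2 := star_dz_of_real h.fam.openU h.smooth_lift (star_canonicalLift f) hz
  have hst : ∀ c : ℝ, star ((c : ℂ) / 2) = (c : ℂ) / 2 := by intro c; simp
  rw [h1] at h2
  simp only [star_add, star_smul, star_sub, star_realPoint, hst, Complex.star_def,
    Complex.conj_I] at h2
  rw [h1] at e1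
  rw [← h2] at e2
  simp only [Matrix.mulVec_add, Matrix.mulVec_smul, Matrix.mulVec_sub, hF, add_left_inj] at e1 e2
  have hl2 : (((expOmega f z)⁻¹ : ℝ) : ℂ) / 2 ≠ 0 := div_ne_zero hl two_ne_zero
  have e1' := smul_right_injective _ hl2 e1
  have e2' := smul_right_injective _ hl2 e2
  simp only [neg_smul, sub_neg_eq_add] at e1' e2'
  have h0 : (2 : ℂ) • (liftOp (canonicalLift f) z).mulVec (realPoint 0 (partialDeriv f 0 z)) =
      (2 : ℂ) • realPoint 0 (partialDeriv f 0 z) := by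
    rw [two_smul, two_smul]
    have := congrArg₂ (· + ·) e1' e2'
    rw [show ∀ a b : Mink d, a - b + (a + b) = a + a by intros; abel,
      show ∀ a b : Mink d, a - b + (a + b) = a + a by intros; abel] at this
    exact this
  have h3 := smul_right_injective _ (two_ne_zero (α := ℂ)) h0
  rw [Fin.forall_fin_two]
  refine ⟨h3, ?_⟩
  rw [h3, add_right_inj] at e2'
  exact smul_right_injective _ Complex.I_ne_zero e2'

/-- The conformal Gauss map in terms of the canonical lift. -/
theorem gaussMap_eq_liftOp (h : IsConformalOn f U) {z : ℂ} (hz : z ∈ U) :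
    gaussMap f z = liftOp (canonicalLift f) z := by
  have r := h.liftRel hz
  obtain ⟨e0, e1, e2, e3⟩ := liftOp_fix r
  obtain ⟨hF, hT⟩ := h.liftOp_fix_tang hz
  have hG : (gaussMap f z).mulVec (sectionN (canonicalLift f) z) = sectionN (canonicalLift f) z := by
    simp only [sectionN, Matrix.mulVec_add, Matrix.mulVec_smul, h.gaussMap_lift hz,
      h.gaussMap_dzbar_dz_lift hz]
  have hW : (liftOp (canonicalLift f) z).mulVec (dzbar (dz (canonicalLift f)) z) =
      dzbar (dz (canonicalLift f)) z := by
    have : dzbar (dz (canonicalLift f)) z = (1 / 2 : ℂ) • (sectionN (canonicalLift f) z -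
        (2 * mink (dzbar (dz (canonicalLift f)) z) (dzbar (dz (canonicalLift f)) z)) •
          canonicalLift f z) := by
      rw [sectionN]
      module
    rw [this, Matrix.mulVec_smul, Matrix.mulVec_sub, Matrix.mulVec_smul, e0, e3]
  -- Expand Y_{z z̄}, which both projections fix, in F, (0, f_i), F*. All other terms are fixed, and
  -- the coefficient -⟨F, Y_{z z̄}⟩ of F* is non-zero because ⟨Y, Y_{z z̄}⟩ = -1/2.
  have hD : (liftOp (canonicalLift f) z).mulVec (dualPoint (f z) (meanCurvature f z)) =
      dualPoint (f z) (meanCurvature f z) := by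
    have h1 := h.gaussMap_dzbar_dz_lift hz
    rw [gaussMap, gaussOp_mulVec] at h1
    have h2 := (congrArg (liftOp (canonicalLift f) z).mulVec h1).trans (hW.trans h1.symm)
    simp only [Fin.sum_univ_two, Matrix.mulVec_add, Matrix.mulVec_smul, Matrix.mulVec_sub, hF,
      hT] at h2
    have h3 := sub_right_injective h2
    refine smul_right_injective _ ?_ h3
    intro h4
    have h5 := r.y3
    rw [canonicalLift, conePoint_eq, mink_smul_left, h4] at h5
    norm_num at h5
  refine op_eq_of_selfadjoint (gaussOp_selfadjoint _ _ _) (liftOp_selfadjoint _ _) ?_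
    (gaussOp_mul_of_fix hF hT hD)
  simp only [liftOp, ← mulB_apply, map_sub, map_add, map_smul]
  simp only [mulB_apply, mul_rk, h.gaussMap_lift hz, h.gaussMap_dz_lift hz,
    h.gaussMap_dzbar_lift hz, hG]

end IsConformalOn

end Harmonic

/-! ### The Willmore operator as a component of the Laplacian of the Gauss map -/

section WillmoreEquation

variable {d : ℕ} {f : ℂ → Euc d} {U : Set ℂ}

namespace IsConformalOn

theorem normalProj_eq_gaussMap (h : IsConformalOn f U) {z : ℂ} (hz : z ∈ U) (x : Mink d) :
    normalProj (canonicalLift f) z x = x - (gaussMap f z).mulVec x := by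
  rw [normalProj_eq, h.gaussMap_eq_liftOp hz]

theorem idem (h : IsConformalOn f U) {z : ℂ} (hz : z ∈ U) :
    gaussMap f z * gaussMap f z = gaussMap f z := h.fam.gaussMap_idem (Set.mem_univ 0) hz

theorem gaussMap_normalProj (h : IsConformalOn f U) {z : ℂ} (hz : z ∈ U) (x : Mink d) :
    (gaussMap f z).mulVec (normalProj (canonicalLift f) z x) = 0 := by
  rw [h.normalProj_eq_gaussMap hz, Matrix.mulVec_sub, Matrix.mulVec_mulVec, h.idem hz, sub_self]

theorem normalProj_of_gaussMap_eq (h : IsConformalOn f U) {z : ℂ} (hz : z ∈ U) {x : Mink d}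
    (hx : (gaussMap f z).mulVec x = x) : normalProj (canonicalLift f) z x = 0 := by
  rw [h.normalProj_eq_gaussMap hz, hx, sub_self]

theorem normalProj_of_gaussMap_zero (h : IsConformalOn f U) {z : ℂ} (hz : z ∈ U) {x : Mink d}
    (hx : (gaussMap f z).mulVec x = 0) : normalProj (canonicalLift f) z x = x := by
  rw [h.normalProj_eq_gaussMap hz, hx, sub_zero]

/-- Y_zz is orthogonal to Y, Y_z and Y_z̄, so its tangential part is a multiple of Y alone. -/
theorem hopf_eq (h : IsConformalOn f U) {z : ℂ} (hz : z ∈ U) :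
    hopf (canonicalLift f) z =
      normalProj (canonicalLift f) z (dz (dz (canonicalLift f)) z) := by
  have r := h.liftRel hz
  rw [hopf, schwarzian, normalProj, mink_comm (dz (dz _) z) (canonicalLift f z), r.yzz,
    mink_comm _ (dzbar _ z), r.r2zz, mink_comm _ (dz _ z), r.r1zz]
  module

/-- `P_z Y_z = κ`. -/
theorem dz_gaussMap_dz_lift (h : IsConformalOn f U) {z : ℂ} (hz : z ∈ U) :
    (dz (gaussMap f) z).mulVec (dz (canonicalLift f) z) = hopf (canonicalLift f) z := by
  rw [dz_mulVec_of_fix h.fam.openU h.gaussMap_smooth (contDiffOn_dz h.fam.openU h.smooth_lift)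
    (fun w hw => h.gaussMap_dz_lift hw) hz, h.hopf_eq hz, h.normalProj_eq_gaussMap hz]

theorem dz_gaussMap_lift (h : IsConformalOn f U) {z : ℂ} (hz : z ∈ U) :
    (dz (gaussMap f) z).mulVec (canonicalLift f z) = 0 := by
  rw [dz_mulVec_of_fix h.fam.openU h.gaussMap_smooth h.smooth_lift
    (fun w hw => h.gaussMap_lift hw) hz, h.gaussMap_dz_lift hz, sub_self]

theorem dz_gaussMap_dzbar_lift (h : IsConformalOn f U) {z : ℂ} (hz : z ∈ U) :
    (dz (gaussMap f) z).mulVec (dzbar (canonicalLift f) z) = 0 := by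
  rw [dz_mulVec_of_fix h.fam.openU h.gaussMap_smooth (contDiffOn_dzbar h.fam.openU h.smooth_lift)
    (fun w hw => h.gaussMap_dzbar_lift hw) hz, dz_dzbar_comm h.fam.openU h.smooth_lift hz,
    h.gaussMap_dzbar_dz_lift hz, sub_self]

theorem smooth_hopf (h : IsConformalOn f U) : ContDiffOn ℝ ∞ (hopf (canonicalLift f)) U :=
  (contDiffOn_bilin appB (contDiffOn_dz h.fam.openU h.gaussMap_smooth)
    (contDiffOn_dz h.fam.openU h.smooth_lift)).congr fun _ hz => (h.dz_gaussMap_dz_lift hz).symm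

theorem smooth_schwarzian (h : IsConformalOn f U) :
    ContDiffOn ℝ ∞ (schwarzian (canonicalLift f)) U := by
  have hU := h.fam.openU
  have h1 := contDiffOn_dz hU h.smooth_lift
  have h2 := contDiffOn_dzbar hU h1
  have hN : ContDiffOn ℝ ∞ (sectionN (canonicalLift f)) U :=
    (h2.const_smul (2 : ℂ)).add
      ((contDiffOn_const.mul (contDiffOn_bilin minkB h2 h2)).smul h.smooth_lift)
  exact contDiffOn_const.mul (contDiffOn_bilin minkB (contDiffOn_dz hU h1) hN)

theorem gaussMap_hopf (h : IsConformalOn f U) {z : ℂ} (hz : z ∈ U) :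
    (gaussMap f z).mulVec (hopf (canonicalLift f) z) = 0 := by
  rw [h.hopf_eq hz, h.gaussMap_normalProj hz]

theorem normalProj_add (Y : ℂ → Mink d) (z : ℂ) (x y : Mink d) :
    normalProj Y z (x + y) = normalProj Y z x + normalProj Y z y := by
  simp only [normalProj_eq, Matrix.mulVec_add]
  abel

theorem normalProj_sub (Y : ℂ → Mink d) (z : ℂ) (x y : Mink d) :
    normalProj Y z (x - y) = normalProj Y z x - normalProj Y z y := by
  simp only [normalProj_eq, Matrix.mulVec_sub]
  abel

theorem normalProj_smul (Y : ℂ → Mink d) (z : ℂ) (c : ℂ) (x : Mink d) :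
    normalProj Y z (c • x) = c • normalProj Y z x := by
  simp only [normalProj_eq, Matrix.mulVec_smul, smul_sub]

/-- `Y_zz = κ - (s / 2) Y`. -/
theorem dz_dz_lift (Y : ℂ → Mink d) (z : ℂ) :
    dz (dz Y) z = hopf Y z - (schwarzian Y z / 2) • Y z := by
  rw [hopf]
  abel

theorem dzbar_smul_lift (h : IsConformalOn f U) {g : ℂ → ℂ} (hg : ContDiffOn ℝ ∞ g U) {z : ℂ}
    (hz : z ∈ U) : dzbar (fun w => g w • canonicalLift f w) z =
      g z • dzbar (canonicalLift f) z + dzbar g z • canonicalLift f z :=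
  dzbar_bilin (LinearMap.lsmul ℂ (Mink d)) (diffAt h.fam.openU hg hz)
    (diffAt h.fam.openU h.smooth_lift hz)

theorem dz_smul_lift (h : IsConformalOn f U) {g : ℂ → ℂ} (hg : ContDiffOn ℝ ∞ g U) {z : ℂ}
    (hz : z ∈ U) : dz (fun w => g w • canonicalLift f w) z =
      g z • dz (canonicalLift f) z + dz g z • canonicalLift f z :=
  dz_bilin (LinearMap.lsmul ℂ (Mink d)) (diffAt h.fam.openU hg hz)
    (diffAt h.fam.openU h.smooth_lift hz)

theorem dzbar_sub {a b : ℂ → Mink d} {z : ℂ} (ha : DifferentiableAt ℝ a z)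
    (hb : DifferentiableAt ℝ b z) : dzbar (fun w => a w - b w) z = dzbar a z - dzbar b z := by
  simp only [dzbar, du, dv, fderiv_fun_sub ha hb, _root_.sub_apply]
  module

theorem dz_sub {a b : ℂ → Mink d} {z : ℂ} (ha : DifferentiableAt ℝ a z)
    (hb : DifferentiableAt ℝ b z) : dz (fun w => a w - b w) z = dz a z - dz b z := by
  simp only [dz, du, dv, fderiv_fun_sub ha hb, _root_.sub_apply]
  module

/-- `P_z Y_{z z̄} = D_z̄ κ`. -/
theorem dz_gaussMap_dzbar_dz_lift (h : IsConformalOn f U) {z : ℂ} (hz : z ∈ U) :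
    (dz (gaussMap f) z).mulVec (dzbar (dz (canonicalLift f)) z) =
      normalDzbar (canonicalLift f) (hopf (canonicalLift f)) z := by
  have hU := h.fam.openU
  have hY1 := contDiffOn_dz hU h.smooth_lift
  have hs : ContDiffOn ℝ ∞ (fun w => schwarzian (canonicalLift f) w / 2) U :=
    h.smooth_schwarzian.div_const 2
  have hsY : ContDiffOn ℝ ∞ (fun w => (schwarzian (canonicalLift f) w / 2) • canonicalLift f w) U :=
    hs.smul h.smooth_lift
  rw [dz_mulVec_of_fix hU h.gaussMap_smooth (contDiffOn_dzbar hU hY1)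
    (fun w hw => h.gaussMap_dzbar_dz_lift hw) hz, dz_dzbar_comm hU hY1 hz,
    ← h.normalProj_eq_gaussMap hz,
    dzbar_congr hU (fun w _ => dz_dz_lift (canonicalLift f) w) hz,
    dzbar_sub (diffAt hU h.smooth_hopf hz) (diffAt hU hsY hz),
    h.dzbar_smul_lift hs hz, normalProj_sub, normalProj_add, normalProj_smul, normalProj_smul,
    h.normalProj_of_gaussMap_eq hz (h.gaussMap_lift hz),
    h.normalProj_of_gaussMap_eq hz (h.gaussMap_dzbar_lift hz), normalDzbar]
  simp

theorem smooth_normalDzbar (h : IsConformalOn f U) {ψ : ℂ → Mink d} (hψ : ContDiffOn ℝ ∞ ψ U) :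
    ContDiffOn ℝ ∞ (normalDzbar (canonicalLift f) ψ) U := by
  have hU := h.fam.openU
  have h1 := contDiffOn_dzbar hU hψ
  exact (h1.sub (contDiffOn_bilin appB h.gaussMap_smooth h1)).congr fun z hz =>
    h.normalProj_eq_gaussMap hz _

/-- `P_z` exchanges the normal and the tangential parts. -/
theorem normalProj_dz_gaussMap (h : IsConformalOn f U) {z : ℂ} (hz : z ∈ U) (x : Mink d) :
    normalProj (canonicalLift f) z ((dz (gaussMap f) z).mulVec x) =
      (dz (gaussMap f) z).mulVec ((gaussMap f z).mulVec x) := by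
  have h1 := dz_split h.fam.openU h.gaussMap_smooth (fun w hw => h.idem hw) hz
  rw [h.normalProj_eq_gaussMap hz, Matrix.mulVec_mulVec, Matrix.mulVec_mulVec]
  conv_lhs => enter [1, 1]; rw [h1]
  rw [Matrix.add_mulVec]
  abel

/-- Under these two conditions the V-part of x involves only Y and Y_z̄, and P_z kills both. -/
theorem dz_gaussMap_of_orthogonal (h : IsConformalOn f U) {z : ℂ} (hz : z ∈ U) {x : Mink d}
    (h0 : mink x (canonicalLift f z) = 0) (h1 : mink x (dzbar (canonicalLift f) z) = 0) :
    normalProj (canonicalLift f) z ((dz (gaussMap f) z).mulVec x) = 0 := by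
  rw [h.normalProj_dz_gaussMap hz, h.gaussMap_eq_liftOp hz, liftOp_mulVec, h0, h1]
  simp only [Matrix.mulVec_sub, Matrix.mulVec_add, Matrix.mulVec_smul, h.dz_gaussMap_lift hz,
    h.dz_gaussMap_dzbar_lift hz]
  simp

theorem mink_hopf (h : IsConformalOn f U) {z : ℂ} (hz : z ∈ U) {x : Mink d}
    (hx : (gaussMap f z).mulVec x = x) : mink (hopf (canonicalLift f) z) x = 0 := by
  rw [← hx, gaussMap, ← gaussOp_selfadjoint]
  change mink ((gaussMap f z).mulVec _) x = 0
  rw [h.gaussMap_hopf hz, mink_zero_left]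

/-- The normal part of `P_{z z̄} Y_{z z̄}` is the Willmore operator. -/
theorem laplacian_dzbar_dz_lift (h : IsConformalOn f U) {z : ℂ} (hz : z ∈ U) :
    normalProj (canonicalLift f) z
      ((dzbar (dz (gaussMap f)) z).mulVec (dzbar (dz (canonicalLift f)) z)) =
      willmoreOperator (canonicalLift f) z := by
  have hU := h.fam.openU
  have hY := h.smooth_lift
  have hY1 := contDiffOn_dz hU hY
  have hY2 := contDiffOn_dzbar hU hY
  have hs : ContDiffOn ℝ ∞ (fun w => star (schwarzian (canonicalLift f) w) / 2) U :=
    (contDiffOn_star h.smooth_schwarzian).div_const 2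
  have hsY : ContDiffOn ℝ ∞
      (fun w => (star (schwarzian (canonicalLift f) w) / 2) • canonicalLift f w) U := hs.smul hY
  have hκ := contDiffOn_star h.smooth_hopf
  have hr := star_canonicalLift f
  have e22 : ∀ w ∈ U, dzbar (dzbar (canonicalLift f)) w = star (hopf (canonicalLift f) w) -
      (star (schwarzian (canonicalLift f) w) / 2) • canonicalLift f w := by
    intro w hw
    rw [dzbar_congr (g := fun w => star (dz (canonicalLift f) w)) hU
      (fun x hx => (star_dz_of_real hU hY hr hx).symm) hw, dzbar_star (diffAt hU hY1 hw),
      dz_dz_lift, star_sub, star_smul, hr]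
    simp
  -- Conjugating Y_zz = κ - (s/2) Y and applying ∂_z. After P_z, the term with Y_z yields (s̄/2) κ
  -- and the term with Y dies.
  have e1 : dzbar (dzbar (dz (canonicalLift f))) z =
      dz (fun w => star (hopf (canonicalLift f) w)) z -
      ((star (schwarzian (canonicalLift f) z) / 2) • dz (canonicalLift f) z +
        dz (fun w => star (schwarzian (canonicalLift f) w) / 2) z • canonicalLift f z) := by
    rw [dzbar_congr (g := dz (dzbar (canonicalLift f))) hU
      (fun x hx => (dz_dzbar_comm hU hY hx).symm) hz, ← dz_dzbar_comm hU hY2 hz,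
      dz_congr hU e22 hz, dz_sub (diffAt hU hκ hz) (diffAt hU hsY hz),
      h.dz_smul_lift hs hz]
  have o1 : ∀ w ∈ U, mink (star (hopf (canonicalLift f) w)) (canonicalLift f w) = 0 := by
    intro w hw
    rw [← hr w, ← star_mink, h.mink_hopf hw (h.gaussMap_lift hw), star_zero]
  have o2 : ∀ w ∈ U, mink (star (hopf (canonicalLift f) w)) (dzbar (canonicalLift f) w) = 0 := by
    intro w hw
    rw [← star_dz_of_real hU hY hr hw, ← star_mink, h.mink_hopf hw (h.gaussMap_dz_lift hw),
      star_zero]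
  have o3 : mink (star (hopf (canonicalLift f) z)) (dz (canonicalLift f) z) = 0 := by
    have := star_dz_of_real hU hY hr hz
    rw [← star_star (dz (canonicalLift f) z), this, ← star_mink,
      h.mink_hopf hz (h.gaussMap_dzbar_lift hz), star_zero]
  have o4 : mink (star (hopf (canonicalLift f) z)) (dzbar (dz (canonicalLift f)) z) = 0 := by
    have : star (dzbar (dz (canonicalLift f)) z) = dzbar (dz (canonicalLift f)) z := by
      rw [← dz_star (diffAt hU hY1 hz), ← dz_dzbar_comm hU hY hz]
      exact dz_congr hU (fun x hx => star_dz_of_real hU hY hr hx) hz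
    rw [← this, ← star_mink, h.mink_hopf hz (h.gaussMap_dzbar_dz_lift hz), star_zero]
  -- Moving the derivative onto Y and Y_z̄, which stay in V, shows that (κ̄)_z is orthogonal to
  -- both, so P_z (κ̄)_z has no normal part.
  have q1 : mink (dz (fun w => star (hopf (canonicalLift f) w)) z) (canonicalLift f z) = 0 := by
    have := mink_dz_const hU hκ hY o1 hz
    rw [o3] at this
    linear_combination this
  have q2 : mink (dz (fun w => star (hopf (canonicalLift f) w)) z)
      (dzbar (canonicalLift f) z) = 0 := by
    have := mink_dz_const hU hκ hY2 o2 hz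
    rw [dz_dzbar_comm hU hY hz, o4] at this
    linear_combination this
  rw [dzbar_mulVec_eq hU (contDiffOn_dz hU h.gaussMap_smooth) (contDiffOn_dzbar hU hY1)
    (fun w hw => h.dz_gaussMap_dzbar_dz_lift hw) hz, e1]
  simp only [Matrix.mulVec_sub, Matrix.mulVec_add, Matrix.mulVec_smul, h.dz_gaussMap_dz_lift hz,
    h.dz_gaussMap_lift hz, normalProj_sub, normalProj_smul,
    h.dz_gaussMap_of_orthogonal hz q1 q2, h.normalProj_of_gaussMap_zero hz (h.gaussMap_hopf hz),
    smul_zero, add_zero]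
  rw [willmoreOperator, normalDzbar]
  abel

theorem normalProj_normalDzbar (h : IsConformalOn f U) {z : ℂ} (hz : z ∈ U) (ψ : ℂ → Mink d) :
    normalProj (canonicalLift f) z (normalDzbar (canonicalLift f) ψ z) =
      normalDzbar (canonicalLift f) ψ z :=
  h.normalProj_of_gaussMap_zero hz (h.gaussMap_normalProj hz _)

/-- The component of `P_{z z̄}` from `V` to `V^⊥` is given by the Willmore operator. -/
theorem laplacian_gaussMap (h : IsConformalOn f U) {z : ℂ} (hz : z ∈ U) (x : Mink d) :
    normalProj (canonicalLift f) z
      ((dzbar (dz (gaussMap f)) z).mulVec ((gaussMap f z).mulVec x)) =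
      (-(2 * mink x (canonicalLift f z))) • willmoreOperator (canonicalLift f) z := by
  have hU := h.fam.openU
  have hY := h.smooth_lift
  have hY1 := contDiffOn_dz hU hY
  have hY2 := contDiffOn_dzbar hU hY
  have hP1 := contDiffOn_dz hU h.gaussMap_smooth
  have z0 : ∀ v : Mink d, (gaussMap f z).mulVec v = 0 → normalProj (canonicalLift f) z v = v :=
    fun v => h.normalProj_of_gaussMap_zero hz
  have n0 : normalProj (canonicalLift f) z (0 : Mink d) = 0 := z0 0 (by simp)
  have dz0 : dzbar (fun _ : ℂ => (0 : Mink d)) z = 0 := by simp [dzbar, du, dv]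
  have a0 : (dzbar (dz (gaussMap f)) z).mulVec (canonicalLift f z) = 0 := by
    rw [dzbar_mulVec_eq hU hP1 hY (u := fun _ => 0) (fun w hw => h.dz_gaussMap_lift hw) hz,
      h.dz_gaussMap_dzbar_lift hz, dz0, sub_zero]
  have a1 : normalProj (canonicalLift f) z
      -- Here P_{z z̄} Y_z = ∂_z̄ κ - P_z Y_{z z̄} = ∂_z̄ κ - D_z̄ κ, which is tangential. With `a0`
      -- and `a2`, only the N-component -⟨x, Y⟩ N of P x survives, and N is 2 Y_{z z̄} modulo Y.
      ((dzbar (dz (gaussMap f)) z).mulVec (dz (canonicalLift f) z)) = 0 := by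
    rw [dzbar_mulVec_eq hU hP1 hY1 (fun w hw => h.dz_gaussMap_dz_lift hw) hz,
      h.dz_gaussMap_dzbar_dz_lift hz, normalProj_sub, h.normalProj_normalDzbar hz]
    exact sub_self _
  have a2 : normalProj (canonicalLift f) z
      ((dzbar (dz (gaussMap f)) z).mulVec (dzbar (canonicalLift f) z)) = 0 := by
    have hr := star_canonicalLift f
    rw [dzbar_mulVec_eq hU hP1 hY2 (u := fun _ => 0) (fun w hw => h.dz_gaussMap_dzbar_lift hw) hz,
      dz0, normalProj_sub, n0, h.dz_gaussMap_of_orthogonal hz, sub_zero]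
    · have := mink_dzbar_const hU hY hY2 (fun w hw => (h.liftRel hw).y2) hz
      rw [mink_comm, this, (h.liftRel hz).r22, neg_zero]
    · have := mink_dzbar_const hU hY2 hY2 (fun w hw => (h.liftRel hw).r22) hz
      rw [mink_comm (dzbar (canonicalLift f) z)] at this
      linear_combination this / 2
  have a3 := h.laplacian_dzbar_dz_lift hz
  conv_lhs => rw [h.gaussMap_eq_liftOp hz, liftOp_mulVec]
  simp only [Matrix.mulVec_sub, Matrix.mulVec_add, Matrix.mulVec_smul, normalProj_sub,
    normalProj_add, normalProj_smul, a0, a1, a2, n0]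
  rw [sectionN]
  simp only [Matrix.mulVec_add, Matrix.mulVec_smul, normalProj_add, normalProj_smul, a0, a3, n0]
  module

end IsConformalOn

end WillmoreEquation

/-! ### The Willmore equation of H-totally isotropic surfaces -/

section Isotropic

variable {d : ℕ} {f : ℂ → Euc d} {U : Set ℂ}

/-- Entrywise conjugation of operators. -/
def conjOp : Op d →L[ℝ] Op d :=
  LinearMap.toContinuousLinearMap
    { toFun := fun A => A.map star
      map_add' := fun A B => by ext; simp
      map_smul' := fun r A => by ext; simp }

theorem fderiv_map_star {P : ℂ → Op d} (hU : IsOpen U) (hP : ContDiffOn ℝ ∞ P U)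
    (hr : ∀ z ∈ U, (P z).map star = P z) {z : ℂ} (hz : z ∈ U) (e : ℂ) :
    (fderiv ℝ P z e).map star = fderiv ℝ P z e := by
  have h1 : HasFDerivAt (fun w => conjOp (P w)) (conjOp.comp (fderiv ℝ P z)) z :=
    conjOp.hasFDerivAt.comp z (diffAt hU hP hz).hasFDerivAt
  have h2 : (fun w => conjOp (P w)) =ᶠ[nhds z] P :=
    Filter.eventually_of_mem (hU.mem_nhds hz) hr
  exact DFunLike.congr_fun (h1.fderiv.symm.trans h2.fderiv_eq) e

theorem laplacian_map_star {P : ℂ → Op d} (hU : IsOpen U) (hP : ContDiffOn ℝ ∞ P U)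
    (hr : ∀ z ∈ U, (P z).map star = P z) {z : ℂ} (hz : z ∈ U) :
    (dzbar (dz P) z).map star = dzbar (dz P) z := by
  have h1 : ∀ e, (fderiv ℝ (fun w => fderiv ℝ P w e) z e).map star =
      fderiv ℝ (fun w => fderiv ℝ P w e) z e := fun e =>
    fderiv_map_star hU (contDiffOn_fderiv_apply hU hP e)
      (fun w hw => fderiv_map_star hU hP hr hw e) hz e
  have hs : ∀ A B : Op d, ((1 / 4 : ℂ) • (A + B)).map star =
      (1 / 4 : ℂ) • (A.map star + B.map star) := fun A B => by
    ext
    simp [Complex.conj_ofNat, mul_add]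
  rw [dzbar_dz_eq hU hP hz, hs]
  exact congrArg₂ (fun A B => (1 / 4 : ℂ) • (A + B)) (h1 1) (h1 Complex.I)

theorem star_dzbar_dz_of_real {Y : ℂ → Mink d} (hU : IsOpen U) (hY : ContDiffOn ℝ ∞ Y U)
    (hr : ∀ z, star (Y z) = Y z) {z : ℂ} (hz : z ∈ U) :
    star (dzbar (dz Y) z) = dzbar (dz Y) z := by
  rw [← dz_star (diffAt hU (contDiffOn_dz hU hY) hz), ← dz_dzbar_comm hU hY hz]
  exact dz_congr hU (fun x hx => star_dz_of_real hU hY hr hx) hz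

namespace IsConformalOn

/-- The Codazzi equation: the Willmore operator is real. -/
theorem star_willmoreOperator (h : IsConformalOn f U) {z : ℂ} (hz : z ∈ U) :
    star (willmoreOperator (canonicalLift f) z) = willmoreOperator (canonicalLift f) z := by
  have h1 := laplacian_map_star h.fam.openU h.gaussMap_smooth (fun w _ => star_gaussMap f w) hz
  have h2 := star_dzbar_dz_of_real h.fam.openU h.smooth_lift (star_canonicalLift f) hz
  rw [← h.laplacian_dzbar_dz_lift hz, h.normalProj_eq_gaussMap hz, star_sub,
    star_mulVec_of_real (star_gaussMap f z), star_mulVec_of_real h1, h2]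

theorem gaussMap_of_mem_normalSpace (h : IsConformalOn f U) {z : ℂ} (hz : z ∈ U) {x : Mink d}
    (hx : x ∈ normalSpace (canonicalLift f) z) : (gaussMap f z).mulVec x = 0 := by
  obtain ⟨h0, h1, h2, h3⟩ := hx
  have h4 : mink x (sectionN (canonicalLift f) z) = 0 := by
    simp only [sectionN, mink_add_right, mink_smul_right, h0, h3]
    ring
  rw [h.gaussMap_eq_liftOp hz, liftOp_mulVec, h0, h1, h2, h4]
  simp

theorem hopf_mem_normalSpace (h : IsConformalOn f U) {z : ℂ} (hz : z ∈ U) :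
    hopf (canonicalLift f) z ∈ normalSpace (canonicalLift f) z :=
  ⟨h.mink_hopf hz (h.gaussMap_lift hz), h.mink_hopf hz (h.gaussMap_dz_lift hz),
    h.mink_hopf hz (h.gaussMap_dzbar_lift hz), h.mink_hopf hz (h.gaussMap_dzbar_dz_lift hz)⟩

end IsConformalOn

/-- The span of `E₂, …, E_m`. -/
def frameSpan (m : ℕ) (E : ℕ → ℂ → Mink d) (z : ℂ) : Submodule ℂ (Mink d) :=
  Submodule.span ℂ {x | ∃ l ∈ Finset.Icc 2 m, x = E l z}

variable {m : ℕ} {E : ℕ → ℂ → Mink d}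

theorem mem_frameSpan {z : ℂ} {j : ℕ} (hj : j ∈ Finset.Icc 2 m) : E j z ∈ frameSpan m E z :=
  Submodule.subset_span ⟨j, hj, rfl⟩

theorem Icc_two_subset {j : ℕ} (hj : j ∈ Finset.Icc 2 m) : j ∈ Finset.Icc 1 m := by
  simp only [Finset.mem_Icc] at *
  omega

namespace IsAdaptedIsotropicFrame

theorem gaussMap_frame (h : IsConformalOn f U)
    (hE : IsAdaptedIsotropicFrame m (canonicalLift f) U E) {z : ℂ} (hz : z ∈ U) {j : ℕ}
    (hj : j ∈ Finset.Icc 2 m) : (gaussMap f z).mulVec (E j z) = 0 := by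
  apply h.gaussMap_of_mem_normalSpace hz
  rw [← hE.span_normal z hz]
  exact Submodule.subset_span ⟨j, hj, Or.inl rfl⟩

/-- Y_z lies in Span {Y, E₁} with non-zero E₁-coefficient, so E₁ is tangential; then the normal part
of Y_zz, which lies in Span {Y, E₁, E₂}, is a multiple of E₂. -/
theorem hopf_mem (h : IsConformalOn f U)
    (hE : IsAdaptedIsotropicFrame m (canonicalLift f) U E) {z : ℂ} (hz : z ∈ U) :
    hopf (canonicalLift f) z ∈ frameSpan m E z := by
  by_cases hm : 2 ≤ m
  · have f1 : dz (canonicalLift f) z ∈ _ := hE.flag z hz 1 (by simp; omega)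
    have f2 : dz (dz (canonicalLift f)) z ∈ _ := hE.flag z hz 2 (by simp; omega)
    have s1 : {x | ∃ l ∈ Finset.Icc 1 1, x = E l z} = {E 1 z} := by
      ext x
      simp
    have s2 : {x | ∃ l ∈ Finset.Icc 1 2, x = E l z} = {E 1 z, E 2 z} := by
      ext x
      simp only [Set.mem_ofPred_eq, Set.mem_insert_iff, Set.mem_singleton_iff]
      constructor
      · rintro ⟨l, hl, rfl⟩
        rw [Finset.mem_Icc] at hl
        obtain rfl | rfl : l = 1 ∨ l = 2 := by omega
        · exact Or.inl rfl
        · exact Or.inr rfl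
      · rintro (rfl | rfl)
        · exact ⟨1, by simp, rfl⟩
        · exact ⟨2, by simp, rfl⟩
    rw [s1, Set.singleton_union] at f1
    rw [s2, Set.singleton_union] at f2
    obtain ⟨α, β, hαβ⟩ := Submodule.mem_span_pair.1 f1
    obtain ⟨a, b, c, habc⟩ := Submodule.mem_span_triple.1 f2
    have r := h.liftRel hz
    -- Otherwise Y_z would be a multiple of Y, against ⟨Y_z, Y_z̄⟩ = 1/2.
    have hβ : β ≠ 0 := by
      rintro rfl
      have h1 := r.r12
      rw [← hαβ] at h1
      simp only [mink_add_left, mink_smul_left, r.y2] at h1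
      norm_num at h1
    have hE1 : E 1 z = β⁻¹ • (dz (canonicalLift f) z - α • canonicalLift f z) := by
      rw [← hαβ, add_sub_cancel_left, smul_smul, inv_mul_cancel₀ hβ, one_smul]
    have h2 : (2 : ℕ) ∈ Finset.Icc 2 m := by simp; omega
    have hQ : normalProj (canonicalLift f) z (E 2 z) = E 2 z :=
      h.normalProj_of_gaussMap_zero hz (gaussMap_frame h hE hz h2)
    rw [h.hopf_eq hz, ← habc, hE1]
    simp only [IsConformalOn.normalProj_add, IsConformalOn.normalProj_smul,
      IsConformalOn.normalProj_sub, hQ, h.normalProj_of_gaussMap_eq hz (h.gaussMap_lift hz),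
      h.normalProj_of_gaussMap_eq hz (h.gaussMap_dz_lift hz), smul_zero, sub_zero, zero_add]
    exact Submodule.smul_mem _ _ (mem_frameSpan h2)
  -- If m ≤ 1 the frame of the normal space is empty, so the normal space and κ are zero.
  · have h1 := h.hopf_mem_normalSpace hz
    rw [← hE.span_normal z hz] at h1
    have h2 : {x | ∃ j ∈ Finset.Icc 2 m, x = E j z ∨ x = star (E j z)} = ∅ := by
      rw [Finset.Icc_eq_empty hm]
      simp
    rw [h2, Submodule.span_empty] at h1
    rw [(Submodule.mem_bot ℂ).1 h1]
    exact Submodule.zero_mem _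

/-- Expansion in a Hermitian orthogonal basis with ⟨E_j, Ē_j⟩ = 2. It provides smooth coefficients
for sections known only to lie pointwise in the span. -/
theorem eq_sum (hE : IsAdaptedIsotropicFrame m (canonicalLift f) U E) {z : ℂ} (hz : z ∈ U)
    {x : Mink d} (hx : x ∈ frameSpan m E z) :
    x = ∑ j ∈ Finset.Icc 2 m, (mink x (star (E j z)) / 2) • E j z := by
  refine Submodule.span_induction ?_ ?_ ?_ ?_ hx
  · rintro _ ⟨l, hl, rfl⟩
    rw [Finset.sum_eq_single l]
    · rw [hE.hermitian z hz l (Icc_two_subset hl) l (Icc_two_subset hl)]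
      simp
    · intro j hj hjl
      rw [hE.hermitian z hz l (Icc_two_subset hl) j (Icc_two_subset hj), if_neg hjl.symm]
      simp
    · exact fun h => absurd hl h
  · simp [mink_zero_left]
  · intro x y _ _ hx hy
    conv_lhs => rw [hx, hy]
    rw [← Finset.sum_add_distrib]
    refine Finset.sum_congr rfl fun j _ => ?_
    rw [mink_add_left]
    module
  · intro c x _ hx
    conv_lhs => rw [hx]
    rw [Finset.smul_sum]
    refine Finset.sum_congr rfl fun j _ => ?_
    rw [mink_smul_left]
    module

theorem mink_frame (hE : IsAdaptedIsotropicFrame m (canonicalLift f) U E) {z : ℂ} (hz : z ∈ U)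
    {x : Mink d} (hx : x ∈ frameSpan m E z) {j : ℕ} (hj : j ∈ Finset.Icc 2 m) :
    mink x (E j z) = 0 := by
  rw [eq_sum hE hz hx, mink_sum_left]
  refine Finset.sum_eq_zero fun l hl => ?_
  rw [mink_smul_left, hE.isotropic z hz l (Icc_two_subset hl) j (Icc_two_subset hj), mul_zero]

/-- An isotropic span meets its conjugate trivially here: for real x the coefficient ⟨x, Ē_j⟩ is the
conjugate of ⟨x, E_j⟩ = 0. -/
theorem eq_zero_of_real (hE : IsAdaptedIsotropicFrame m (canonicalLift f) U E) {z : ℂ}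
    (hz : z ∈ U) {x : Mink d} (hx : x ∈ frameSpan m E z) (hr : star x = x) : x = 0 := by
  rw [eq_sum hE hz hx]
  refine Finset.sum_eq_zero fun j hj => ?_
  rw [← hr, ← star_mink, mink_frame hE hz hx hj]
  simp

theorem dzbar_sum {ι : Type*} (s : Finset ι) {a : ι → ℂ → Mink d} {z : ℂ}
    (ha : ∀ i ∈ s, DifferentiableAt ℝ (a i) z) :
    dzbar (fun w => ∑ i ∈ s, a i w) z = ∑ i ∈ s, dzbar (a i) z := by
  simp only [dzbar, du, dv, fderiv_fun_sum ha, _root_.sum_apply, Finset.smul_sum,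
    ← Finset.sum_add_distrib, smul_add]

/-- Leibniz rule for the expansion `eq_sum`: differentiated coefficients stay in the span, and the
differentiated frame does so by the hypothesis of H-isotropy. -/
theorem normalDzbar_mem (h : IsConformalOn f U)
    (hE : IsAdaptedIsotropicFrame m (canonicalLift f) U E)
    (hD : ∀ z ∈ U, ∀ j ∈ Finset.Icc 2 m,
      normalDzbar (canonicalLift f) (E j) z ∈ frameSpan m E z)
    {ψ : ℂ → Mink d} (hψ : ContDiffOn ℝ ∞ ψ U) (hm : ∀ z ∈ U, ψ z ∈ frameSpan m E z) {z : ℂ}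
    (hz : z ∈ U) : normalDzbar (canonicalLift f) ψ z ∈ frameSpan m E z := by
  have hU := h.fam.openU
  have hs : ∀ j ∈ Finset.Icc 2 m, ContDiffOn ℝ ∞ (E j) U := fun j hj =>
    hE.smooth j (Icc_two_subset hj)
  have hc : ∀ j ∈ Finset.Icc 2 m, ContDiffOn ℝ ∞ (fun w => mink (ψ w) (star (E j w)) / 2) U :=
    fun j hj => (contDiffOn_bilin minkB hψ (contDiffOn_star (hs j hj))).div_const 2
  have h1 : ∀ j ∈ Finset.Icc 2 m,
      dzbar (fun w => (mink (ψ w) (star (E j w)) / 2) • E j w) z =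
        (mink (ψ z) (star (E j z)) / 2) • dzbar (E j) z +
          dzbar (fun w => mink (ψ w) (star (E j w)) / 2) z • E j z := fun j hj =>
    dzbar_bilin (LinearMap.lsmul ℂ (Mink d)) (diffAt hU (hc j hj) hz) (diffAt hU (hs j hj) hz)
  have hsm : ∀ j ∈ Finset.Icc 2 m, DifferentiableAt ℝ
      (fun w => (mink (ψ w) (star (E j w)) / 2) • E j w) z := fun j hj =>
    (diffAt hU (hc j hj) hz).fun_smul (diffAt hU (hs j hj) hz)
  have hlin : ∀ (s : Finset ℕ) (a : ℕ → Mink d), normalProj (canonicalLift f) z (∑ j ∈ s, a j) =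
      ∑ j ∈ s, normalProj (canonicalLift f) z (a j) := by
    intro s a
    simp only [normalProj_eq, ← appB_apply, map_sum, Finset.sum_sub_distrib]
  rw [normalDzbar, dzbar_congr hU (fun w hw => eq_sum hE hw (hm w hw)) hz, dzbar_sum _ hsm, hlin]
  refine Submodule.sum_mem _ fun j hj => ?_
  rw [h1 j hj, IsConformalOn.normalProj_add, IsConformalOn.normalProj_smul,
    IsConformalOn.normalProj_smul,
    h.normalProj_of_gaussMap_zero hz (gaussMap_frame h hE hz hj)]
  exact Submodule.add_mem _ (Submodule.smul_mem _ _ (hD z hz j hj))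
    (Submodule.smul_mem _ _ (mem_frameSpan hj))

/-- κ, D_z̄ κ and D_z̄ D_z̄ κ are all in Span {E₂, …, E_m}, while the Willmore operator is real. -/
theorem willmoreOperator_eq_zero (h : IsConformalOn f U)
    (hE : IsAdaptedIsotropicFrame m (canonicalLift f) U E)
    (hD : ∀ z ∈ U, ∀ j ∈ Finset.Icc 2 m,
      normalDzbar (canonicalLift f) (E j) z ∈ frameSpan m E z) {z : ℂ} (hz : z ∈ U) :
    willmoreOperator (canonicalLift f) z = 0 := by
  have h0 := fun w (hw : w ∈ U) => hopf_mem h hE hw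
  have h1 := fun w (hw : w ∈ U) => normalDzbar_mem h hE hD h.smooth_hopf h0 hw
  have h2 := normalDzbar_mem h hE hD (h.smooth_normalDzbar h.smooth_hopf) h1 hz
  exact eq_zero_of_real hE hz
    (Submodule.add_mem _ h2 (Submodule.smul_mem _ _ (h0 z hz))) (h.star_willmoreOperator hz)

end IsAdaptedIsotropicFrame

end Isotropic

/-! ### Holomorphic changes of coordinates -/

section Holomorphic

variable {d : ℕ} {f f' : ℂ → Euc d} {U W : Set ℂ} {φ : ℂ → ℂ}

theorem fderiv_holomorphic {w : ℂ} (hφ : DifferentiableAt ℂ φ w) (e : ℂ) :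
    fderiv ℝ φ w e = deriv φ w * e := by
  have h : HasFDerivAt φ ((fderiv ℂ φ w).restrictScalars ℝ) w :=
    hφ.hasFDerivAt.restrictScalars ℝ
  rw [h.fderiv]
  change fderiv ℂ φ w e = _
  rw [fderiv_eq_smul_deriv, smul_eq_mul, mul_comm]

theorem fderiv_comp_holomorphic {V : Type*} [NormedAddCommGroup V] [NormedSpace ℝ V]
    {g : ℂ → V} {w : ℂ} (hg : DifferentiableAt ℝ g (φ w)) (hφ : DifferentiableAt ℂ φ w) (e : ℂ) :
    fderiv ℝ (fun x => g (φ x)) w e = fderiv ℝ g (φ w) (deriv φ w * e) := by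
  have h : HasFDerivAt (fun x => g (φ x)) ((fderiv ℝ g (φ w)).comp (fderiv ℝ φ w)) w :=
    hg.hasFDerivAt.comp w (hφ.restrictScalars ℝ).hasFDerivAt
  rw [h.fderiv, ContinuousLinearMap.comp_apply, fderiv_holomorphic hφ]

section

variable {V : Type*} [NormedAddCommGroup V] [NormedSpace ℂ V] {g : ℂ → V}

theorem fderiv_eq_dz (z c : ℂ) : fderiv ℝ g z c = c • dz g z + star c • dzbar g z := by
  have h := apply_eq_sum_coord (fderiv ℝ g z) c
  rw [Fin.sum_univ_two] at h
  have h' : fderiv ℝ g z c = (c.re : ℂ) • du g z + (c.im : ℂ) • dv g z := by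
    rw [Complex.coe_smul, Complex.coe_smul]
    simpa [coordComp, coordDir, du, dv] using h
  rw [h', dz, dzbar]
  have hc : c = c.re + c.im * Complex.I := (Complex.re_add_im c).symm
  have hc' : star c = c.re - c.im * Complex.I := by
    apply Complex.ext <;> simp
  rw [hc']
  generalize (c.re : ℂ) = a at *
  generalize (c.im : ℂ) = b at *
  rw [hc]
  match_scalars <;> (ring_nf; try (simp [Complex.I_sq]))

theorem dz_comp_holomorphic {w : ℂ} (hg : DifferentiableAt ℝ g (φ w))
    (hφ : DifferentiableAt ℂ φ w) : dz (fun x => g (φ x)) w = deriv φ w • dz g (φ w) := by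
  conv_lhs => rw [dz, du, dv, fderiv_comp_holomorphic hg hφ, fderiv_comp_holomorphic hg hφ,
    fderiv_eq_dz, fderiv_eq_dz]
  simp only [star_mul', Complex.star_def, Complex.conj_I, map_one]
  match_scalars <;> (ring_nf; try (simp [Complex.I_sq]; try ring))

theorem dzbar_comp_holomorphic {w : ℂ} (hg : DifferentiableAt ℝ g (φ w))
    (hφ : DifferentiableAt ℂ φ w) :
    dzbar (fun x => g (φ x)) w = star (deriv φ w) • dzbar g (φ w) := by
  conv_lhs => rw [dzbar, du, dv, fderiv_comp_holomorphic hg hφ, fderiv_comp_holomorphic hg hφ,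
    fderiv_eq_dz, fderiv_eq_dz]
  simp only [star_mul', Complex.star_def, Complex.conj_I, map_one]
  match_scalars <;> (ring_nf; try (simp [Complex.I_sq]; try ring))

theorem dzbar_holomorphic {w : ℂ} (hφ : DifferentiableAt ℂ φ w) : dzbar φ w = 0 := by
  rw [dzbar, du, dv, fderiv_holomorphic hφ, fderiv_holomorphic hφ]
  simp only [smul_eq_mul]
  linear_combination (1 / 2 * deriv φ w) * Complex.I_mul_I

theorem contDiffOn_real_of_holomorphic (hW : IsOpen W) (hφ : DifferentiableOn ℂ φ W) :
    ContDiffOn ℝ ∞ φ W :=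
  (hφ.contDiffOn (n := ∞) hW).restrict_scalars ℝ

/-- In ∂_z̄ (φ' · (g_z ∘ φ)) the factor φ' is holomorphic, so only the second factor is
differentiated. -/
theorem laplacian_comp_holomorphic [FiniteDimensional ℂ V] (hU : IsOpen U) (hW : IsOpen W)
    (hg : ContDiffOn ℝ ∞ g U) (hφ : DifferentiableOn ℂ φ W) (hm : Set.MapsTo φ W U) {w : ℂ}
    (hw : w ∈ W) : dzbar (dz (fun x => g (φ x))) w =
      (deriv φ w * star (deriv φ w)) • dzbar (dz g) (φ w) := by
  have hd := fun x (hx : x ∈ W) => hφ.differentiableAt (hW.mem_nhds hx)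
  have hd' : DifferentiableOn ℂ (deriv φ) W := hφ.deriv hW
  have hdw := hd'.differentiableAt (hW.mem_nhds hw)
  have h1 := diffAt hU (contDiffOn_dz hU hg) (hm hw)
  have h2 : DifferentiableAt ℝ (fun x => dz g (φ x)) w :=
    h1.comp w ((hd w hw).restrictScalars ℝ)
  have h3 := dzbar_bilin (LinearMap.lsmul ℂ V) (hdw.restrictScalars ℝ) h2
  simp only [LinearMap.lsmul_apply] at h3
  rw [dzbar_congr hW (fun x hx => dz_comp_holomorphic (diffAt hU hg (hm hx)) (hd x hx)) hw, h3,
    dzbar_holomorphic hdw, dzbar_comp_holomorphic h1 (hd w hw), zero_smul, add_zero, smul_smul]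

end

/-- The Willmore equation does not depend on the complex coordinate. -/
theorem willmoreOperator_comp (h : IsConformalOn f U) (h' : IsConformalOn f' W)
    (hφ : DifferentiableOn ℂ φ W) (hm : Set.MapsTo φ W U) (hf : ∀ w ∈ W, f' w = f (φ w)) {w : ℂ}
    (hw : w ∈ W) (h0 : willmoreOperator (canonicalLift f) (φ w) = 0) :
    willmoreOperator (canonicalLift f') w = 0 := by
  have hW := h'.fam.openU
  have hP : ∀ x ∈ W, gaussMap f' x = gaussMap f (φ x) := fun x hx =>
    h.fam.gaussMap_comp h'.fam (contDiffOn_real_of_holomorphic hW hφ) hm (fun _ _ => hf)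
      (Set.mem_univ (0 : ℝ)) hx
  have hL : dzbar (dz (gaussMap f')) w =
      (deriv φ w * star (deriv φ w)) • dzbar (dz (gaussMap f)) (φ w) := by
    rw [← laplacian_comp_holomorphic h.fam.openU hW h.gaussMap_smooth hφ hm hw]
    exact dzbar_congr hW (fun x hx => dz_congr hW hP hx) hw
  -- Both the Gauss map and, up to a factor, its Laplacian agree in the two coordinates. Since the
  -- new Y_{z z̄} has the form P x, `laplacian_gaussMap` in the old coordinate gives a multiple of
  -- the old operator.
  rw [← h'.laplacian_dzbar_dz_lift hw, h'.normalProj_eq_gaussMap hw, hL, hP w hw,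
    ← h'.gaussMap_dzbar_dz_lift hw, hP w hw, ← h.normalProj_eq_gaussMap (hm hw),
    Matrix.smul_mulVec, IsConformalOn.normalProj_smul, h.laplacian_gaussMap (hm hw), h0, smul_zero,
    smul_zero]

end Holomorphic

/-! ### The first variation of the Willmore density -/

section FirstVariation

variable {d : ℕ}

/-- The Dirichlet pairing of two fields of operators. -/
def dirichletPairing (P R : ℂ → Op d) (z : ℂ) : ℝ :=
  (∑ k, (fderiv ℝ P z (coordDir k) * fderiv ℝ R z (coordDir k)).trace).re

/-- The velocity of the conformal Gauss map along a family of immersions. -/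
def gaussVelocity (Φ : ℝ → ℂ → Euc d) (z : ℂ) : Op d :=
  deriv (fun t => gaussMap (Φ t) z) 0

namespace IsFamily

variable {Φ : ℝ → ℂ → Euc d} {I : Set ℝ} {U : Set ℂ}

theorem hasDerivAt_gaussMap (h : IsFamily Φ I U) (h0 : (0 : ℝ) ∈ I) {z : ℂ} (hz : z ∈ U) :
    HasDerivAt (fun t => gaussMap (Φ t) z)
      (fderiv ℝ (fun q : ℝ × ℂ => gaussMap (Φ q.1) q.2) (0, z) (1, 0)) 0 :=
  hasDerivAt_slice_left (G := fun q : ℝ × ℂ => gaussMap (Φ q.1) q.2)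
    (diffAt h.isOpen_prod h.smooth_gaussMap ⟨h0, hz⟩)

theorem gaussVelocity_eq (h : IsFamily Φ I U) (h0 : (0 : ℝ) ∈ I) {z : ℂ} (hz : z ∈ U) :
    gaussVelocity Φ z =
      fderiv ℝ (fun q : ℝ × ℂ => gaussMap (Φ q.1) q.2) (0, z) (1, 0) :=
  (h.hasDerivAt_gaussMap h0 hz).deriv

theorem smooth_gaussVelocity (h : IsFamily Φ I U) (h0 : (0 : ℝ) ∈ I) :
    ContDiffOn ℝ ∞ (gaussVelocity Φ) U := by
  have h1 := contDiffOn_fderiv_apply h.isOpen_prod h.smooth_gaussMap (1, 0)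
  have h2 : ContDiffOn ℝ ∞ (fun w : ℂ => ((0 : ℝ), w)) U :=
    (contDiff_const.prodMk contDiff_id).contDiffOn
  exact (h1.comp h2 fun _ hz => ⟨h0, hz⟩).congr fun z hz => h.gaussVelocity_eq h0 hz

/-- Differentiating P² = P in time: the velocity is block off-diagonal, which is what makes it
invisible to a block diagonal Laplacian. -/
theorem gaussVelocity_split (h : IsFamily Φ I U) (h0 : (0 : ℝ) ∈ I) {z : ℂ} (hz : z ∈ U) :
    gaussVelocity Φ z =
      gaussVelocity Φ z * gaussMap (Φ 0) z + gaussMap (Φ 0) z * gaussVelocity Φ z := by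
  rw [h.gaussVelocity_eq h0 hz]
  exact fderiv_split h.isOpen_prod h.smooth_gaussMap (fun q hq => h.gaussMap_idem hq.1 hq.2)
    (z := (0, z)) ⟨h0, hz⟩ (1, 0)

theorem hasDerivAt_fderiv_gaussMap (h : IsFamily Φ I U) (h0 : (0 : ℝ) ∈ I) {z : ℂ} (hz : z ∈ U)
    (e : ℂ) : HasDerivAt (fun t => fderiv ℝ (gaussMap (Φ t)) z e)
      (fderiv ℝ (gaussVelocity Φ) z e) 0 := by
  have hO := h.isOpen_prod
  have hq : ((0 : ℝ), z) ∈ I ×ˢ U := ⟨h0, hz⟩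
  have hs := h.smooth_gaussMap
  have h1 := hasDerivAt_slice_left (diffAt hO (contDiffOn_fderiv_apply hO hs (0, e)) hq)
  rw [fderiv_fderiv_comm hO hs hq] at h1
  rw [← fderiv_slice_right (diffAt hO (contDiffOn_fderiv_apply hO hs (1, 0)) hq)] at h1
  have h2 : (fun w => fderiv ℝ (fun q : ℝ × ℂ => gaussMap (Φ q.1) q.2) (0, w) (1, 0))
      =ᶠ[nhds z] gaussVelocity Φ :=
    Filter.eventually_of_mem (h.openU.mem_nhds hz) fun w hw => (h.gaussVelocity_eq h0 hw).symm
  have h3 := DFunLike.congr_fun (h2.fderiv_eq (𝕜 := ℝ)) e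
  have h4 : (fun t => fderiv ℝ (gaussMap (Φ t)) z e) =ᶠ[nhds 0]
      fun t => fderiv ℝ (fun q : ℝ × ℂ => gaussMap (Φ q.1) q.2) (t, z) (0, e) :=
    Filter.eventually_of_mem (h.openI.mem_nhds h0) fun t ht =>
      fderiv_slice_right (G := fun q : ℝ × ℂ => gaussMap (Φ q.1) q.2)
        (diffAt hO hs (⟨ht, hz⟩ : (t, z) ∈ I ×ˢ U)) e
  exact (h3 ▸ h1).congr_of_eventuallyEq h4

theorem hasDerivAt_energy (h : IsFamily Φ I U) (h0 : (0 : ℝ) ∈ I) {z : ℂ} (hz : z ∈ U) :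
    HasDerivAt (fun t => (∑ k, energyForm (gaussMap (Φ t)) z k k).re)
      (2 * dirichletPairing (gaussMap (Φ 0)) (gaussVelocity Φ) z) 0 := by
  have h1 : ∀ k, HasDerivAt (fun t => energyForm (gaussMap (Φ t)) z k k)
      (2 * (fderiv ℝ (gaussMap (Φ 0)) z (coordDir k) *
        fderiv ℝ (gaussVelocity Φ) z (coordDir k)).trace) 0 := by
    intro k
    have hd := h.hasDerivAt_fderiv_gaussMap h0 hz (coordDir k)
    have h2 := (traceB (d := d)).toContinuousBilinearMap.bilinearRestrictScalars ℝ
      |>.isBoundedBilinearMap.differentiableAt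
        (fderiv ℝ (gaussMap (Φ 0)) z (coordDir k), fderiv ℝ (gaussMap (Φ 0)) z (coordDir k))
      |>.comp (0 : ℝ) (hd.differentiableAt.prodMk hd.differentiableAt)
    have h3 : HasDerivAt (fun t => energyForm (gaussMap (Φ t)) z k k) _ 0 := h2.hasDerivAt
    convert h3 using 1
    have h4 := fderiv_bilin traceB hd.differentiableAt hd.differentiableAt 1
    have h5 : fderiv ℝ (fun t => fderiv ℝ (gaussMap (Φ t)) z (coordDir k)) 0 1 =
        fderiv ℝ (gaussVelocity Φ) z (coordDir k) := hd.deriv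
    refine Eq.trans ?_ (h4.trans (congrArg₂ (· + ·)
      (congrArg (traceB (fderiv ℝ (gaussMap (Φ 0)) z (coordDir k))) h5)
      (congrArg (fun A => traceB A (fderiv ℝ (gaussMap (Φ 0)) z (coordDir k))) h5))).symm
    simp only [traceB_apply]
    rw [Matrix.trace_mul_comm (fderiv ℝ (gaussVelocity Φ) z _)]
    ring
  have h2 := HasDerivAt.fun_sum (u := Finset.univ) fun k _ => h1 k
  have h3 := Complex.reCLM.hasFDerivAt.comp_hasDerivAt (0 : ℝ) h2
  refine h3.congr_deriv ?_
  rw [← Finset.mul_sum]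
  simp [dirichletPairing]

/-- The first variation of the Willmore density of a conformal immersion. -/
theorem hasDerivAt_willmoreDensity (h : IsFamily Φ I U) (h0 : (0 : ℝ) ∈ I)
    (hc : IsConformalOn (Φ 0) U) {z : ℂ} (hz : z ∈ U) :
    HasDerivAt (fun t => willmoreDensity (Φ t) z)
      (1 / 2 * dirichletPairing (gaussMap (Φ 0)) (gaussVelocity Φ) z) 0 := by
  have h1 := hasDerivAt_slice_left (G := fun q : ℝ × ℂ => willmoreDensity (Φ q.1) q.2)
    (diffAt h.isOpen_prod h.smooth_willmoreDensity (⟨h0, hz⟩ : ((0 : ℝ), z) ∈ I ×ˢ U))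
  have h2 := (h.hasDerivAt_energy h0 hz).const_mul (1 / 4 : ℝ)
  -- A quarter of the Dirichlet density dominates the Willmore density for all t, with equality at t
  -- = 0 by conformality; hence their derivatives at 0 coincide.
  have hm : IsLocalMin (fun t => 1 / 4 * (∑ k, energyForm (gaussMap (Φ t)) z k k).re -
      willmoreDensity (Φ t) z) 0 := by
    filter_upwards [h.openI.mem_nhds h0] with t ht
    rw [h.willmoreDensity_eq_of_conformal h0 hz (hc.conf z hz), sub_self]
    exact sub_nonneg.2 (h.willmoreDensity_le ht hz)
  have h3 := hm.hasDerivAt_eq_zero (h2.sub h1)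
  refine h1.congr_deriv ?_
  symm
  exact Eq.trans (by ring) (sub_eq_zero.1 h3)

end IsFamily

/-! ### Conformal Gauss maps of Willmore surfaces are harmonic -/

namespace IsConformalOn

variable {f : ℂ → Euc d} {U : Set ℂ}

theorem laplacian_selfadjoint (h : IsConformalOn f U) {z : ℂ} (hz : z ∈ U) (x y : Mink d) :
    mink ((dzbar (dz (gaussMap f)) z).mulVec x) y =
      mink x ((dzbar (dz (gaussMap f)) z).mulVec y) := by
  have hU := h.fam.openU
  have h1 : ∀ e x y, mink ((fderiv ℝ (fun w => fderiv ℝ (gaussMap f) w e) z e).mulVec x) y =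
      mink x ((fderiv ℝ (fun w => fderiv ℝ (gaussMap f) w e) z e).mulVec y) := fun e x y =>
    IsFamily.fderiv_selfadjoint hU (contDiffOn_fderiv_apply hU h.gaussMap_smooth e)
      (fun w hw => IsFamily.fderiv_selfadjoint hU h.gaussMap_smooth
        (fun w _ => gaussOp_selfadjoint _ _ _) hw e) hz e x y
  rw [dzbar_dz_eq hU h.gaussMap_smooth hz, Matrix.smul_mulVec, Matrix.smul_mulVec,
    Matrix.add_mulVec, Matrix.add_mulVec, mink_smul_left, mink_smul_right, mink_add_left,
    mink_add_right]
  exact congrArg₂ (fun a b => (1 / 4 : ℂ) * (a + b)) (h1 1 x y) (h1 Complex.I x y)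

/-- Without the Willmore operator P_{z z̄} maps V into V. The next lemma is the adjoint statement,
and together they make P_{z z̄} commute with P. -/
theorem laplacian_mul_gaussMap (h : IsConformalOn f U) {z : ℂ} (hz : z ∈ U)
    (hw : willmoreOperator (canonicalLift f) z = 0) :
    dzbar (dz (gaussMap f)) z * gaussMap f z =
      gaussMap f z * (dzbar (dz (gaussMap f)) z * gaussMap f z) := by
  apply op_ext
  intro x
  have h1 := h.laplacian_gaussMap hz x
  rw [hw, smul_zero, h.normalProj_eq_gaussMap hz, sub_eq_zero] at h1
  simpa only [Matrix.mulVec_mulVec] using h1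

theorem gaussMap_mul_laplacian (h : IsConformalOn f U) {z : ℂ} (hz : z ∈ U)
    (hw : willmoreOperator (canonicalLift f) z = 0) :
    gaussMap f z * dzbar (dz (gaussMap f)) z =
      gaussMap f z * (dzbar (dz (gaussMap f)) z * gaussMap f z) := by
  have hP : ∀ x y, mink ((gaussMap f z).mulVec x) y = mink x ((gaussMap f z).mulVec y) :=
    gaussOp_selfadjoint _ _ _
  have hA := h.laplacian_selfadjoint hz
  apply op_ext
  intro x
  apply mink_left_injective
  intro y
  simp only [← Matrix.mulVec_mulVec]
  rw [hP, hA, Matrix.mulVec_mulVec, h.laplacian_mul_gaussMap hz hw]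
  simp only [← Matrix.mulVec_mulVec]
  rw [hP, hA, hP]

/-- Block diagonal against block off-diagonal: the splitting of R gives P R P = 0, and both summands
of tr(A R) reduce to tr(P A P R) = tr(A P R P) = 0. -/
theorem trace_laplacian_mul (h : IsConformalOn f U) {z : ℂ} (hz : z ∈ U)
    (hw : willmoreOperator (canonicalLift f) z = 0) {R : Op d}
    (hR : R = R * gaussMap f z + gaussMap f z * R) :
    (dzbar (dz (gaussMap f)) z * R).trace = 0 := by
  set P := gaussMap f z
  set A := dzbar (dz (gaussMap f)) z
  have hPP : P * P = P := h.idem hz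
  have h1 : A * P = P * (A * P) := h.laplacian_mul_gaussMap hz hw
  have h2 : P * A = P * (A * P) := h.gaussMap_mul_laplacian hz hw
  have h3 : P * R * P = 0 := by
    have h4 : P * R * P = P * R * P + P * R * P := by
      conv_lhs => rw [hR]
      rw [mul_add, add_mul, mul_assoc P (R * P) P, mul_assoc R P P, ← mul_assoc P P R, hPP,
        mul_assoc P R P]
    exact left_eq_add.1 h4
  have h4 : (P * A * R).trace = 0 := by
    rw [h2, Matrix.trace_mul_comm, ← mul_assoc, ← mul_assoc, Matrix.trace_mul_comm,
      ← mul_assoc, ← mul_assoc, h3, zero_mul, Matrix.trace_zero]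
  conv_lhs => rw [hR]
  rw [mul_add, Matrix.trace_add, ← mul_assoc, Matrix.trace_mul_comm (A * R), ← mul_assoc,
    ← mul_assoc, h1, ← h2, h4, add_zero]

/-- The Dirichlet pairing of a harmonic conformal Gauss map with an infinitesimal variation is a
divergence. -/
theorem dirichletPairing_eq_divergence (h : IsConformalOn f U)
    (hw : ∀ z ∈ U, willmoreOperator (canonicalLift f) z = 0) {R : ℂ → Op d}
    (hR : ContDiffOn ℝ ∞ R U) {z : ℂ} (hz : z ∈ U)
    (hs : R z = R z * gaussMap f z + gaussMap f z * R z) :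
    dirichletPairing (gaussMap f) R z = ∑ k, fderiv ℝ (fun w =>
      ((fderiv ℝ (gaussMap f) w (coordDir k) * R w).trace).re) z (coordDir k) := by
  have hU := h.fam.openU
  have hs2 := fun k => contDiffOn_fderiv_apply hU h.gaussMap_smooth (coordDir k)
  have hk : ∀ k, fderiv ℝ (fun w => ((fderiv ℝ (gaussMap f) w (coordDir k) * R w).trace).re) z
      (coordDir k) = ((fderiv ℝ (gaussMap f) z (coordDir k) *
        fderiv ℝ R z (coordDir k)).trace + (fderiv ℝ (fun w => fderiv ℝ (gaussMap f) w
          (coordDir k)) z (coordDir k) * R z).trace).re := by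
    intro k
    have h1 := fderiv_bilin traceB (diffAt hU (hs2 k) hz) (diffAt hU hR hz) (coordDir k)
    have h2 : HasFDerivAt (fun w => Complex.reCLM
        (traceB (fderiv ℝ (gaussMap f) w (coordDir k)) (R w))) _ z :=
      Complex.reCLM.hasFDerivAt.comp z
        (diffAt hU (contDiffOn_bilin traceB (hs2 k) hR) hz).hasFDerivAt
    exact (DFunLike.congr_fun h2.fderiv (coordDir k)).trans (congrArg Complex.re h1)
  -- This kills the sum over k of the terms tr(P_kk R) left over by the Leibniz rule, so the
  -- divergence is the pairing alone.
  have hL := h.trace_laplacian_mul hz (hw z hz) hs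
  rw [dzbar_dz_eq hU h.gaussMap_smooth hz, Matrix.smul_mul, add_mul, Matrix.trace_smul,
    Matrix.trace_add, smul_eq_mul, mul_eq_zero, or_iff_right (by norm_num)] at hL
  rw [dirichletPairing, Fin.sum_univ_two, Fin.sum_univ_two, hk, hk, ← Complex.add_re]
  congr 1
  rw [add_add_add_comm]
  exact (add_eq_left.2 hL).symm

end IsConformalOn

/-! ### Conformal invariance of the Dirichlet pairing -/

theorem dirichletPairing_congr {P P' R R' : ℂ → Op d} {U : Set ℂ} (hU : IsOpen U)
    (hP : ∀ z ∈ U, P z = P' z) (hR : ∀ z ∈ U, R z = R' z) {z : ℂ} (hz : z ∈ U) :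
    dirichletPairing P R z = dirichletPairing P' R' z := by
  have h1 : P =ᶠ[nhds z] P' := Filter.eventually_of_mem (hU.mem_nhds hz) hP
  have h2 : R =ᶠ[nhds z] R' := Filter.eventually_of_mem (hU.mem_nhds hz) hR
  have h3 := fun e => DFunLike.congr_fun (h1.fderiv_eq (𝕜 := ℝ)) e
  have h4 := fun e => DFunLike.congr_fun (h2.fderiv_eq (𝕜 := ℝ)) e
  rw [dirichletPairing, dirichletPairing]
  exact congrArg Complex.re (Finset.sum_congr rfl fun k _ =>
    congrArg Matrix.trace (congrArg₂ _ (h3 (coordDir k)) (h4 (coordDir k))))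

theorem continuousOn_dirichletPairing {P R : ℂ → Op d} {U : Set ℂ} (hU : IsOpen U)
    (hP : ContDiffOn ℝ ∞ P U) (hR : ContDiffOn ℝ ∞ R U) :
    ContinuousOn (dirichletPairing P R) U := by
  have h1 : ∀ k, ContDiffOn ℝ ∞ (fun z => (fderiv ℝ P z (coordDir k) *
      fderiv ℝ R z (coordDir k)).trace) U := fun k =>
    contDiffOn_bilin traceB (contDiffOn_fderiv_apply hU hP (coordDir k))
      (contDiffOn_fderiv_apply hU hR (coordDir k))
  exact Complex.continuous_re.comp_continuousOn
    (continuousOn_finsetSum _ fun k _ => (h1 k).continuousOn)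

theorem dirichletPairing_sum {ι : Type*} (s : Finset ι) (P : ℂ → Op d) {R : ι → ℂ → Op d} {z : ℂ}
    (hR : ∀ a ∈ s, DifferentiableAt ℝ (R a) z) :
    dirichletPairing P (fun w => ∑ a ∈ s, R a w) z = ∑ a ∈ s, dirichletPairing P (R a) z := by
  have h := fun e => DFunLike.congr_fun (fderiv_fun_sum hR) e
  simp only [dirichletPairing]
  rw [← Complex.re_sum, Finset.sum_comm]
  refine congrArg Complex.re (Finset.sum_congr rfl fun k _ => ?_)
  rw [← Matrix.trace_sum, ← Finset.mul_sum]
  exact congrArg Matrix.trace (congrArg _ ((h (coordDir k)).trans (_root_.sum_apply _ _ _)))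

/-- The real differential of a holomorphic map is a similarity with factor |φ'|, so the pairing of
two gradients transforms like a density. -/
theorem dirichletPairing_comp {P R : ℂ → Op d} {φ : ℂ → ℂ} {w : ℂ}
    (hP : DifferentiableAt ℝ P (φ w)) (hR : DifferentiableAt ℝ R (φ w))
    (hφ : DifferentiableAt ℂ φ w) :
    dirichletPairing (fun x => P (φ x)) (fun x => R (φ x)) w =
      Complex.normSq (deriv φ w) * dirichletPairing P R (φ w) := by
  have h1 := fun e => fderiv_comp_holomorphic hP hφ e
  have h2 := fun e => fderiv_comp_holomorphic hR hφ e
  have key : ∀ L : ℂ →L[ℝ] Op d, ∀ c : ℂ, L (c * 1) = (c.re : ℂ) • L 1 + (c.im : ℂ) • L Complex.I ∧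
      L (c * Complex.I) = (c.re : ℂ) • L Complex.I - (c.im : ℂ) • L 1 := by
    intro L c
    have e1 : c * 1 = c.re • (1 : ℂ) + c.im • Complex.I := by apply Complex.ext <;> simp
    have e2 : c * Complex.I = c.re • Complex.I - c.im • (1 : ℂ) := by apply Complex.ext <;> simp
    rw [e1, e2, map_add, map_sub]
    simp only [map_smul, Complex.coe_smul, and_self]
  have gen : ∀ (L L' N N' : ℂ →L[ℝ] Op d) (c : ℂ), (∀ e, L' e = L (c * e)) →
      (∀ e, N' e = N (c * e)) → (∑ k, (L' (coordDir k) * N' (coordDir k)).trace).re =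
        Complex.normSq c * (∑ k, (L (coordDir k) * N (coordDir k)).trace).re := by
    intro L L' N N' c hL hN
    rw [← Complex.re_ofReal_mul]
    congr 1
    have c0 : coordDir 0 = 1 := rfl
    have c1 : coordDir 1 = Complex.I := rfl
    rw [Fin.sum_univ_two, Fin.sum_univ_two, c0, c1, hL, hL, hN, hN, (key L c).1, (key L c).2,
      (key N c).1, (key N c).2, Complex.normSq_apply]
    simp only [add_mul, mul_add, sub_mul, mul_sub, Matrix.smul_mul, Matrix.mul_smul,
      Matrix.trace_add, Matrix.trace_sub, Matrix.trace_smul, smul_eq_mul, Complex.ofReal_add,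
      Complex.ofReal_mul]
    ring
  exact gen _ _ _ _ _ h1 h2

end FirstVariation

/-! ### Integrals of smooth functions with compact support -/

section Integrals

/-- The divergence theorem for functions with compact support. -/
theorem setIntegral_fderiv_eq_zero {U C : Set ℂ} (hU : IsOpen U) (hC : IsCompact C) (hCU : C ⊆ U)
    {g : ℂ → ℝ} (hg : ContDiffOn ℝ ∞ g U) (h0 : ∀ z ∈ U, z ∉ C → g z = 0) (v : ℂ) :
    IntegrableOn (fun z => fderiv ℝ g z v) U ∧ ∫ z in U, fderiv ℝ g z v = 0 := by
  -- Extension by zero is smooth on ℂ: near points of `U` it is `g`, and off the closed set `C` it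
  -- vanishes.
  set G : ℂ → ℝ := U.indicator g with hG
  have hin : ∀ z ∈ U, G =ᶠ[nhds z] g := fun z hz =>
    Filter.eventually_of_mem (hU.mem_nhds hz) fun w hw => Set.indicator_of_mem hw g
  have hout : ∀ z ∉ C, G =ᶠ[nhds z] fun _ => 0 := fun z hz =>
    Filter.eventually_of_mem (hC.isClosed.isOpen_compl.mem_nhds hz) fun w hw => by
      by_cases hwU : w ∈ U
      · rw [hG, Set.indicator_of_mem hwU, h0 w hwU hw]
      · rw [hG, Set.indicator_of_notMem hwU]
  have hsm : ContDiff ℝ ∞ G := contDiff_iff_contDiffAt.2 fun z => by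
    by_cases hz : z ∈ U
    · exact (hg.contDiffAt (hU.mem_nhds hz)).congr_of_eventuallyEq (hin z hz)
    · exact contDiffAt_const.congr_of_eventuallyEq (hout z fun h => hz (hCU h))
  have hsupp : HasCompactSupport G := HasCompactSupport.intro hC fun z hz => (hout z hz).eq_of_nhds
  have hc' : Continuous fun z => fderiv ℝ G z v :=
    (hsm.continuous_fderiv (by simp)).clm_apply continuous_const
  have hi : Integrable G := hsm.continuous.integrable_of_hasCompactSupport hsupp
  have hi' : Integrable fun z => fderiv ℝ G z v :=
    hc'.integrable_of_hasCompactSupport (hsupp.fderiv_apply ℝ v)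
  have hz : ∫ z, fderiv ℝ G z v = 0 := by
    -- Integration by parts against the constant function 1.
    have h1 := integral_mul_fderiv_eq_neg_fderiv_mul_of_integrable (μ := (volume : Measure ℂ))
      (f := fun _ : ℂ => (1 : ℝ)) (g := G) (v := v) (by simp) (by simpa using hi')
      (by simpa using hi) (fun _ _ => differentiableAt_const _)
      (fun z _ => (hsm.differentiable (by simp)) z)
    simpa using h1
  have heq : Set.EqOn (fun z => fderiv ℝ G z v) (fun z => fderiv ℝ g z v) U := fun z hz =>
    DFunLike.congr_fun ((hin z hz).fderiv_eq (𝕜 := ℝ)) v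
  refine ⟨(hi'.integrableOn (s := U)).congr_fun heq hU.measurableSet, ?_⟩
  rw [← setIntegral_congr_fun hU.measurableSet heq, setIntegral_eq_integral_of_forall_compl_eq_zero,
    hz]
  intro z hz
  have h1 := DFunLike.congr_fun ((hout z fun h => hz (hCU h)).fderiv_eq (𝕜 := ℝ)) v
  simpa using h1

/-- Differentiation under the integral sign. -/
theorem hasDerivAt_setIntegral {I : Set ℝ} {U B C : Set ℂ} (hI : IsOpen I) (hU : IsOpen U)
    (h0 : (0 : ℝ) ∈ I) (hB : MeasurableSet B) (hBC : B ⊆ C) (hC : IsCompact C) (hCU : C ⊆ U)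
    {G : ℝ → ℂ → ℝ} (hG : ContDiffOn ℝ ∞ (fun q : ℝ × ℂ => G q.1 q.2) (I ×ˢ U)) {G' : ℂ → ℝ}
    (hG' : ∀ z ∈ U, HasDerivAt (fun t => G t z) (G' z) 0) :
    (∀ t ∈ I, IntegrableOn (G t) B) ∧ IntegrableOn G' B ∧
      HasDerivAt (fun t => ∫ z in B, G t z) (∫ z in B, G' z) 0 := by
  have hO : IsOpen (I ×ˢ U) := hI.prod hU
  have hslice : ∀ H : ℝ × ℂ → ℝ, ContinuousOn H (I ×ˢ U) → ∀ t ∈ I,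
      IntegrableOn (fun z => H (t, z)) B := by
    intro H hH t ht
    have h1 : ContinuousOn (fun z => H (t, z)) C :=
      hH.comp (by fun_prop) fun z hz => ⟨ht, hCU hz⟩
    exact (h1.integrableOn_compact hC).mono_set hBC
  have hint : ∀ t ∈ I, IntegrableOn (G t) B := fun t ht =>
    hslice (fun q => G q.1 q.2) hG.continuousOn t ht
  set F' : ℝ × ℂ → ℝ := fun q => fderiv ℝ (fun q : ℝ × ℂ => G q.1 q.2) q (1, 0) with hF'
  have hF'c : ContinuousOn F' (I ×ˢ U) := (contDiffOn_fderiv_apply hO hG (1, 0)).continuousOn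
  have hd : ∀ t ∈ I, ∀ z ∈ U, HasDerivAt (fun s => G s z) (F' (t, z)) t := fun t ht z hz =>
    hasDerivAt_slice_left (G := fun q : ℝ × ℂ => G q.1 q.2) (diffAt hO hG ⟨ht, hz⟩)
  have hFG : Set.EqOn (fun z => F' (0, z)) G' B := fun z hz =>
    (hd 0 h0 z (hCU (hBC hz))).unique (hG' z (hCU (hBC hz)))
  obtain ⟨r, hr, hrI⟩ := Metric.nhds_basis_closedBall.mem_iff.1 (hI.mem_nhds h0)
  have hcomp : IsCompact (Metric.closedBall (0 : ℝ) r ×ˢ C) :=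
    (isCompact_closedBall _ _).prod hC
  -- Compactness in both t and z gives a constant bound for the time derivative, integrable because
  -- `B` lies in the compact set `C`.
  obtain ⟨b, hb⟩ := hcomp.exists_bound_of_continuousOn (hF'c.mono (Set.prod_mono hrI hCU))
  have key := hasDerivAt_integral_of_dominated_loc_of_deriv_le (μ := volume.restrict B)
    (F := G) (F' := fun t z => F' (t, z)) (x₀ := (0 : ℝ)) (bound := fun _ => b)
    (Metric.closedBall_mem_nhds 0 hr)
    (Filter.eventually_of_mem (hI.mem_nhds h0) fun t ht => (hint t ht).aestronglyMeasurable)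
    (hint 0 h0) (hslice F' hF'c 0 h0).aestronglyMeasurable
    ((ae_restrict_iff' hB).2 (Filter.Eventually.of_forall fun z hz t ht =>
      hb (t, z) ⟨ht, hBC hz⟩))
    (integrableOn_const ((measure_mono hBC).trans_lt hC.measure_lt_top).ne)
    ((ae_restrict_iff' hB).2 (Filter.Eventually.of_forall fun z hz t ht =>
      hd t (hrI ht) z (hCU (hBC hz))))
  refine ⟨hint, (hslice F' hF'c 0 h0).congr_fun hFG hB, ?_⟩
  rw [← setIntegral_congr_fun hB hFG]
  exact key.2

end Integrals

/-! ### Densities on a Riemann surface -/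

section Densities

theorem measurableSet_inter_preimage {X Y : Type*} [TopologicalSpace X] [MeasurableSpace X]
    [OpensMeasurableSpace X] [TopologicalSpace Y] [MeasurableSpace Y] [BorelSpace Y] {f : X → Y}
    {s : Set X} (hs : MeasurableSet s) (hf : ContinuousOn f s) {A : Set Y} (hA : MeasurableSet A) :
    MeasurableSet (s ∩ f ⁻¹' A) := by
  have h1 := hs.subtype_image ((continuousOn_iff_continuous_domRestrict.1 hf).measurable hA)
  convert h1 using 1
  ext x
  simp [and_comm]

theorem det_fderiv_holomorphic {φ : ℂ → ℂ} {w : ℂ} (hφ : DifferentiableAt ℂ φ w) :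
    (fderiv ℝ φ w).det = Complex.normSq (deriv φ w) := by
  rw [ContinuousLinearMap.det, ← LinearMap.det_toMatrix Complex.basisOneI, Matrix.det_fin_two]
  simp only [LinearMap.toMatrix_apply, Complex.coe_basisOneI_repr, Complex.coe_basisOneI,
    ContinuousLinearMap.coe_coe, fderiv_holomorphic hφ, Complex.normSq_apply]
  simp

theorem det_jacobian_holomorphic {φ : ℂ → ℂ} {w : ℂ} (hφ : DifferentiableAt ℂ φ w) :
    (jacobian φ w).det = Complex.normSq (deriv φ w) := by
  rw [Matrix.det_fin_two, Complex.normSq_apply]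
  simp [jacobian_apply, fderiv_holomorphic hφ, coordComp, coordDir]

variable {M : Type*} [TopologicalSpace M]

/-- The part of a subset of `M` in the domain of a coordinate, seen in the coordinate. -/
def chartSet (e : OpenPartialHomeomorph M ℂ) (A : Set M) : Set ℂ :=
  e.target ∩ e.symm ⁻¹' A

/-- The change of coordinates from `e'` to `e`. -/
def transition (e' e : OpenPartialHomeomorph M ℂ) (w : ℂ) : ℂ := e (e'.symm w)

theorem isOpen_chartSet (e : OpenPartialHomeomorph M ℂ) {A : Set M} (hA : IsOpen A) :
    IsOpen (chartSet e A) := e.isOpen_inter_preimage_symm hA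

theorem measurableSet_chartSet [MeasurableSpace M] [BorelSpace M] (e : OpenPartialHomeomorph M ℂ)
    {A : Set M} (hA : MeasurableSet A) : MeasurableSet (chartSet e A) :=
  measurableSet_inter_preimage e.open_target.measurableSet e.continuousOn_symm hA

theorem measurableSet_symm_image [MeasurableSpace M] [BorelSpace M]
    (e : OpenPartialHomeomorph M ℂ) {B : Set ℂ} (hB : MeasurableSet B) (hBe : B ⊆ e.target) :
    MeasurableSet (e.symm '' B) := by
  rw [e.symm.image_eq_target_inter_inv_preimage hBe]
  exact measurableSet_inter_preimage e.open_source.measurableSet e.continuousOn hB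

theorem chartSet_symm_image (e : OpenPartialHomeomorph M ℂ) {B : Set ℂ} (hBe : B ⊆ e.target) :
    chartSet e (e.symm '' B) = B := by
  ext z
  constructor
  · rintro ⟨hz, w, hw, hwz⟩
    rwa [← e.symm.injOn (hBe hw) hz hwz]
  · exact fun hz => ⟨hBe hz, z, hz, rfl⟩

theorem isCompact_chartSet (e : OpenPartialHomeomorph M ℂ) {A : Set M} (hA : IsCompact A)
    (hAe : A ⊆ e.source) : IsCompact (chartSet e A) := by
  have h := hA.image_of_continuousOn (e.continuousOn.mono hAe)
  rwa [e.image_eq_target_inter_inv_preimage hAe] at h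

theorem chartSet_mono (e : OpenPartialHomeomorph M ℂ) {A A' : Set M} (h : A ⊆ A') :
    chartSet e A ⊆ chartSet e A' := fun _ hz => ⟨hz.1, h hz.2⟩

theorem chartSet_iUnion {ι : Type*} (e : OpenPartialHomeomorph M ℂ) (A : ι → Set M) :
    chartSet e (⋃ i, A i) = ⋃ i, chartSet e (A i) := by
  simp only [chartSet, Set.preimage_iUnion, Set.inter_iUnion]

theorem disjoint_chartSet {ι : Type*} (e : OpenPartialHomeomorph M ℂ) {A : ι → Set M}
    (hA : Pairwise (Function.onFun Disjoint A)) :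
    Pairwise (Function.onFun Disjoint fun i => chartSet e (A i)) := fun _ _ hij =>
  ((hA hij).preimage e.symm).mono Set.inter_subset_right Set.inter_subset_right

theorem transition_injOn (e e' : OpenPartialHomeomorph M ℂ) :
    Set.InjOn (transition e' e) (chartSet e' e.source) := fun _ hw _ hw' h =>
  e'.symm.injOn hw.1 hw'.1 (e.injOn hw.2 hw'.2 h)

theorem transition_image (e e' : OpenPartialHomeomorph M ℂ) {A : Set M} (hA : A ⊆ e.source)
    (hA' : A ⊆ e'.source) : transition e' e '' chartSet e' A = chartSet e A := by
  ext z
  constructor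
  · rintro ⟨w, hw, rfl⟩
    refine ⟨e.map_source (hA hw.2), ?_⟩
    rw [Set.mem_preimage, transition, e.left_inv (hA hw.2)]
    exact hw.2
  · rintro ⟨hz, hzA⟩
    refine ⟨e' (e.symm z), ⟨e'.map_source (hA' hzA), ?_⟩, ?_⟩
    · rw [Set.mem_preimage, e'.left_inv (hA' hzA)]
      exact hzA
    · rw [transition, e'.left_inv (hA' hzA), e.right_inv hz]

variable [ChartedSpace ℂ M]

/-- Two charts of the maximal analytic atlas are compatible. -/
theorem transition_holomorphic {e e' : OpenPartialHomeomorph M ℂ} (he : IsCoordinate e)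
    (he' : IsCoordinate e') : DifferentiableOn ℂ (transition e' e) (chartSet e' e.source) := by
  have h1 := (contDiffGroupoid ω 𝓘(ℂ)).compatible_of_mem_maximalAtlas he' he
  have h2 := contMDiffOn_of_mem_contDiffGroupoid h1
  exact (contMDiffOn_iff_contDiffOn.1 h2).differentiableOn (by simp)

/-- Families of functions on the coordinate domains that transform like densities. -/
def IsDensity (D : OpenPartialHomeomorph M ℂ → ℂ → ℝ) : Prop :=
  ∀ e e' : OpenPartialHomeomorph M ℂ, IsCoordinate e → IsCoordinate e' →
    ∀ w ∈ chartSet e' e.source,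
      D e' w = Complex.normSq (deriv (transition e' e) w) * D e (transition e' e w)

namespace IsDensity

variable {D : OpenPartialHomeomorph M ℂ → ℂ → ℝ} {e e' : OpenPartialHomeomorph M ℂ} {A : Set M}

theorem hasFDerivWithinAt_transition (he : IsCoordinate e) (he' : IsCoordinate e')
    (hA : A ⊆ e.source) {w : ℂ} (hw : w ∈ chartSet e' A) :
    HasFDerivWithinAt (transition e' e) (fderiv ℝ (transition e' e) w) (chartSet e' A) w ∧
      |(fderiv ℝ (transition e' e) w).det| = Complex.normSq (deriv (transition e' e) w) := by
  have h1 := (transition_holomorphic he he').differentiableAt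
    ((isOpen_chartSet e' e.open_source).mem_nhds (chartSet_mono e' hA hw))
  refine ⟨(h1.restrictScalars ℝ).hasFDerivAt.hasFDerivWithinAt, ?_⟩
  rw [det_fderiv_holomorphic h1, abs_of_nonneg (Complex.normSq_nonneg _)]

variable [MeasurableSpace M] [BorelSpace M]

/-- Change of variables along the transition map, whose real Jacobian |φ'|² is the factor in the
definition of a density. -/
theorem setLIntegral_eq (hD : IsDensity D) (he : IsCoordinate e) (he' : IsCoordinate e')
    (hAm : MeasurableSet A) (hA : A ⊆ e.source) (hA' : A ⊆ e'.source) :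
    ∫⁻ z in chartSet e A, ENNReal.ofReal (D e z) =
      ∫⁻ z in chartSet e' A, ENNReal.ofReal (D e' z) := by
  rw [← transition_image e e' hA hA', lintegral_image_eq_lintegral_abs_det_fderiv_mul volume
    (measurableSet_chartSet e' hAm) (fun w hw => (hasFDerivWithinAt_transition he he' hA hw).1)
    ((transition_injOn e e').mono (chartSet_mono e' hA))]
  refine setLIntegral_congr_fun (measurableSet_chartSet e' hAm) fun w hw => ?_
  rw [(hasFDerivWithinAt_transition he he' hA hw).2, hD e e' he he' w (chartSet_mono e' hA hw),
    ENNReal.ofReal_mul (Complex.normSq_nonneg _)]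

theorem setIntegral_eq (hD : IsDensity D) (he : IsCoordinate e) (he' : IsCoordinate e')
    (hAm : MeasurableSet A) (hA : A ⊆ e.source) (hA' : A ⊆ e'.source) :
    ∫ z in chartSet e A, D e z = ∫ z in chartSet e' A, D e' z := by
  rw [← transition_image e e' hA hA', integral_image_eq_integral_abs_det_fderiv_smul volume
    (measurableSet_chartSet e' hAm) (fun w hw => (hasFDerivWithinAt_transition he he' hA hw).1)
    ((transition_injOn e e').mono (chartSet_mono e' hA))]
  refine setIntegral_congr_fun (measurableSet_chartSet e' hAm) fun w hw => ?_
  rw [hD e e' he he' w (chartSet_mono e' hA hw), ← (hasFDerivWithinAt_transition he he' hA hw).2,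
    smul_eq_mul]

end IsDensity

/-- Finitely many disjoint Borel subsets of coordinate domains with union `K`. -/
structure IsChartPartition [MeasurableSpace M] (K : Set M) {n : ℕ}
    (e : Fin n → OpenPartialHomeomorph M ℂ) (A : Fin n → Set M) : Prop where
  coord : ∀ i, IsCoordinate (e i)
  meas : ∀ i, MeasurableSet (A i)
  subset : ∀ i, A i ⊆ (e i).source
  disj : Pairwise (Function.onFun Disjoint A)
  union : ⋃ i, A i = K

variable [MeasurableSpace M] [BorelSpace M] {d : ℕ}

/-- A partition is itself admissible in the supremum, which gives one inequality. For the other, cut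
the pieces of a competing family along the partition and move each fragment to the chart of the
partition; there the fragments are disjoint. -/
theorem willmoreEnergy_eq {y : M → Sph d}
    (hD : IsDensity fun e => willmoreDensity (inCoord y e)) {K : Set M} {n : ℕ}
    {e : Fin n → OpenPartialHomeomorph M ℂ} {A : Fin n → Set M} (h : IsChartPartition K e A) :
    willmoreEnergy y K =
      ∑ i, ∫⁻ z in chartSet (e i) (A i), ENNReal.ofReal (willmoreDensity (inCoord y (e i)) z) := by
  apply le_antisymm
  · refine iSup_le fun n' => iSup_le fun e' => iSup_le fun B => iSup_le fun hB => ?_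
    obtain ⟨hc, hm, hs, hK, hd⟩ := hB
    have hSm := fun j => measurableSet_symm_image (e' j) (hm j) (hs j)
    have hSs : ∀ j, (e' j).symm '' B j ⊆ (e' j).source := by
      rintro j _ ⟨z, hz, rfl⟩
      exact (e' j).map_target (hs j hz)
    have h1 : ∀ j, ∫⁻ z in B j, ENNReal.ofReal (willmoreDensity (inCoord y (e' j)) z) =
        ∑ i, ∫⁻ z in chartSet (e i) ((e' j).symm '' B j ∩ A i),
          ENNReal.ofReal (willmoreDensity (inCoord y (e i)) z) := by
      intro j
      have hu : B j = ⋃ i, chartSet (e' j) ((e' j).symm '' B j ∩ A i) := by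
        rw [← chartSet_iUnion, ← Set.inter_iUnion, h.union, Set.inter_eq_left.2 (hK j),
          chartSet_symm_image _ (hs j)]
      have hdis : Pairwise (Function.onFun Disjoint
          fun i => chartSet (e' j) ((e' j).symm '' B j ∩ A i)) :=
        disjoint_chartSet (e' j) fun a b hab =>
          (h.disj hab).mono Set.inter_subset_right Set.inter_subset_right
      conv_lhs => rw [hu]
      rw [lintegral_iUnion (fun i => measurableSet_chartSet _ ((hSm j).inter (h.meas i))) hdis,
        tsum_fintype]
      exact Finset.sum_congr rfl fun i _ => hD.setLIntegral_eq (hc j) (h.coord i)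
        ((hSm j).inter (h.meas i)) (Set.inter_subset_left.trans (hSs j))
        (Set.inter_subset_right.trans (h.subset i))
    rw [Finset.sum_congr rfl fun j _ => h1 j, Finset.sum_comm]
    refine Finset.sum_le_sum fun i _ => ?_
    have hdis : Pairwise (Function.onFun Disjoint
        fun j => chartSet (e i) ((e' j).symm '' B j ∩ A i)) :=
      disjoint_chartSet (e i) fun a b hab =>
        (hd hab).mono Set.inter_subset_left Set.inter_subset_left
    have h2 := lintegral_iUnion (μ := volume)
      (fun j => measurableSet_chartSet (e i) ((hSm j).inter (h.meas i))) hdis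
      fun z => ENNReal.ofReal (willmoreDensity (inCoord y (e i)) z)
    rw [tsum_fintype] at h2
    rw [← h2]
    exact lintegral_mono_set
      (Set.iUnion_subset fun j => chartSet_mono (e i) Set.inter_subset_right)
  · have hsub : ∀ i, (e i).symm '' chartSet (e i) (A i) ⊆ A i := by
      rintro i _ ⟨z, hz, rfl⟩
      exact hz.2
    refine le_iSup_of_le n (le_iSup_of_le e (le_iSup_of_le (fun i => chartSet (e i) (A i))
      (le_iSup_of_le ⟨h.coord, fun i => measurableSet_chartSet _ (h.meas i),
        fun i => Set.inter_subset_left, fun i => (hsub i).trans ?_, fun i j hij =>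
          (h.disj hij).mono (hsub i) (hsub j)⟩ le_rfl)))
    rw [← h.union]
    exact Set.subset_iUnion A i

end Densities

/-! ### Coordinate covers of compact sets -/

section Covers

variable {M : Type*}

/-- The functions `χ_a = ρ_a ∏_{j < a} (1 - ρ_j)`. -/
def partitionFn {n : ℕ} (ρ : Fin n → M → ℝ) (a : Fin n) (p : M) : ℝ :=
  ρ a p * ∏ j ∈ Finset.univ with j < a, (1 - ρ j p)

/-- The sum telescopes to 1 - ∏ (1 - ρ_j), and one factor of the product is zero. -/
theorem sum_partitionFn {n : ℕ} {ρ : Fin n → M → ℝ} {p : M} (hp : ∃ i, ρ i p = 1) :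
    ∑ a, partitionFn ρ a p = 1 := by
  obtain ⟨i, hi⟩ := hp
  have h := Finset.prod_one_sub_ordered Finset.univ fun j => ρ j p
  rw [Finset.prod_eq_zero (Finset.mem_univ i) (by rw [hi, sub_self])] at h
  exact (sub_eq_zero.1 h.symm).symm

variable [TopologicalSpace M] [ChartedSpace ℂ M]

/-- Smooth real functions on a Riemann surface. -/
def IsSmoothFn (χ : M → ℝ) : Prop :=
  ∀ e : OpenPartialHomeomorph M ℂ, IsCoordinate e → ContDiffOn ℝ ∞ (fun z => χ (e.symm z)) e.target

/-- A smooth cut-off function `ρ` with support in a compact subset `S` of a coordinate domain,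
which is `1` on the open set `N`. -/
structure IsCutoff (e : OpenPartialHomeomorph M ℂ) (S N : Set M) (ρ : M → ℝ) : Prop where
  coord : IsCoordinate e
  compact : IsCompact S
  subset : S ⊆ e.source
  isOpen : IsOpen N
  nhds_subset : N ⊆ S
  eq_one : ∀ q ∈ N, ρ q = 1
  eq_zero : ∀ q, q ∉ S → ρ q = 0
  smooth : IsSmoothFn ρ

/-- A bump function in the preferred chart at p, extended by zero. Its compact support is closed
since M is Hausdorff, so the extension is smooth in every coordinate. -/
theorem exists_isCutoff [T2Space M] [IsManifold 𝓘(ℂ) ω M] (p : M) :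
    ∃ e S N ρ, p ∈ N ∧ IsCutoff (M := M) e S N ρ := by
  classical
  set e := chartAt ℂ p
  have he : IsCoordinate e := IsManifold.chart_mem_maximalAtlas p
  have hp : p ∈ e.source := mem_chart_source ℂ p
  obtain ⟨r, hr, hrt⟩ := Metric.nhds_basis_closedBall.mem_iff.1
    (e.open_target.mem_nhds (e.map_source hp))
  let b : ContDiffBump (e p) := ⟨r / 2, r, by positivity, by linarith⟩
  have hSs : e.symm '' Metric.closedBall (e p) r ⊆ e.source := by
    rintro _ ⟨z, hz, rfl⟩
    exact e.map_target (hrt hz)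
  have hS : IsCompact (e.symm '' Metric.closedBall (e p) r) :=
    (isCompact_closedBall _ _).image_of_continuousOn (e.continuousOn_symm.mono hrt)
  have h0 : ∀ q, q ∉ e.symm '' Metric.closedBall (e p) r →
      e.source.indicator (fun q => b (e q)) q = 0 := by
    intro q hq
    by_cases hqe : q ∈ e.source
    · rw [Set.indicator_of_mem hqe]
      refine b.zero_of_le_dist (le_of_not_ge fun h => hq ⟨e q, h, e.left_inv hqe⟩)
    · rw [Set.indicator_of_notMem hqe]
  refine ⟨e, e.symm '' Metric.closedBall (e p) r, e.source ∩ e ⁻¹' Metric.ball (e p) (r / 2),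
    e.source.indicator fun q => b (e q), ⟨hp, Metric.mem_ball_self (by positivity)⟩, he, hS, hSs,
    e.isOpen_inter_preimage Metric.isOpen_ball, ?_, ?_, h0, ?_⟩
  · rintro q ⟨hq, hqb⟩
    refine ⟨e q, Metric.mem_closedBall.2 ?_, e.left_inv hq⟩
    have := Metric.mem_ball.1 hqb
    linarith
  · rintro q ⟨hq, hqb⟩
    rw [Set.indicator_of_mem hq]
    exact b.one_of_mem_closedBall (Metric.ball_subset_closedBall hqb)
  · intro e' he' z hz
    by_cases hzS : e'.symm z ∈ e.symm '' Metric.closedBall (e p) r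
    · have hW := isOpen_chartSet e' e.open_source
      have hzW : z ∈ chartSet e' e.source := ⟨hz, hSs hzS⟩
      have h1 : ContDiffAt ℝ ∞ (fun w => b (transition e' e w)) z :=
        b.contDiff.contDiffAt.comp z ((contDiffOn_real_of_holomorphic hW
          (transition_holomorphic he he')).contDiffAt (hW.mem_nhds hzW))
      refine (h1.congr_of_eventuallyEq ?_).contDiffWithinAt
      filter_upwards [hW.mem_nhds hzW] with w hw
      have hwe : e'.symm w ∈ e.source := hw.2
      exact Set.indicator_of_mem hwe fun q => b (e q)
    · have hW := isOpen_chartSet e' hS.isClosed.isOpen_compl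
      refine ((contDiffAt_const (c := (0 : ℝ))).congr_of_eventuallyEq ?_).contDiffWithinAt
      filter_upwards [hW.mem_nhds ⟨hz, hzS⟩] with w hw
      exact h0 _ hw.2

theorem exists_finite_cutoffs [T2Space M] [IsManifold 𝓘(ℂ) ω M] {K : Set M} (hK : IsCompact K) :
    ∃ (n : ℕ) (e : Fin n → OpenPartialHomeomorph M ℂ) (S N : Fin n → Set M)
      (ρ : Fin n → M → ℝ), (∀ i, IsCutoff (e i) (S i) (N i) (ρ i)) ∧ K ⊆ ⋃ i, N i := by
  choose e S N ρ hp hc using exists_isCutoff (M := M)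
  obtain ⟨t, -, ht⟩ := hK.elim_nhds_subcover N fun p _ => (hc p).isOpen.mem_nhds (hp p)
  refine ⟨t.card, fun i => e (t.equivFin.symm i), fun i => S (t.equivFin.symm i),
    fun i => N (t.equivFin.symm i), fun i => ρ (t.equivFin.symm i), fun i => hc _, fun q hq => ?_⟩
  obtain ⟨p, hpt, hqp⟩ := Set.mem_iUnion₂.1 (ht hq)
  refine Set.mem_iUnion.2 ⟨t.equivFin ⟨p, hpt⟩, ?_⟩
  rwa [Equiv.symm_apply_apply]

/-- A partition of a compact set subordinate to a cover by cut-off functions. -/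
theorem isChartPartition_of_cutoffs [T2Space M] [MeasurableSpace M] [BorelSpace M] {K : Set M}
    (hK : IsCompact K) {n : ℕ} {e : Fin n → OpenPartialHomeomorph M ℂ} {S N : Fin n → Set M}
    {ρ : Fin n → M → ℝ} (hc : ∀ i, IsCutoff (e i) (S i) (N i) (ρ i)) (hKN : K ⊆ ⋃ i, N i) :
    IsChartPartition K e fun i => K ∩ disjointed N i where
  coord i := (hc i).coord
  meas i := hK.isClosed.measurableSet.inter
    (disjointedRec (fun _ _ ht => ht.diff (hc _).isOpen.measurableSet) (hc i).isOpen.measurableSet)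
  subset i := (Set.inter_subset_right.trans (disjointed_subset N i)).trans
    ((hc i).nhds_subset.trans (hc i).subset)
  disj i j hij := (disjoint_disjointed N hij).mono Set.inter_subset_right Set.inter_subset_right
  union := by rw [← Set.inter_iUnion, iUnion_disjointed, Set.inter_eq_left.2 hKN]

theorem isSmoothFn_partitionFn {n : ℕ} {ρ : Fin n → M → ℝ} (hρ : ∀ i, IsSmoothFn (ρ i))
    (a : Fin n) : IsSmoothFn (partitionFn ρ a) := fun e he =>
  (hρ a e he).mul (contDiffOn_prod fun j _ => contDiffOn_const.sub (hρ j e he))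

end Covers

/-! ### Variations -/

section Variations

namespace IsFamily

variable {d : ℕ} {Φ : ℝ → ℂ → Euc d} {I J : Set ℝ} {U W : Set ℂ}

theorem mono (h : IsFamily Φ I U) (hJ : IsOpen J) (hW : IsOpen W) (hJI : J ⊆ I) (hWU : W ⊆ U) :
    IsFamily Φ J W :=
  ⟨hJ, hW, h.smooth.mono (Set.prod_mono hJI hWU), fun t ht z hz => h.sph t (hJI ht) z (hWU hz),
    fun t ht z hz => h.inj t (hJI ht) z (hWU hz)⟩

theorem restrict (h : IsFamily Φ I U) (hW : IsOpen W) (hWU : W ⊆ U) : IsFamily Φ I W :=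
  h.mono h.openI hW subset_rfl hWU

theorem willmoreDensity_nonneg (h : IsFamily Φ I U) {t : ℝ} (ht : t ∈ I) {z : ℂ} (hz : z ∈ U) :
    0 ≤ willmoreDensity (Φ t) z := by
  rw [h.willmoreDensity_eq_sqrt ht hz]
  positivity

end IsFamily

theorem IsConformalOn.restrict {d : ℕ} {f : ℂ → Euc d} {U W : Set ℂ} (h : IsConformalOn f U)
    (hW : IsOpen W) (hWU : W ⊆ U) : IsConformalOn f W :=
  ⟨h.fam.restrict hW hWU, fun z hz => h.conf z (hWU hz)⟩

variable {M : Type*} [TopologicalSpace M] {d : ℕ} {y : M → Sph d}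
  {e e' : OpenPartialHomeomorph M ℂ}

theorem norm_inCoord (y : M → Sph d) (e : OpenPartialHomeomorph M ℂ) (z : ℂ) :
    ‖inCoord y e z‖ = 1 :=
  mem_sphere_zero_iff_norm.1 (y (e.symm z)).2

theorem inCoord_transition (y : M → Sph d) {w : ℂ} (hw : w ∈ chartSet e' e.source) :
    inCoord y e' w = inCoord y e (transition e' e w) := by
  rw [inCoord, inCoord, transition, e.left_inv hw.2]

theorem mapsTo_transition (e e' : OpenPartialHomeomorph M ℂ) :
    Set.MapsTo (transition e' e) (chartSet e' e.source) e.target := fun _ hw => e.map_source hw.2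

variable [ChartedSpace ℂ M]

theorem IsConformalImmersion.isConformalOn (hy : IsConformalImmersion y) (he : IsCoordinate e) :
    IsConformalOn (inCoord y e) e.target where
  fam := ⟨isOpen_univ, e.open_target,
    (hy.smooth e he).comp contDiff_snd.contDiffOn fun _ hq => hq.2,
    fun _ _ z _ => norm_inCoord y e z, fun _ _ z hz => hy.immersion e he z hz⟩
  conf := hy.conformal e he

theorem willmoreOperator_eq_zero_of_chart (hy : IsConformalImmersion y) (he : IsCoordinate e)
    (he' : IsCoordinate e') (h0 : ∀ z ∈ e.target, willmoreOperator (liftIn y e) z = 0) {w : ℂ}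
    (hw : w ∈ chartSet e' e.source) : willmoreOperator (liftIn y e') w = 0 :=
  willmoreOperator_comp (hy.isConformalOn he)
    ((hy.isConformalOn he').restrict (isOpen_chartSet e' e.open_source) Set.inter_subset_left)
    (transition_holomorphic he he') (mapsTo_transition e e') (fun _ hx => inCoord_transition y hx)
    hw (h0 _ (mapsTo_transition e e' hw))

namespace IsVariation

variable {K : Set M} {ε : ℝ} {Φ : ℝ → M → Sph d}

theorem zero_mem (hΦ : IsVariation y K ε Φ) : (0 : ℝ) ∈ Set.Ioo (-ε) ε := by
  have := hΦ.pos
  constructor <;> linarith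

theorem isFamily (hΦ : IsVariation y K ε Φ) (he : IsCoordinate e) :
    IsFamily (fun t => inCoord (Φ t) e) (Set.Ioo (-ε) ε) e.target :=
  ⟨isOpen_Ioo, e.open_target, hΦ.smooth e he, fun t _ z _ => norm_inCoord (Φ t) e z,
    fun t ht z hz => (hΦ.immersion t ht).immersion e he z hz⟩

theorem isFamily_restrict (hΦ : IsVariation y K ε Φ) (he : IsCoordinate e) {A : Set M}
    (hA : IsOpen A) :
    IsFamily (fun t => inCoord (Φ t) e) (Set.Ioo (-ε) ε) (chartSet e A) :=
  (hΦ.isFamily he).restrict (isOpen_chartSet e hA) Set.inter_subset_left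

theorem contDiffOn_transition (he : IsCoordinate e) (he' : IsCoordinate e') :
    ContDiffOn ℝ ∞ (transition e' e) (chartSet e' e.source) :=
  contDiffOn_real_of_holomorphic (isOpen_chartSet e' e.open_source) (transition_holomorphic he he')

/-- Holds for every member of the variation, conformal or not: the real transformation law needs
only |det|, which is |φ'|² for holomorphic transitions. -/
theorem isDensity_willmoreDensity (hΦ : IsVariation y K ε Φ) {t : ℝ} (ht : t ∈ Set.Ioo (-ε) ε) :
    IsDensity fun e => willmoreDensity (inCoord (Φ t) e) := by
  intro e e' he he' w hw
  have h := (hΦ.isFamily he).willmoreDensity_comp (hΦ.isFamily_restrict he' e.open_source)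
    (contDiffOn_transition he he') (mapsTo_transition e e')
    (fun t _ x hx => inCoord_transition (Φ t) hx) ht hw
  rwa [det_jacobian_holomorphic ((transition_holomorphic he he').differentiableAt
    ((isOpen_chartSet e' e.open_source).mem_nhds hw)), abs_of_nonneg (Complex.normSq_nonneg _)] at h

theorem gaussMap_transition (hΦ : IsVariation y K ε Φ) (he : IsCoordinate e)
    (he' : IsCoordinate e') {t : ℝ} (ht : t ∈ Set.Ioo (-ε) ε) {w : ℂ}
    (hw : w ∈ chartSet e' e.source) :
    gaussMap (inCoord (Φ t) e') w = gaussMap (inCoord (Φ t) e) (transition e' e w) :=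
  (hΦ.isFamily he).gaussMap_comp (hΦ.isFamily_restrict he' e.open_source)
    (contDiffOn_transition he he') (mapsTo_transition e e')
    (fun t _ _ hx => inCoord_transition (Φ t) hx) ht hw

end IsVariation

/-- The velocity of the conformal Gauss map along a variation, cut off by a function. -/
def cutVelocity (χ : M → ℝ) (Φ : ℝ → M → Sph d) (e : OpenPartialHomeomorph M ℂ) (z : ℂ) : Op d :=
  χ (e.symm z) • gaussVelocity (fun t => inCoord (Φ t) e) z

/-- The first variation density of a variation, cut off by a function. -/
def cutPairing (χ : M → ℝ) (Φ : ℝ → M → Sph d) (e : OpenPartialHomeomorph M ℂ) : ℂ → ℝ :=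
  dirichletPairing (gaussMap (inCoord (Φ 0) e)) (cutVelocity χ Φ e)

namespace IsVariation

variable {K : Set M} {ε : ℝ} {Φ : ℝ → M → Sph d} {χ : M → ℝ}

theorem smooth_cutVelocity (hΦ : IsVariation y K ε Φ) (hχ : IsSmoothFn χ) (he : IsCoordinate e) :
    ContDiffOn ℝ ∞ (cutVelocity χ Φ e) e.target :=
  (hχ e he).smul ((hΦ.isFamily he).smooth_gaussVelocity hΦ.zero_mem)

theorem cutVelocity_transition (hΦ : IsVariation y K ε Φ) (he : IsCoordinate e)
    (he' : IsCoordinate e') {w : ℂ} (hw : w ∈ chartSet e' e.source) :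
    cutVelocity χ Φ e' w = cutVelocity χ Φ e (transition e' e w) := by
  have h1 : (fun t => gaussMap (inCoord (Φ t) e') w) =ᶠ[nhds 0]
      fun t => gaussMap (inCoord (Φ t) e) (transition e' e w) :=
    Filter.eventually_of_mem (isOpen_Ioo.mem_nhds hΦ.zero_mem) fun t ht =>
      hΦ.gaussMap_transition he he' ht hw
  rw [cutVelocity, cutVelocity, transition, e.left_inv hw.2]
  exact congrArg (χ (e'.symm w) • ·) (h1.deriv_eq (𝕜 := ℝ))

theorem isDensity_cutPairing (hΦ : IsVariation y K ε Φ) (hχ : IsSmoothFn χ) :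
    IsDensity (cutPairing χ Φ) := by
  intro e e' he he' w hw
  have hm := mapsTo_transition e e' hw
  have hW := isOpen_chartSet e' e.open_source
  rw [cutPairing, cutPairing, ← dirichletPairing_comp
    (diffAt e.open_target ((hΦ.isFamily he).gaussMap_slice hΦ.zero_mem) hm)
    (diffAt e.open_target (hΦ.smooth_cutVelocity hχ he) hm)
    ((transition_holomorphic he he').differentiableAt (hW.mem_nhds hw))]
  exact dirichletPairing_congr hW
    (fun x hx => hΦ.gaussMap_transition he he' hΦ.zero_mem hx)
    (fun x hx => hΦ.cutVelocity_transition he he' hx) hw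

/-- Since K is closed, the variation is constant in time on a whole neighbourhood of the point, and
the Gauss map depends only on the germ of the immersion. -/
theorem gaussVelocity_eq_zero (hΦ : IsVariation y K ε Φ) (hK : IsClosed K) (he : IsCoordinate e)
    {z : ℂ} (hz : z ∈ e.target) (hzK : e.symm z ∉ K) :
    gaussVelocity (fun t => inCoord (Φ t) e) z = 0 := by
  have hfam := hΦ.isFamily_restrict he hK.isOpen_compl
  have h0 : IsFamily (fun _ => inCoord y e) (Set.Ioo (-ε) ε) (chartSet e Kᶜ) := by
    have h1 := hfam.slice hΦ.zero_mem
    refine ⟨isOpen_Ioo, hfam.openU, ?_, fun t _ z _ => norm_inCoord y e z, fun t _ z hz => ?_⟩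
    · rw [hΦ.init] at h1
      exact h1.comp contDiff_snd.contDiffOn fun _ hq => hq.2
    · have h2 := hfam.inj 0 hΦ.zero_mem z hz
      rwa [hΦ.init] at h2
  have h1 : (fun t => gaussMap (inCoord (Φ t) e) z) =ᶠ[nhds 0]
      fun _ => gaussMap (inCoord y e) z :=
    Filter.eventually_of_mem (isOpen_Ioo.mem_nhds hΦ.zero_mem) fun t ht =>
      h0.gaussMap_comp hfam contDiffOn_id (Set.mapsTo_id _)
        (fun t ht w hw => by simp only [inCoord, id, hΦ.support t ht _ hw.2]) ht ⟨hz, hzK⟩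
  exact (h1.deriv_eq (𝕜 := ℝ)).trans (deriv_const _ _)

theorem cutVelocity_eq_zero (hΦ : IsVariation y K ε Φ) (hK : IsClosed K) (he : IsCoordinate e)
    {S : Set M} (hχS : ∀ q, q ∉ S → χ q = 0) {z : ℂ} (hz : z ∈ e.target)
    (hzK : e.symm z ∉ K ∩ S) : cutVelocity χ Φ e z = 0 := by
  by_cases h : e.symm z ∈ K
  · rw [cutVelocity, hχS _ fun hS => hzK ⟨h, hS⟩, zero_smul]
  · rw [cutVelocity, hΦ.gaussVelocity_eq_zero hK he hz h, smul_zero]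

theorem dirichletPairing_zero (P : ℂ → Op d) (z : ℂ) : dirichletPairing P (fun _ => 0) z = 0 := by
  simp [dirichletPairing]

theorem cutPairing_eq_zero (hΦ : IsVariation y K ε Φ) (hK : IsClosed K) (he : IsCoordinate e)
    {S : Set M} (hS : IsClosed S) (hχS : ∀ q, q ∉ S → χ q = 0) {z : ℂ} (hz : z ∈ e.target)
    (hzK : e.symm z ∉ K ∩ S) : cutPairing χ Φ e z = 0 :=
  (dirichletPairing_congr (R := cutVelocity χ Φ e) (R' := fun _ => 0)
    (isOpen_chartSet e (hK.inter hS).isOpen_compl) (fun _ _ => rfl)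
    (fun _ hw => hΦ.cutVelocity_eq_zero hK he hχS hw.1 hw.2) ⟨hz, hzK⟩).trans
    (dirichletPairing_zero _ _)

/-- The integral of the first variation density vanishes if the support of the cut-off function
lies in a coordinate domain. -/
theorem setIntegral_cutPairing (hΦ : IsVariation y K ε Φ) (hK : IsClosed K)
    (hy : IsConformalImmersion y) (he : IsCoordinate e)
    (hw : ∀ z ∈ e.target, willmoreOperator (liftIn y e) z = 0) {S : Set M} (hS : IsCompact S)
    (hSe : S ⊆ e.source) (hχ : IsSmoothFn χ) (hχS : ∀ q, q ∉ S → χ q = 0) :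
    IntegrableOn (cutPairing χ Φ e) e.target ∧ ∫ z in e.target, cutPairing χ Φ e z = 0 := by
  have hc := hy.isConformalOn he
  have hU := e.open_target
  have hR := hΦ.smooth_cutVelocity hχ he
  have hfam := hΦ.isFamily he
  have hC : IsCompact (chartSet e (K ∩ S)) :=
    isCompact_chartSet e (hS.inter_left hK) (Set.inter_subset_right.trans hSe)
  have hg : ∀ k, ContDiffOn ℝ ∞ (fun w => ((fderiv ℝ (gaussMap (inCoord y e)) w (coordDir k) *
      cutVelocity χ Φ e w).trace).re) e.target := fun k =>
    Complex.reCLM.contDiff.comp_contDiffOn (contDiffOn_bilin traceB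
      (contDiffOn_fderiv_apply hU hc.gaussMap_smooth (coordDir k)) hR)
  have hk := fun k => setIntegral_fderiv_eq_zero hU hC Set.inter_subset_left (hg k)
    (fun z hz hzC => by
      rw [hΦ.cutVelocity_eq_zero hK he hχS hz fun h => hzC ⟨hz, h⟩]
      simp) (coordDir k)
  have heq : Set.EqOn (cutPairing χ Φ e) (fun z => ∑ k, fderiv ℝ (fun w =>
      ((fderiv ℝ (gaussMap (inCoord y e)) w (coordDir k) * cutVelocity χ Φ e w).trace).re) z
        (coordDir k)) e.target := by
    intro z hz
    -- The splitting is pointwise linear, so it survives multiplication by the cut-off function;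
    -- this is why the velocity of P is cut off, and not the variation.
    have hsp : cutVelocity χ Φ e z = cutVelocity χ Φ e z * gaussMap (inCoord y e) z +
        gaussMap (inCoord y e) z * cutVelocity χ Φ e z := by
      have h1 := hfam.gaussVelocity_split hΦ.zero_mem hz
      rw [hΦ.init] at h1
      rw [cutVelocity]
      conv_lhs => rw [h1]
      rw [smul_add, Matrix.smul_mul, Matrix.mul_smul]
    rw [cutPairing, hΦ.init]
    exact hc.dirichletPairing_eq_divergence hw hR hz hsp
  refine ⟨IntegrableOn.congr_fun ?_ heq.symm hU.measurableSet, ?_⟩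
  · exact integrable_finsetSum _ fun k _ => (hk k).1
  · rw [setIntegral_congr_fun hU.measurableSet heq, integral_finsetSum _ fun k _ => (hk k).1]
    exact Finset.sum_eq_zero fun k _ => (hk k).2

end IsVariation

end Variations

/-! ### The first variation of the Willmore energy -/

section EnergyVariation

variable {M : Type*} [TopologicalSpace M] [ChartedSpace ℂ M] {d : ℕ} {y : M → Sph d}
  {K : Set M} {ε : ℝ} {Φ : ℝ → M → Sph d}

namespace IsVariation

/-- The functions of the partition sum to 1 on K, and off K the velocity vanishes; so the cut-off
velocities add up to the full velocity on the whole coordinate domain, including neighbourhoods of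
boundary points of K. -/
theorem sum_cutPairing (hΦ : IsVariation y K ε Φ) {n : ℕ} {ρ : Fin n → M → ℝ}
    (hρ : ∀ a, IsSmoothFn (ρ a)) (hK : IsClosed K) (hone : ∀ p ∈ K, ∃ i, ρ i p = 1)
    {e : OpenPartialHomeomorph M ℂ} (he : IsCoordinate e) {z : ℂ} (hz : z ∈ e.target) :
    ∑ a, cutPairing (partitionFn ρ a) Φ e z =
      dirichletPairing (gaussMap (inCoord (Φ 0) e))
        (gaussVelocity fun t => inCoord (Φ t) e) z := by
  simp only [cutPairing]
  rw [← dirichletPairing_sum Finset.univ _ fun a _ =>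
    diffAt e.open_target (hΦ.smooth_cutVelocity (isSmoothFn_partitionFn hρ a) he) hz]
  refine dirichletPairing_congr e.open_target (fun _ _ => rfl) (fun w hw => ?_) hz
  simp only [cutVelocity]
  rw [← Finset.sum_smul]
  by_cases h : e.symm w ∈ K
  · rw [sum_partitionFn (hone _ h), one_smul]
  · rw [hΦ.gaussVelocity_eq_zero hK he hw h, smul_zero]

variable [MeasurableSpace M] [BorelSpace M]

/-- The total first variation of the cut-off by one function vanishes. -/
theorem sum_setIntegral_cutPairing [T2Space M] (hΦ : IsVariation y K ε Φ) (hK : IsClosed K)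
    (hy : IsConformalImmersion y) {n : ℕ} {e : Fin n → OpenPartialHomeomorph M ℂ}
    {A : Fin n → Set M} (hA : IsChartPartition K e A) {e₀ : OpenPartialHomeomorph M ℂ}
    (he₀ : IsCoordinate e₀) (hw : ∀ z ∈ e₀.target, willmoreOperator (liftIn y e₀) z = 0)
    {S : Set M} (hS : IsCompact S) (hSe : S ⊆ e₀.source) {χ : M → ℝ} (hχ : IsSmoothFn χ)
    (hχS : ∀ q, q ∉ S → χ q = 0) :
    ∑ i, ∫ z in chartSet (e i) (A i), cutPairing χ Φ (e i) z = 0 := by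
  have hSc : IsClosed S := hS.isClosed
  have hD := hΦ.isDensity_cutPairing hχ
  obtain ⟨hint, hzero⟩ := hΦ.setIntegral_cutPairing hK hy he₀ hw hS hSe hχ hχS
  have hm : ∀ i, MeasurableSet (A i ∩ S) := fun i => (hA.meas i).inter hSc.measurableSet
  have hAK : ∀ i, A i ⊆ K := fun i => hA.union ▸ Set.subset_iUnion A i
  -- The integrand is supported in S, so each piece may be shrunk to A_i ∩ S and moved to the
  -- coordinate `e₀`. There the shrunken pieces are disjoint with union K ∩ S, outside of which the
  -- integrand is zero.
  have h1 : ∀ i, ∫ z in chartSet (e i) (A i), cutPairing χ Φ (e i) z =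
      ∫ z in chartSet e₀ (A i ∩ S), cutPairing χ Φ e₀ z := by
    intro i
    rw [hD.setIntegral_eq he₀ (hA.coord i) (hm i) (Set.inter_subset_right.trans hSe)
      (Set.inter_subset_left.trans (hA.subset i))]
    refine setIntegral_eq_of_subset_of_forall_sdiff_eq_zero
      (measurableSet_chartSet _ (hA.meas i)) (chartSet_mono _ Set.inter_subset_left) ?_
    rintro z ⟨hz, hz'⟩
    exact hΦ.cutPairing_eq_zero hK (hA.coord i) hSc hχS hz.1 fun h => hz' ⟨hz.1, hz.2, h.2⟩
  rw [Finset.sum_congr rfl fun i _ => h1 i, ← integral_iUnion_fintype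
    (fun i => measurableSet_chartSet e₀ (hm i))
    (disjoint_chartSet e₀ fun i j hij =>
      (hA.disj hij).mono Set.inter_subset_left Set.inter_subset_left)
    (fun i => hint.mono_set Set.inter_subset_left), ← hzero]
  refine (setIntegral_eq_of_subset_of_forall_sdiff_eq_zero e₀.open_target.measurableSet
    (Set.iUnion_subset fun i => Set.inter_subset_left) ?_).symm
  rintro z ⟨hz, hz'⟩
  refine hΦ.cutPairing_eq_zero hK he₀ hSc hχS hz fun h => hz' ?_
  rw [← hA.union] at h
  obtain ⟨i, hi⟩ := Set.mem_iUnion.1 h.1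
  exact Set.mem_iUnion.2 ⟨i, hz, hi, h.2⟩

/-- The first variation of the Willmore energy of a conformal immersion. -/
theorem hasDerivAt_willmoreEnergy (hΦ : IsVariation y K ε Φ) (hy : IsConformalImmersion y) {n : ℕ}
    {e : Fin n → OpenPartialHomeomorph M ℂ} {A S : Fin n → Set M} (hA : IsChartPartition K e A)
    (hS : ∀ i, IsCompact (S i)) (hSe : ∀ i, S i ⊆ (e i).source) (hAS : ∀ i, A i ⊆ S i) :
    HasDerivAt (fun t => (willmoreEnergy (Φ t) K).toReal)
      (∑ i, ∫ z in chartSet (e i) (A i), 1 / 2 * dirichletPairing (gaussMap (inCoord (Φ 0) (e i)))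
        (gaussVelocity fun t => inCoord (Φ t) (e i)) z) 0 := by
  have hfam := fun i => hΦ.isFamily (hA.coord i)
  have hc : ∀ i, IsConformalOn (inCoord (Φ 0) (e i)) (e i).target := fun i => by
    rw [hΦ.init]
    exact hy.isConformalOn (hA.coord i)
  have key := fun i => hasDerivAt_setIntegral isOpen_Ioo (e i).open_target hΦ.zero_mem
    (measurableSet_chartSet (e i) (hA.meas i)) (chartSet_mono (e i) (hAS i))
    (isCompact_chartSet (e i) (hS i) (hSe i)) Set.inter_subset_left
    (G := fun t => willmoreDensity (inCoord (Φ t) (e i))) (hfam i).smooth_willmoreDensity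
    (fun z hz => (hfam i).hasDerivAt_willmoreDensity hΦ.zero_mem (hc i) hz)
  refine (HasDerivAt.fun_sum fun i _ => (key i).2.2).congr_of_eventuallyEq ?_
  -- One partition computes the energy for all small t. Its pieces lie in compact subsets of the
  -- coordinate domains, so every term is finite and passes to a real integral.
  filter_upwards [isOpen_Ioo.mem_nhds hΦ.zero_mem] with t ht
  rw [willmoreEnergy_eq (hΦ.isDensity_willmoreDensity ht) hA,
    ENNReal.toReal_sum fun i _ => ((key i).1 t ht).lintegral_lt_top.ne]
  refine Finset.sum_congr rfl fun i _ => ?_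
  rw [integral_eq_lintegral_of_nonneg_ae _ ((key i).1 t ht).aestronglyMeasurable]
  exact (ae_restrict_iff' (measurableSet_chartSet (e i) (hA.meas i))).2
    (Filter.Eventually.of_forall fun z hz => (hfam i).willmoreDensity_nonneg ht hz.1)

/-- Two decompositions interact: the Borel pieces index the integrals, the partition of unity splits
the velocity. Exchanging the two sums leaves, for each function of the partition of unity, a total
integral that vanishes by the divergence theorem in its own chart. -/
theorem hasDerivAt_willmoreEnergy_zero [T2Space M] [IsManifold 𝓘(ℂ) ω M] (hΦ : IsVariation y K ε Φ)
    (hK : IsCompact K) (hy : IsConformalImmersion y)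
    (hw : ∀ e : OpenPartialHomeomorph M ℂ, IsCoordinate e → ∀ z ∈ e.target,
      willmoreOperator (liftIn y e) z = 0) :
    HasDerivAt (fun t => (willmoreEnergy (Φ t) K).toReal) 0 0 := by
  obtain ⟨n, e, S, N, ρ, hc, hKN⟩ := exists_finite_cutoffs hK
  have hA := isChartPartition_of_cutoffs hK hc hKN
  have hAS : ∀ i, K ∩ disjointed N i ⊆ S i := fun i =>
    (Set.inter_subset_right.trans (disjointed_subset N i)).trans (hc i).nhds_subset
  have hone : ∀ p ∈ K, ∃ i, ρ i p = 1 := fun p hp => by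
    obtain ⟨i, hi⟩ := Set.mem_iUnion.1 (hKN hp)
    exact ⟨i, (hc i).eq_one p hi⟩
  have hρ := fun i => (hc i).smooth
  refine (hΦ.hasDerivAt_willmoreEnergy hy hA (fun i => (hc i).compact) (fun i => (hc i).subset)
    hAS).congr_deriv ?_
  have hint : ∀ a i, IntegrableOn (cutPairing (partitionFn ρ a) Φ (e i))
      (chartSet (e i) (K ∩ disjointed N i)) := by
    intro a i
    refine ((ContinuousOn.mono ?_ Set.inter_subset_left).integrableOn_compact
      (isCompact_chartSet (e i) (hc i).compact (hc i).subset)).mono_set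
        (chartSet_mono (e i) (hAS i))
    exact continuousOn_dirichletPairing (e i).open_target
      ((hΦ.isFamily (hc i).coord).gaussMap_slice hΦ.zero_mem)
      (hΦ.smooth_cutVelocity (isSmoothFn_partitionFn hρ a) (hc i).coord)
  have hi : ∀ i, ∫ z in chartSet (e i) (K ∩ disjointed N i),
      1 / 2 * dirichletPairing (gaussMap (inCoord (Φ 0) (e i)))
        (gaussVelocity fun t => inCoord (Φ t) (e i)) z =
      1 / 2 * ∑ a, ∫ z in chartSet (e i) (K ∩ disjointed N i),
        cutPairing (partitionFn ρ a) Φ (e i) z := by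
    intro i
    rw [integral_const_mul, ← integral_finsetSum _ fun a _ => hint a i]
    congr 1
    exact setIntegral_congr_fun (measurableSet_chartSet (e i) (hA.meas i)) fun z hz =>
      (hΦ.sum_cutPairing hρ hK.isClosed hone (hc i).coord hz.1).symm
  rw [Finset.sum_congr rfl fun i _ => hi i, ← Finset.mul_sum, Finset.sum_comm,
    Finset.sum_eq_zero fun a _ => ?_, mul_zero]
  exact hΦ.sum_setIntegral_cutPairing hK.isClosed hy hA (hc a).coord (hw _ (hc a).coord)
    (hc a).compact (hc a).subset (isSmoothFn_partitionFn hρ a) fun q hq => by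
      rw [partitionFn, (hc a).eq_zero q hq, zero_mul]

end IsVariation

end EnergyVariation

/-! ### Assembly of the Willmore equation and criticality -/

/-- H-totally isotropic surfaces satisfy the Willmore equation. -/
theorem IsHTotallyIsotropic.willmoreOperator_eq_zero {M : Type*} [TopologicalSpace M]
    [ChartedSpace ℂ M] {m : ℕ} {y : M → Sph (2 * m)} (hH : IsHTotallyIsotropic y)
    (hy : IsConformalImmersion y) {e : OpenPartialHomeomorph M ℂ} (he : IsCoordinate e) {z : ℂ}
    (hz : z ∈ e.target) : willmoreOperator (liftIn y e) z = 0 := by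
  obtain ⟨e', he', hp, E, hE, hD⟩ := hH.2 (e.symm z)
  exact willmoreOperator_eq_zero_of_chart hy he' he
    (fun w hw => IsAdaptedIsotropicFrame.willmoreOperator_eq_zero (hy.isConformalOn he') hE hD hw)
    ⟨hz, hp⟩

theorem IsConformalImmersion.isWillmore {M : Type*} [TopologicalSpace M] [T2Space M]
    [ChartedSpace ℂ M] [IsManifold 𝓘(ℂ) ω M] {d : ℕ} {y : M → Sph d}
    (hy : IsConformalImmersion y)
    (hw : ∀ e : OpenPartialHomeomorph M ℂ, IsCoordinate e → ∀ z ∈ e.target,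
      willmoreOperator (liftIn y e) z = 0) : IsWillmore y := by
  -- The measurable structure is auxiliary: the energy is defined by integrals over subsets of ℂ
  -- only.
  borelize M
  exact ⟨hy.toIsSmoothImmersion, fun K ε Φ hK hΦ => hΦ.hasDerivAt_willmoreEnergy_zero hK hy hw⟩

end HIsotropic

end

theorem mainTheorem5 {M : Type*} [TopologicalSpace M] [T2Space M] [ChartedSpace ℂ M]
    [IsManifold 𝓘(ℂ) ω M] (m : ℕ) (y : M → HIsotropic.Sph (2 * m))
    (hy : HIsotropic.IsConformalImmersion y) (hH : HIsotropic.IsHTotallyIsotropic y) :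
    HIsotropic.IsWillmore y ∧
      ∀ e : OpenPartialHomeomorph M ℂ, HIsotropic.IsCoordinate e → ∀ z ∈ e.target,
        HIsotropic.willmoreOperator (HIsotropic.liftIn y e) z = 0 := by
  have hw : ∀ e : OpenPartialHomeomorph M ℂ, HIsotropic.IsCoordinate e → ∀ z ∈ e.target,
      HIsotropic.willmoreOperator (HIsotropic.liftIn y e) z = 0 :=
    fun _ he _ hz => hH.willmoreOperator_eq_zero hy he hz
  exact ⟨hy.isWillmore hw, hw⟩
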